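/- Let $k\ge 3$ and $n\ge 1$. A \emph{$(k,n)$-ladder} is a graph obtained as follows. Start with a $k$-cycle $C_1$, all of whose edges are free. For $i=2,\dots,n$, choose a free edge and add a $k$-cycle $C_i$ that consists of this edge and a path through $k-2$ new vertices; then the free edges are exactly the edges whose two end points are both among these new vertices. Given a ladder $L$ with edge set $E$, real costs $c_e$ ($e\in E$) and $q(e,f)$ ($e\ne f$ in $E$) with $q(e,f)=0$ whenever $e$ and $f$ have no common vertex, the adjacent-only quadratic minimum spanning tree problem (AQMST) asks for a spanning tree $T$ of $L$ that minimizes $$z(T)=\sum_{e\in T}\ \sum_{f\in T,\,f\ne e}q(e,f)+\sum_{e\in T}c_e .$$ \textbf{Notation.} Let $L^i$ be the ladder formed by $C_1,\dots,C_i$. Let $k\ge 4$. Label the edges of $C_i$ by $e^i_1,\dots,e^i_k$ so that $e^i_1$ is shared with $C_{i-1}$ (if $i\ge 2$), $e^i_k$ is shared with $C_{i+1}$ (if $i<n$; for $i=n$ it is an edge of $C_n$ whose two end points are not in $L^{n-1}$), $e^i_{k-1}$ and $e^i_{k-2}$ are the two edges of $C_i$ adjacent to $e^i_k$, and $e^i_1,e^i_{k-2},e^i_{k-1},e^i_k$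 are distinct. Let $T^i_1,T^i_2,T^i_3,T^i_4$ denote spanning trees of $L^i$ of minimum cost $z$ among those whose intersection with $\{e^i_k,e^i_{k-1},e^i_{k-2}\}$ is, respectively, $\{e^i_k,e^i_{k-1}\}$, $\{e^i_k,e^i_{k-2}\}$, $\{e^i_{k-1},e^i_{k-2}\}$, $\{e^i_k,e^i_{k-1},e^i_{k-2}\}$. Let $F^i_1,F^i_2,F^i_3$ denote spanning forests of $L^i$ of minimum cost $z$ among those that consist of exactly two trees, one containing one end point of $e^i_k$ and the other one the other end point, and whose intersection with $\{e^i_k,e^i_{k-1},e^i_{k-2}\}$ is, respectively, $\{e^i_{k-1}\}$, $\{e^i_{k-2}\}$, $\{e^i_{k-1},e^i_{k-2}\}$. \textbf{Algorithm (AQMST-$(k,n)$-ladder).} The input is the ladder, given by its cycles $C_1,\dots,C_n$ in order, each listed cyclically, with the shared edges marked, together with the costs. For $k\ge 4$, compute $T^1_1,\dots,T^1_4,F^1_1,F^1_2,F^1_3$ and their costs, and then for $i=2,\dots,n$ compute from the corresponding objects for $i-1$, with their costs, the following minimum cost objects with their costs, where $j$ runs over $1,\dots,4$ for trees and over $1,2,3$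 for forests, and $\ell$ runs over $2,\dots,k-3$: \begin{itemize} \item $T^i_1,\ T^i_2,\ T^i_3$: the best $T^{i-1}_j+(C_i-e^i_1-e)$ with $e=e^i_{k-2},\ e^i_{k-1},\ e^i_k$, respectively; \item $T^i_4$: the best among all $F^{i-1}_j+(C_i-e^i_1)$ and all $T^{i-1}_j+(C_i-e^i_1-e^i_\ell)$; \item $F^i_1,\ F^i_2$: the best $T^{i-1}_j+(C_i-e^i_1-e^i_k-e)$ with $e=e^i_{k-2},\ e^i_{k-1}$, respectively; \item $F^i_3$: the best among all $F^{i-1}_j+(C_i-e^i_1-e^i_k)$ and all $T^{i-1}_j+(C_i-e^i_1-e^i_k-e^i_\ell)$. \end{itemize} Finally output the cheapest of $T^n_1,\dots,T^n_4$ and its cost. For $k=3$, where necessarily $n\le 2$, output the cheapest of the three (if $n=1$) or eight (if $n=2$) spanning trees and its cost. \textbf{Theorem.} Every $(k,n)$-ladder can be presented to the algorithm in this way. On a random access machine on which additions, subtractions and comparisons of real numbers, index arithmetic, input reads and insertions at the head of a linked list take unit time, the algorithm has an implementation and there is an absolute constant $C$ such that for all $k\ge 3$, $n\ge 1$, every $(k,n)$-ladder,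 every presentation of it and all adjacent-only costs, it halts after at most $C\,k\,n$ steps and outputs an optimal solution $T$ of the AQMST on the ladder together with $z(T)$. Moreover, for $k\ge 4$ and every $i=1,\dots,n$, the seven objects that it holds after processing $C_1,\dots,C_i$ are minimum cost objects $T^i_1,\dots,T^i_4,F^i_1,F^i_2,F^i_3$ as defined above, together with their costs. -/

import Mathlib

namespace AQMST

/-! ### Graphs: `(k,n)`-ladders -/

/-- The edges of the cycle `x 0, x 1, …, x (k-1)`, closed by the edge from `x (k-1)` to `x 0`. -/
def cycleEdges {V : Type*} (k : ℕ) (x : ℕ → V) : Set (Sym2 V) :=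
  {e | ∃ t, t < k ∧ e = s(x t, x ((t + 1) % k))}

/-- The recursive construction of `(k,n)`-ladders. `LadderBuild k n W E F` says that fusing `n`
`k`-cycles can produce the graph with vertex set `W`, edge set `E` and set of free edges `F`.
One starts from a `k`-cycle, all of whose edges are free. In each further step a new `k`-cycle
`x 0, …, x (k-1)` is fused along a free edge `s(x 0, x 1)`, its other `k - 2` vertices being new;
afterwards the free edges are those whose two end points are both new. -/
inductive LadderBuild {V : Type*} (k : ℕ) :
    ℕ → Set V → Set (Sym2 V) → Set (Sym2 V) → Prop
  | cycle (x : ℕ → V) (inj : Set.InjOn x (Set.Iio k)) :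
      LadderBuild k 1 (x '' Set.Iio k) (cycleEdges k x) (cycleEdges k x)
  | fuse (n : ℕ) (W : Set V) (E F : Set (Sym2 V)) (x : ℕ → V)
      (prev : LadderBuild k n W E F)
      (inj : Set.InjOn x (Set.Iio k))
      (free : s(x 0, x 1) ∈ F)
      (fresh : ∀ t, 2 ≤ t → t < k → x t ∉ W) :
      LadderBuild k (n + 1) (W ∪ x '' Set.Iio k) (E ∪ cycleEdges k x)
        {e | ∃ t, 2 ≤ t ∧ t + 1 < k ∧ e = s(x t, x (t + 1))}

/-- `G` is a `(k,n)`-ladder (here `k ≥ 3`; the construction forces `n ≥ 1`). -/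
def IsLadder {V : Type*} (k n : ℕ) (G : SimpleGraph V) : Prop :=
  3 ≤ k ∧ ∃ F : Set (Sym2 V), LadderBuild k n Set.univ G.edgeSet F

/-- The way in which a `(k,n)`-ladder is presented to the algorithm: its cycles `C 0, …, C (n-1)`
in the order of the construction, each as a cyclic list `x i 0, …, x i (k-1)` of vertices.
The edge at position `t` of `C i` joins `x i t` and `x i (t+1)`; the edge at position `0` is the
one shared with `C (i-1)`, and the edge at position `pos i` is the one shared with `C (i+1)`
(for the last cycle: any edge both of whose end points are new). The listing of `C 0` may start
anywhere; for `k ≥ 4` it is started so that its edge at position `0` is disjoint from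
its edge at position `pos 0`. -/
structure Labelling {V : Type*} (G : SimpleGraph V) (k n : ℕ) where
  x : ℕ → ℕ → V
  pos : ℕ → ℕ
  inj : ∀ i, i < n → Set.InjOn (x i) (Set.Iio k)
  pos_lt : ∀ i, i < n → pos i < k
  pos_free : 4 ≤ k → ∀ i, i < n → 2 ≤ pos i ∧ pos i + 2 ≤ k
  glue : ∀ i, i + 1 < n →
    s(x (i + 1) 0, x (i + 1) 1) = s(x i (pos i), x i ((pos i + 1) % k))
  fresh : ∀ i, i + 1 < n → ∀ t, 2 ≤ t → t < k →
    ∀ j, j ≤ i → ∀ u, u < k → x (i + 1) t ≠ x j u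
  verts_eq : ∀ v, ∃ i, i < n ∧ ∃ t, t < k ∧ x i t = v
  edges_eq : ∀ e, e ∈ G.edgeSet ↔ ∃ i, i < n ∧ e ∈ cycleEdges k (x i)

namespace Labelling

variable {V : Type*} {G : SimpleGraph V} {k n : ℕ}

/-- The edge at position `t` of the cycle `C i`. -/
def edge (L : Labelling G k n) (i t : ℕ) : Sym2 V := s(L.x i t, L.x i ((t + 1) % k))

/-- The vertices of the ladder formed by the first `m` cycles. -/
def verts (L : Labelling G k n) (m : ℕ) : Set V :=
  {v | ∃ i, i < m ∧ ∃ t, t < k ∧ L.x i t = v}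

/-- The edges of the ladder formed by the first `m` cycles. -/
def edges (L : Labelling G k n) (m : ℕ) : Set (Sym2 V) :=
  {e | ∃ i, i < m ∧ ∃ t, t < k ∧ L.edge i t = e}

/-- The set of edges named by a list of pairs (cycle, position). -/
def edgeFinset [DecidableEq V] (L : Labelling G k n) (l : List (ℕ × ℕ)) : Finset (Sym2 V) :=
  (l.map fun a => L.edge a.1 a.2).toFinset

end Labelling

/-! ### The optimization problem -/

/-- `T` is the edge set of a spanning tree of `G`. -/
def IsSpanningTree {V : Type*} (G : SimpleGraph V) (T : Finset (Sym2 V)) : Prop :=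
  (T : Set (Sym2 V)) ⊆ G.edgeSet ∧ (SimpleGraph.fromEdgeSet (T : Set (Sym2 V))).IsTree

/-- The quadratic objective `z(T)`, a sum over ordered pairs of distinct edges plus linear costs. -/
def cost {V : Type*} [DecidableEq V] (c : Sym2 V → ℝ) (q : Sym2 V → Sym2 V → ℝ)
    (T : Finset (Sym2 V)) : ℝ :=
  (∑ e ∈ T, ∑ f ∈ T.erase e, q e f) + ∑ e ∈ T, c e

/-- Two edges that do not share a vertex have no interaction cost. -/
def AdjacentOnly {V : Type*} (G : SimpleGraph V) (q : Sym2 V → Sym2 V → ℝ) : Prop :=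
  ∀ e ∈ G.edgeSet, ∀ f ∈ G.edgeSet, e ≠ f → (¬ ∃ v, v ∈ e ∧ v ∈ f) → q e f = 0

/-- `T` satisfies `P` and has minimum cost among all edge sets that satisfy `P`. -/
def IsOptimal {V : Type*} (z : Finset (Sym2 V) → ℝ) (P : Finset (Sym2 V) → Prop)
    (T : Finset (Sym2 V)) : Prop :=
  P T ∧ ∀ T', P T' → z T ≤ z T'

/-- The seven objects maintained by the algorithm: four trees and three forests. -/
inductive Entry
  | T1 | T2 | T3 | T4 | F1 | F2 | F3
  deriving DecidableEq

namespace Labelling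

variable {V : Type*} {G : SimpleGraph V} {k n : ℕ}

/-- `T` is a spanning tree of the ladder formed by the first `m` cycles. -/
def SpanningTree (L : Labelling G k n) (m : ℕ) (T : Finset (Sym2 V)) : Prop :=
  (T : Set (Sym2 V)) ⊆ L.edges m ∧
    (SimpleGraph.fromEdgeSet (T : Set (Sym2 V))).IsAcyclic ∧
    ∀ u ∈ L.verts m, ∀ w ∈ L.verts m,
      (SimpleGraph.fromEdgeSet (T : Set (Sym2 V))).Reachable u w

/-- `T` is a spanning forest, made of exactly two trees, of the ladder formed by the first `m`
cycles; one tree contains one end point of the edge at position `pos (m-1)` of the last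
cycle, and the other tree contains the other end point. -/
def SplitForest (L : Labelling G k n) (m : ℕ) (T : Finset (Sym2 V)) : Prop :=
  let H := SimpleGraph.fromEdgeSet (T : Set (Sym2 V))
  let v₁ := L.x (m - 1) (L.pos (m - 1))
  let v₂ := L.x (m - 1) (L.pos (m - 1) + 1)
  (T : Set (Sym2 V)) ⊆ L.edges m ∧ H.IsAcyclic ∧ ¬ H.Reachable v₁ v₂ ∧
    ∀ u ∈ L.verts m, H.Reachable u v₁ ∨ H.Reachable u v₂

/-- The constraint that defines each of the seven objects on the first `m` cycles (`m ≥ 1`).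
In the last of these cycles, `a` is the edge that the next cycle is fused to, and `b`, `b'` are
the two edges of the cycle adjacent to `a`. -/
def Admissible (L : Labelling G k n) (m : ℕ) (j : Entry) (T : Finset (Sym2 V)) : Prop :=
  let a := L.edge (m - 1) (L.pos (m - 1))
  let b := L.edge (m - 1) (L.pos (m - 1) - 1)
  let b' := L.edge (m - 1) (L.pos (m - 1) + 1)
  match j with
  | .T1 => L.SpanningTree m T ∧ a ∈ T ∧ b ∈ T ∧ b' ∉ T
  | .T2 => L.SpanningTree m T ∧ a ∈ T ∧ b ∉ T ∧ b' ∈ T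
  | .T3 => L.SpanningTree m T ∧ a ∉ T ∧ b ∈ T ∧ b' ∈ T
  | .T4 => L.SpanningTree m T ∧ a ∈ T ∧ b ∈ T ∧ b' ∈ T
  | .F1 => L.SplitForest m T ∧ a ∉ T ∧ b ∈ T ∧ b' ∉ T
  | .F2 => L.SplitForest m T ∧ a ∉ T ∧ b ∉ T ∧ b' ∈ T
  | .F3 => L.SplitForest m T ∧ a ∉ T ∧ b ∈ T ∧ b' ∈ T

end Labelling

/-! ### The machine

A random access machine with finitely many registers, which hold natural numbers, real numbers, or
(pointers to) immutable linked lists of edge names. An edge name is a pair (cycle, position). The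
input can be read at random. Every node of every evaluated expression, every assignment, every
test and every round of a loop costs one step. -/

/-- The input: `k`, `n`, the positions of the shared edges, and the costs by edge names. -/
structure Input where
  k : ℕ
  n : ℕ
  pos : ℕ → ℕ
  c : ℕ × ℕ → ℝ
  q : ℕ × ℕ → ℕ × ℕ → ℝ

/-- Registers for natural numbers. -/
inductive NReg
  | cyc | pos | t | del₁ | del₂ | bestDel₁ | bestDel₂
  deriving DecidableEq

/-- Registers for real numbers. -/
inductive RReg
  | z (j : Entry) | newZ (j : Entry) | x (j : Entry) | y (j : Entry)
  | path | rest | cand | best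
  deriving DecidableEq

/-- Registers for lists of edge names. -/
inductive LReg
  | tree (j : Entry) | newTree (j : Entry) | src | out
  deriving DecidableEq

/-- The contents of the registers. -/
structure State where
  nat : NReg → ℕ
  real : RReg → ℝ
  list : LReg → List (ℕ × ℕ)

/-- Expressions for natural numbers; `sub` is truncated subtraction. -/
inductive NExp
  | reg (r : NReg) | num (m : ℕ) | k | n | pos (a : NExp) | add (a b : NExp) | sub (a b : NExp)

/-- Expressions for edge names. -/
structure EExp where
  cyc : NExp
  pos : NExp

/-- Expressions for real numbers. -/
inductive RExp
  | reg (r : RReg) | zero | c (e : EExp) | q (e f : EExp) | add (a b : RExp) | sub (a b : RExp)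

/-- Expressions for lists. -/
inductive LExp
  | nil | reg (r : LReg) | cons (e : EExp) (r : LReg)

/-- Tests. -/
inductive BExp
  | lt (a b : NExp) | eq (a b : NExp) | rlt (a b : RExp) | or (a b : BExp) | not (a : BExp)

/-- Programs. `loop r lo hi p` runs `p` for `r = lo, …, hi - 1`, the bounds being evaluated once. -/
inductive Cmd
  | skip
  | nat (r : NReg) (e : NExp)
  | real (r : RReg) (e : RExp)
  | list (r : LReg) (e : LExp)
  | seq (p p' : Cmd)
  | ite (b : BExp) (p p' : Cmd)
  | loop (r : NReg) (lo hi : NExp) (p : Cmd)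

def NExp.eval (I : Input) (s : State) : NExp → ℕ
  | .reg r => s.nat r
  | .num m => m
  | .k => I.k
  | .n => I.n
  | .pos a => I.pos (a.eval I s)
  | .add a b => a.eval I s + b.eval I s
  | .sub a b => a.eval I s - b.eval I s

def NExp.size : NExp → ℕ
  | .reg _ => 1
  | .num _ => 1
  | .k => 1
  | .n => 1
  | .pos a => a.size + 1
  | .add a b => a.size + b.size + 1
  | .sub a b => a.size + b.size + 1

def EExp.eval (I : Input) (s : State) (e : EExp) : ℕ × ℕ := (e.cyc.eval I s, e.pos.eval I s)

def EExp.size (e : EExp) : ℕ := e.cyc.size + e.pos.size + 1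

def RExp.eval (I : Input) (s : State) : RExp → ℝ
  | .reg r => s.real r
  | .zero => 0
  | .c e => I.c (e.eval I s)
  | .q e f => I.q (e.eval I s) (f.eval I s)
  | .add a b => a.eval I s + b.eval I s
  | .sub a b => a.eval I s - b.eval I s

def RExp.size : RExp → ℕ
  | .reg _ => 1
  | .zero => 1
  | .c e => e.size + 1
  | .q e f => e.size + f.size + 1
  | .add a b => a.size + b.size + 1
  | .sub a b => a.size + b.size + 1

def LExp.eval (I : Input) (s : State) : LExp → List (ℕ × ℕ)
  | .nil => []
  | .reg r => s.list r
  | .cons e r => e.eval I s :: s.list r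

def LExp.size : LExp → ℕ
  | .nil => 1
  | .reg _ => 1
  | .cons e _ => e.size + 2

def BExp.holds (I : Input) (s : State) : BExp → Prop
  | .lt a b => a.eval I s < b.eval I s
  | .eq a b => a.eval I s = b.eval I s
  | .rlt a b => a.eval I s < b.eval I s
  | .or a b => a.holds I s ∨ b.holds I s
  | .not a => ¬ a.holds I s

def BExp.size : BExp → ℕ
  | .lt a b => a.size + b.size + 1
  | .eq a b => a.size + b.size + 1
  | .rlt a b => a.size + b.size + 1
  | .or a b => a.size + b.size + 1
  | .not a => a.size + 1

def State.setNat (s : State) (r : NReg) (v : ℕ) : State :=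
  { s with nat := Function.update s.nat r v }

def State.setReal (s : State) (r : RReg) (v : ℝ) : State :=
  { s with real := Function.update s.real r v }

def State.setList (s : State) (r : LReg) (v : List (ℕ × ℕ)) : State :=
  { s with list := Function.update s.list r v }

open Classical in
/-- Runs a program; returns the final state and the number of steps. -/
noncomputable def Cmd.exec (I : Input) : Cmd → State → State × ℕ
  | .skip, s => (s, 1)
  | .nat r e, s => (s.setNat r (e.eval I s), e.size + 1)
  | .real r e, s => (s.setReal r (e.eval I s), e.size + 1)
  | .list r e, s => (s.setList r (e.eval I s), e.size + 1)
  | .seq p p', s => ((p'.exec I (p.exec I s).1).1, (p.exec I s).2 + (p'.exec I (p.exec I s).1).2)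
  | .ite b p p', s =>
      if b.holds I s then ((p.exec I s).1, (p.exec I s).2 + b.size + 1)
      else ((p'.exec I s).1, (p'.exec I s).2 + b.size + 1)
  | .loop r lo hi p, s =>
      (List.range' (lo.eval I s) (hi.eval I s - lo.eval I s)).foldl
        (fun o v => ((p.exec I (o.1.setNat r v)).1, o.2 + (p.exec I (o.1.setNat r v)).2 + 1))
        (s, lo.size + hi.size + 1)

/-! ### The algorithm -/

/-- Sequential composition of a list of programs. -/
def seqs : List Cmd → Cmd
  | [] => .skip
  | p :: ps => .seq p (seqs ps)

/-- `if b then p`. -/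
def cond (b : BExp) (p : Cmd) : Cmd := .ite b p .skip

/-- The cost of the unordered pair of edges `e`, `f`. -/
def pairCost (e f : EExp) : RExp := .add (.q e f) (.q f e)

/-- The sum of a list of expressions. -/
def sumExp : List RExp → RExp
  | [] => .zero
  | a :: as => .add a (sumExp as)

/-- The edge at position `p` of the current cycle. -/
def here (p : NExp) : EExp := ⟨.reg .cyc, p⟩

/-- `r := r + e`. -/
def incr (r : RReg) (e : RExp) : Cmd := .real r (.add (.reg r) e)

/-- `r := r - e`. -/
def decr (r : RReg) (e : RExp) : Cmd := .real r (.sub (.reg r) e)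

/-- The names of the four trees. -/
def trees : List Entry := [.T1, .T2, .T3, .T4]

/-- The names of the three forests. -/
def forests : List Entry := [.F1, .F2, .F3]

/-- `path` := cost of the edges at positions `1, …, k-1` of the current cycle. -/
def pathCost : Cmd :=
  seqs [.real .path (.c (here (.num 1))),
    .loop .t (.num 2) .k
      (incr .path (.add (.c (here (.reg .t)))
        (pairCost (here (.sub (.reg .t) (.num 1))) (here (.reg .t)))))]

/-- Chooses the edges to be deleted from the current cycle besides the one at position `0`,
and sets `rest` to the cost of the remaining edges; the position `0` stands for no
further deletion. -/
def setDel (a b : NExp) : Cmd :=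
  seqs [.nat .del₁ a, .nat .del₂ b, .real .rest (.reg .path),
    cond (.lt (.num 0) (.reg .del₁))
      (seqs [decr .rest (.c (here (.reg .del₁))),
        cond (.lt (.num 1) (.reg .del₁))
          (decr .rest (pairCost (here (.sub (.reg .del₁) (.num 1))) (here (.reg .del₁)))),
        cond (.lt (.add (.reg .del₁) (.num 1)) .k)
          (decr .rest (pairCost (here (.reg .del₁)) (here (.add (.reg .del₁) (.num 1)))))]),
    cond (.lt (.num 0) (.reg .del₂))
      (seqs [decr .rest (.c (here (.reg .del₂))),
        cond (.lt (.num 1) (.reg .del₂))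
          (cond (.not (.eq (.sub (.reg .del₂) (.num 1)) (.reg .del₁)))
            (decr .rest (pairCost (here (.sub (.reg .del₂) (.num 1))) (here (.reg .del₂))))),
        cond (.lt (.add (.reg .del₂) (.num 1)) .k)
          (cond (.not (.eq (.add (.reg .del₂) (.num 1)) (.reg .del₁)))
            (decr .rest (pairCost (here (.reg .del₂)) (here (.add (.reg .del₂) (.num 1))))))])]

/-- `cand` := cost of the old object `j` together with the remaining edges of the current cycle.
The registers `x j` and `y j` hold the interaction costs of the old object `j` with the edges at
positions `1` and `k-1`. -/
def candidate (j : Entry) : Cmd :=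
  seqs [.real .cand (.add (.reg .rest) (.reg (.z j))),
    cond (.not (.or (.eq (.reg .del₁) (.num 1)) (.eq (.reg .del₂) (.num 1))))
      (incr .cand (.reg (.x j))),
    cond (.not (.or (.eq (.reg .del₁) (.sub .k (.num 1))) (.eq (.reg .del₂) (.sub .k (.num 1)))))
      (incr .cand (.reg (.y j)))]

/-- Makes the candidate built on the old object `j` the best one. -/
def take (j : Entry) : Cmd :=
  seqs [.real .best (.reg .cand), .nat .bestDel₁ (.reg .del₁), .nat .bestDel₂ (.reg .del₂),
    .list .src (.reg (.tree j))]

/-- The first candidate of a minimization. -/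
def start (j : Entry) : Cmd := seqs [candidate j, take j]

/-- A further candidate of a minimization. -/
def consider (j : Entry) : Cmd :=
  seqs [candidate j, cond (.rlt (.reg .cand) (.reg .best)) (take j)]

/-- Stores the best candidate as the new object `j`. -/
def commit (j : Entry) : Cmd :=
  seqs [.loop .t (.num 1) .k
      (cond (.not (.or (.eq (.reg .t) (.reg .bestDel₁)) (.eq (.reg .t) (.reg .bestDel₂))))
        (.list .src (.cons (here (.reg .t)) .src))),
    .list (.newTree j) (.reg .src), .real (.newZ j) (.reg .best)]

/-- The new object `j` is the best of the four old trees, each with the current cycle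
minus the edges at positions `0`, `a`, `b`. -/
def fromTrees (j : Entry) (a b : NExp) : Cmd :=
  seqs [setDel a b, start .T1, consider .T2, consider .T3, consider .T4, commit j]

/-- The new object `j` is the best of the following: the three old forests, each with the current
cycle minus the edges at positions `0`, `a`; and the four old trees, each with the current
cycle minus the edges at positions `0`, `a` and one further edge that is neither at
position `pos` nor adjacent to the edge at position `pos`. -/
def fromForests (j : Entry) (a : NExp) : Cmd :=
  seqs [setDel a (.num 0), start .F1, consider .F2, consider .F3,
    .loop .t (.num 1) .k
      (cond (.or (.lt (.add (.reg .t) (.num 1)) (.reg .pos))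
          (.lt (.add (.reg .pos) (.num 1)) (.reg .t)))
        (seqs [setDel a (.reg .t), consider .T1, consider .T2, consider .T3, consider .T4])),
    commit j]

/-- Replaces the seven objects by those of the ladder with the current cycle included. -/
def update : Cmd :=
  seqs [.nat .pos (.pos (.reg .cyc)), pathCost,
    fromTrees .T1 (.add (.reg .pos) (.num 1)) (.num 0),
    fromTrees .T2 (.sub (.reg .pos) (.num 1)) (.num 0),
    fromTrees .T3 (.reg .pos) (.num 0),
    fromForests .T4 (.num 0),
    fromTrees .F1 (.reg .pos) (.add (.reg .pos) (.num 1)),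
    fromTrees .F2 (.reg .pos) (.sub (.reg .pos) (.num 1)),
    fromForests .F3 (.reg .pos),
    seqs ((trees ++ forests).map fun j =>
      seqs [.real (.z j) (.reg (.newZ j)), .list (.tree j) (.reg (.newTree j))])]

/-- The first cycle: its trees and forests are obtained by fusing it to the single edge at
position `0` (whose only spanning tree is the edge itself, and whose only spanning forest
made of two trees is empty). -/
def init : Cmd :=
  seqs [.nat .cyc (.num 0),
    seqs (trees.map fun j =>
      seqs [.real (.z j) (.c (here (.num 0))), .list .src .nil,
        .list (.tree j) (.cons (here (.num 0)) .src),
        .real (.x j) (pairCost (here (.num 1)) (here (.num 0))),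
        .real (.y j) (pairCost (here (.sub .k (.num 1))) (here (.num 0)))]),
    seqs (forests.map fun j =>
      seqs [.real (.z j) .zero, .list (.tree j) .nil, .real (.x j) .zero, .real (.y j) .zero]),
    update]

/-- The index of the previous cycle. -/
def prevCyc : NExp := .sub (.reg .cyc) (.num 1)

/-- The edge of the previous cycle that is shared with the current one. -/
def prevA : EExp := ⟨prevCyc, .pos prevCyc⟩

/-- One neighbour of the shared edge in the previous cycle. -/
def prevB : EExp := ⟨prevCyc, .sub (.pos prevCyc) (.num 1)⟩

/-- The other neighbour of the shared edge in the previous cycle. -/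
def prevB' : EExp := ⟨prevCyc, .add (.pos prevCyc) (.num 1)⟩

/-- Which of the three edges `prevA`, `prevB`, `prevB'` belong to the old object `j`. -/
def contents : Entry → List EExp
  | .T1 => [prevA, prevB]
  | .T2 => [prevA, prevB']
  | .T3 => [prevB, prevB']
  | .T4 => [prevA, prevB, prevB']
  | .F1 => [prevB]
  | .F2 => [prevB']
  | .F3 => [prevB, prevB']

/-- One round of the main loop, for the current cycle `cyc ≥ 1`. -/
def round : Cmd :=
  seqs [seqs ((trees ++ forests).map fun j =>
      seqs [.real (.x j) (sumExp ((contents j).map (pairCost (here (.num 1))))),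
        .real (.y j) (sumExp ((contents j).map (pairCost (here (.sub .k (.num 1))))))]),
    update]

/-- Processes the cycles `0, …, m-1` (`m ≥ 1`). -/
def sweep (m : NExp) : Cmd := .seq init (.loop .cyc (.num 1) m round)

/-- Selects the best of the four trees of the whole ladder. -/
def finish : Cmd :=
  seqs [.real .best (.reg (.z .T1)), .list .out (.reg (.tree .T1)),
    seqs ([Entry.T2, .T3, .T4].map fun j =>
      cond (.rlt (.reg (.z j)) (.reg .best))
        (seqs [.real .best (.reg (.z j)), .list .out (.reg (.tree j))]))]

/-- The cost of an explicitly listed set of edges. -/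
def listCost : List EExp → RExp
  | [] => .zero
  | e :: es => .add (.add (.c e) (sumExp (es.map (pairCost e)))) (listCost es)

/-- Makes an explicitly listed tree, of cost `cand`, the best one. -/
def takeList (es : List EExp) : Cmd :=
  seqs [.real .best (.reg .cand), .list .out .nil, seqs (es.map fun e => .list .out (.cons e .out))]

/-- The first explicitly listed tree. -/
def startList (es : List EExp) : Cmd := seqs [.real .cand (listCost es), takeList es]

/-- A further explicitly listed tree. -/
def considerList (es : List EExp) : Cmd :=
  seqs [.real .cand (listCost es), cond (.rlt (.reg .cand) (.reg .best)) (takeList es)]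

/-- The edge at position `t` of cycle `i`, for fixed numbers `i`, `t`. -/
def fixed (i t : ℕ) : EExp := ⟨.num i, .num t⟩

/-- The case `k = 3`, in which `n ≤ 2`: the three spanning trees of a triangle, or the eight
spanning trees of two triangles with a common edge. -/
def small : Cmd :=
  .ite (.eq .n (.num 1))
    (seqs [startList [fixed 0 0, fixed 0 1], considerList [fixed 0 0, fixed 0 2],
      considerList [fixed 0 1, fixed 0 2]])
    (seqs [startList [fixed 0 0, fixed 0 1, fixed 1 1],
      considerList [fixed 0 0, fixed 0 1, fixed 1 2],
      considerList [fixed 0 0, fixed 0 2, fixed 1 1],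
      considerList [fixed 0 0, fixed 0 2, fixed 1 2],
      considerList [fixed 0 1, fixed 0 2, fixed 1 1],
      considerList [fixed 0 1, fixed 0 2, fixed 1 2],
      .loop .t (.num 0) (.num 3)
        (cond (.not (.eq (.reg .t) (.pos (.num 0))))
          (considerList [⟨.num 0, .reg .t⟩, fixed 1 1, fixed 1 2]))])

/-- The AQMST-`(k,n)`-ladder algorithm. It leaves the tree in the list register `out` and its cost
in the real register `best`. -/
def ladderAlgorithm : Cmd :=
  .ite (.lt .k (.num 4)) small (.seq (sweep .n) finish)

/-- The instance of the problem as it is presented to the machine. -/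
def Labelling.input {V : Type*} {G : SimpleGraph V} {k n : ℕ} (L : Labelling G k n)
    (c : Sym2 V → ℝ) (q : Sym2 V → Sym2 V → ℝ) : Input where
  k := k
  n := n
  pos := L.pos
  c := fun a => c (L.edge a.1 a.2)
  q := fun a b => q (L.edge a.1 a.2) (L.edge b.1 b.2)

end AQMST

/-!
The proof is a transfer argument. Let `C` be the last cycle of `Lⁱ`, sharing the edge `e` with
`Lⁱ⁻¹`. A spanning tree of `Lⁱ` either misses one edge of the path `C - e`, and is then a spanning
tree of `Lⁱ⁻¹` together with the rest of that path, or contains the whole path, and is then a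
two-tree forest of `Lⁱ⁻¹` separating the end points of `e` together with that path. Split forests of
`Lⁱ` arise from trees of `Lⁱ` by deleting the next shared edge. The first cycle obeys the same rule
if `L⁰` is read as the single edge `e`.

As only adjacent edges interact, the cost of such a union is the cost of the old part, plus that of
the new part, plus interactions that involve only `e` and its two neighbours in `Lⁱ⁻¹`: the end
points of `e` lie on no cycle before `Cᵢ₋₁`, so no other old edge meets `C - e`. Hence the cheapest
old object in each of the seven classes is all that matters. The cost of a path with one or two
edges removed is obtained from that of the full path by local corrections, so a candidate costs
constant time and a cycle time `O(k)`.
-/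

namespace AQMST

/-! ### Spanning trees and split forests of vertex sets -/

section Forests

open SimpleGraph

variable {V : Type*} {H : SimpleGraph V} {W : Set V} {u v w a b : V}

/-- `H` is a forest in which all vertices of `W` lie in the same tree: if `W` contains the end
points of all edges of `H`, a spanning tree of `W`. Allowing `W ≠ univ` lets one compare the trees
of a graph and of its subgraphs without changing the vertex type. -/
def Spans (H : SimpleGraph V) (W : Set V) : Prop :=
  H.IsAcyclic ∧ ∀ u ∈ W, ∀ w ∈ W, H.Reachable u w

/-- `H` is a forest in which every vertex of `W` lies in exactly one of the trees of `u` and `v`,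
which are different: what remains of a spanning tree of `W` when the edge `s(u, v)` is deleted. -/
def Splits (H : SimpleGraph V) (W : Set V) (u v : V) : Prop :=
  H.IsAcyclic ∧ ¬ H.Reachable u v ∧ ∀ w ∈ W, H.Reachable w u ∨ H.Reachable w v

theorem splits_comm : Splits H W u v ↔ Splits H W v u := by
  simp only [Splits, reachable_comm (u := u) (v := v), or_comm]

theorem reachable_sup_edge_iff :
    (H ⊔ edge u v).Reachable a b ↔ H.Reachable a b ∨
      (H.Reachable a u ∧ H.Reachable v b) ∨ (H.Reachable a v ∧ H.Reachable u b) := by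
  have huv : (H ⊔ edge u v).Reachable u v := by
    by_cases h : u = v
    · rw [h]
    · exact Adj.reachable (Or.inr (by simp [edge_adj, h]))
  constructor
  · rintro ⟨p⟩
    induction p with
    | nil => exact Or.inl .rfl
    | cons hadj _ ih =>
      rcases hadj with hadj | hadj
      · have hreach := hadj.reachable
        exact ih.imp hreach.trans (Or.imp (And.imp_left hreach.trans) (And.imp_left hreach.trans))
      · rw [edge_adj] at hadj
        obtain ⟨⟨rfl, rfl⟩ | ⟨rfl, rfl⟩, -⟩ := hadj
        · rcases ih with h | ⟨-, h⟩ | ⟨-, h⟩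
          exacts [.inr (.inl ⟨.rfl, h⟩), .inr (.inl ⟨.rfl, h⟩), .inl h]
        · rcases ih with h | ⟨-, h⟩ | ⟨-, h⟩
          exacts [.inr (.inr ⟨.rfl, h⟩), .inl h, .inr (.inr ⟨.rfl, h⟩)]
  · have hle : H ≤ H ⊔ edge u v := le_sup_left
    rintro (h | ⟨hau, hvb⟩ | ⟨hav, hub⟩)
    · exact h.mono hle
    · exact (hau.mono hle).trans (huv.trans (hvb.mono hle))
    · exact (hav.mono hle).trans (huv.symm.trans (hub.mono hle))

theorem isAcyclic_sup_edge_iff (huv : u ≠ v) (hadj : ¬ H.Adj u v) :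
    (H ⊔ edge u v).IsAcyclic ↔ H.IsAcyclic ∧ ¬ H.Reachable u v := by
  simp [isAcyclic_sup_fromEdgeSet_iff, huv, hadj]

theorem spans_sup_edge_iff (huv : u ≠ v) (hadj : ¬ H.Adj u v) (hu : u ∈ W) :
    Spans (H ⊔ edge u v) W ↔ Splits H W u v := by
  simp only [Spans, Splits, isAcyclic_sup_edge_iff huv hadj, reachable_sup_edge_iff]
  refine ⟨fun ⟨⟨hacyc, hnot⟩, hconn⟩ => ⟨hacyc, hnot, fun w hw => ?_⟩,
    fun ⟨hacyc, hnot, hsplit⟩ => ⟨⟨hacyc, hnot⟩, fun a ha b hb => ?_⟩⟩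
  · rcases hconn w hw u hu with h | ⟨h, -⟩ | ⟨h, -⟩
    exacts [.inl h, .inl h, .inr h]
  · rcases hsplit a ha with h | h <;> rcases hsplit b hb with h' | h'
    exacts [.inl (h.trans h'.symm), .inr (.inl ⟨h, h'.symm⟩), .inr (.inr ⟨h, h'.symm⟩),
      .inl (h.trans h'.symm)]

theorem splits_fromEdgeSet_iff {T : Set (Sym2 V)} (huv : u ≠ v) (hu : u ∈ W) :
    Splits (fromEdgeSet T) W u v ↔ s(u, v) ∉ T ∧ Spans (fromEdgeSet (insert s(u, v) T)) W := by
  have hinsert : fromEdgeSet (insert s(u, v) T) = fromEdgeSet T ⊔ edge u v := by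
    rw [Set.insert_eq, fromEdgeSet_union, sup_comm]
    rfl
  rw [hinsert]
  by_cases huvT : s(u, v) ∈ T
  · have hreach : (fromEdgeSet T).Reachable u v :=
      Adj.reachable ((fromEdgeSet_adj T).2 ⟨huvT, huv⟩)
    exact iff_of_false (fun h => h.2.1 hreach) (fun h => h.1 huvT)
  · rw [spans_sup_edge_iff huv (fun h => huvT ((fromEdgeSet_adj T).1 h).1) hu,
      and_iff_right huvT]

theorem reachable_iff_eq_of_isIsolated (hw : H.IsIsolated w) : H.Reachable a w ↔ a = w := by
  refine ⟨fun h => ?_, fun h => h ▸ .rfl⟩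
  obtain ⟨p⟩ := h.symm
  cases p with
  | nil => rfl
  | cons hadj => exact absurd hadj (hw _)

theorem not_spans_of_isIsolated (hw : H.IsIsolated w) (hwW : w ∈ W) (hu : u ∈ W) (huw : u ≠ w) :
    ¬ Spans H W := fun h =>
  huw ((reachable_iff_eq_of_isIsolated hw).1 (h.2 u hu w hwW))

theorem splits_insert_iff_of_isIsolated (hw : H.IsIsolated w) (hwW : w ∉ W) (hu : u ∈ W) :
    Splits H (insert w W) u w ↔ Spans H W := by
  have hiso : ∀ a ∈ W, ¬ H.Reachable a w := fun a ha h =>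
    hwW ((reachable_iff_eq_of_isIsolated hw).1 h ▸ ha)
  refine ⟨fun ⟨hacyc, _, hsplit⟩ => ⟨hacyc, fun a ha b hb => ?_⟩,
    fun ⟨hacyc, hconn⟩ => ⟨hacyc, hiso u hu, fun a ha => ?_⟩⟩
  · have hto : ∀ a ∈ W, H.Reachable a u := fun a ha =>
      (hsplit a (Set.mem_insert_of_mem w ha)).resolve_right (hiso a ha)
    exact (hto a ha).trans (hto b hb).symm
  · exact ha.elim (fun h => .inr (h ▸ .rfl)) (fun h => .inl (hconn a h u hu))

theorem spans_pendant_iff (hw : H.IsIsolated w) (hwW : w ∉ W) (hv : v ∈ W) :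
    Spans (H ⊔ edge v w) (insert w W) ↔ Spans H W := by
  rw [spans_sup_edge_iff (ne_of_mem_of_not_mem hv hwW) (fun h => hw v h.symm)
    (Set.mem_insert_of_mem w hv), splits_insert_iff_of_isIsolated hw hwW hv]

theorem splits_pendant_iff (hw : H.IsIsolated w) (hwW : w ∉ W) (hu : u ∈ W) (hv : v ∈ W) :
    Splits (H ⊔ edge v w) (insert w W) u w ↔ Splits H W u v := by
  have hvw : v ≠ w := ne_of_mem_of_not_mem hv hwW
  have hreach : ∀ {a b}, a ∈ W →
      ((H ⊔ edge v w).Reachable a b ↔ H.Reachable a b ∨ (H.Reachable a v ∧ b = w)) := by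
    intro a b ha
    have haw : a ≠ w := ne_of_mem_of_not_mem ha hwW
    simp [reachable_sup_edge_iff, reachable_comm (u := w), reachable_iff_eq_of_isIsolated hw, haw]
  have hiso : ∀ {a}, a ∈ W → ¬ H.Reachable a w := fun ha h =>
    hwW ((reachable_iff_eq_of_isIsolated hw).1 h ▸ ha)
  simp only [Splits, isAcyclic_sup_edge_iff hvw (fun h => hw v h.symm), hreach hu, hiso hu, hiso hv,
    Set.forall_mem_insert, Reachable.refl, or_true, true_and, not_false_eq_true, and_true, false_or]
  refine and_congr_right fun _ => and_congr_right fun _ => forall₂_congr fun a ha => ?_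
  rw [hreach ha, hreach ha]
  simp [hiso ha, ne_of_mem_of_not_mem hu hwW]

/-! ### Fusing a cycle -/

/-- The edge at position `t` of the cycle `x 0, …, x (k-1)`. -/
def cycleEdge (k : ℕ) (x : ℕ → V) (t : ℕ) : Sym2 V := s(x t, x ((t + 1) % k))

/-- `H` together with the edges of the cycle `x 0, …, x (k-1)` at the positions in `S`. -/
def withCycleEdges (H : SimpleGraph V) (k : ℕ) (x : ℕ → V) (S : Finset ℕ) : SimpleGraph V :=
  H ⊔ fromEdgeSet (Set.image (cycleEdge k x) S)

/-- `W` together with the vertices `x 2, …, x m` of a path that starts at `x 1`. -/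
def extendVerts (W : Set V) (x : ℕ → V) (m : ℕ) : Set V := W ∪ x '' Set.Icc 2 m

/-- `x 0, …, x (k-1)` is a cycle of which exactly the vertices `x 0` and `x 1` belong to `W`. -/
structure Attached (k : ℕ) (x : ℕ → V) (W : Set V) : Prop where
  three_le : 3 ≤ k
  inj : Set.InjOn x (Set.Iio k)
  mem_zero : x 0 ∈ W
  mem_one : x 1 ∈ W
  fresh : ∀ t, 2 ≤ t → t < k → x t ∉ W

variable {k m : ℕ} {x : ℕ → V} {S : Finset ℕ}

theorem withCycleEdges_empty : withCycleEdges H k x ∅ = H := by simp [withCycleEdges]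

theorem withCycleEdges_insert :
    withCycleEdges H k x (insert m S) = withCycleEdges H k x S ⊔ edge (x m) (x ((m + 1) % k)) := by
  rw [withCycleEdges, withCycleEdges, Finset.coe_insert, Set.image_insert_eq, Set.insert_eq,
    fromEdgeSet_union, sup_comm (fromEdgeSet _), ← sup_assoc]
  rfl

theorem extendVerts_one : extendVerts W x 1 = W := by simp [extendVerts]

theorem extendVerts_succ (hm : 1 ≤ m) :
    extendVerts W x (m + 1) = insert (x (m + 1)) (extendVerts W x m) := by
  rw [extendVerts, extendVerts, ← Set.insert_Icc_right_eq_Icc_add_one (by omega),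
    Set.image_insert_eq, Set.union_insert]

theorem subset_Ico_succ_cases (hm : 1 ≤ m) (hS : S ⊆ Finset.Ico 1 (m + 1)) :
    (∃ S' ⊆ Finset.Ico 1 m, m ∉ S' ∧ S = insert m S') ∨ S ⊆ Finset.Ico 1 m := by
  rw [← Finset.insert_Ico_right_eq_Ico_add_one hm] at hS
  by_cases hmS : m ∈ S
  · exact .inl ⟨S.erase m, Finset.subset_insert_iff.1 hS, Finset.notMem_erase m S,
      (Finset.insert_erase hmS).symm⟩
  · exact .inr ((Finset.subset_insert_iff_of_notMem hmS).1 hS)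

namespace Attached

variable (h : Attached k x W)

include h

theorem ne {s t : ℕ} (hs : s < k) (ht : t < k) (hst : s ≠ t) : x s ≠ x t :=
  fun he => hst (h.inj hs ht he)

theorem mem_extendVerts (hm : 1 ≤ m) : x m ∈ extendVerts W x m := by
  rcases hm.eq_or_lt with rfl | hm
  · exact .inl h.mem_one
  · exact .inr ⟨m, ⟨hm, le_rfl⟩, rfl⟩

theorem notMem_extendVerts (hm : 1 ≤ m) (hmk : m + 1 < k) : x (m + 1) ∉ extendVerts W x m := by
  rintro (hW | ⟨t, ⟨_, htm⟩, ht⟩)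
  · exact h.fresh _ (by omega) hmk hW
  · exact h.ne (by omega) hmk (by omega) ht

theorem isIsolated_withCycleEdges (hH : H.support ⊆ W) (hS : S ⊆ Finset.Ico 1 m) (hm : 1 ≤ m)
    (hmk : m + 1 < k) : (withCycleEdges H k x S).IsIsolated (x (m + 1)) := by
  rintro b (hadj | ⟨⟨t, ht, he⟩, -⟩)
  · exact h.fresh _ (by omega) hmk (hH ⟨b, hadj⟩)
  · have htm := Finset.mem_Ico.1 (hS ht)
    have hmem : x (m + 1) ∈ cycleEdge k x t := he ▸ Sym2.mem_mk_left _ _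
    rw [cycleEdge, Nat.mod_eq_of_lt (by omega), Sym2.mem_iff] at hmem
    exact hmem.elim (h.ne hmk (by omega) (by omega)) (h.ne hmk (by omega) (by omega))

/-- Attaching the path edges one by one, each edge is pendant, and each missing edge leaves its
new vertex isolated. -/
theorem spans_and_splits_path (hH : H.support ⊆ W) (hm : 1 ≤ m) (hmk : m < k)
    (hS : S ⊆ Finset.Ico 1 m) :
    (Spans (withCycleEdges H k x S) (extendVerts W x m) ↔ S.card + 1 = m ∧ Spans H W) ∧
    (Splits (withCycleEdges H k x S) (extendVerts W x m) (x 0) (x m) ↔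
      (S.card + 1 = m ∧ Splits H W (x 0) (x 1)) ∨ (S.card + 2 = m ∧ Spans H W)) := by
  induction m, hm using Nat.le_induction generalizing S with
  | base =>
    obtain rfl : S = ∅ := by simpa using hS
    simp [withCycleEdges_empty, extendVerts_one]
  | succ m hm ih =>
    have hx0 : x 0 ∈ extendVerts W x m := .inl h.mem_zero
    have hxm := h.mem_extendVerts hm
    have hnew := h.notMem_extendVerts hm hmk
    rw [extendVerts_succ hm]
    rcases subset_Ico_succ_cases hm hS with ⟨S', hS', hmS, rfl⟩ | hS
    · have hiso := h.isIsolated_withCycleEdges hH hS' hm hmk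
      obtain ⟨hspans, hsplits⟩ := ih (by omega) hS'
      rw [withCycleEdges_insert, Nat.mod_eq_of_lt hmk, spans_pendant_iff hiso hnew hxm,
        splits_pendant_iff hiso hnew hx0 hxm, hspans, hsplits, Finset.card_insert_of_notMem hmS]
      constructor <;> grind
    · have hiso := h.isIsolated_withCycleEdges hH hS hm hmk
      have hnot := not_spans_of_isIsolated hiso (Set.mem_insert _ _)
        (Set.mem_insert_of_mem (x (m + 1)) hx0) (ne_of_mem_of_not_mem hx0 hnew)
      have hcard := Finset.card_le_card hS
      rw [Nat.card_Ico] at hcard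
      rw [splits_insert_iff_of_isIsolated hiso hnew hx0, (ih (by omega) hS).1]
      constructor <;> grind

/-- The closing edge joins the two ends of the attached path, so it takes the place of an edge
between `x 0` and `x 1`. -/
theorem spans_cycle_iff (hH : H.support ⊆ W) (hS : S ⊆ Finset.Ico 1 k) :
    Spans (withCycleEdges H k x S) (extendVerts W x (k - 1)) ↔
      (S.card + 1 = k ∧ Splits H W (x 0) (x 1)) ∨ (S.card + 2 = k ∧ Spans H W) := by
  obtain ⟨m, rfl⟩ : ∃ m, k = m + 1 := ⟨k - 1, by have := h.three_le; omega⟩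
  have hm : 2 ≤ m := by have := h.three_le; omega
  rw [Nat.add_sub_cancel]
  rcases subset_Ico_succ_cases (by omega) hS with ⟨S', hS', hmS, rfl⟩ | hS
  · have hne : x m ≠ x 0 := h.ne (by omega) (by omega) (by omega)
    have hadj : ¬ (withCycleEdges H (m + 1) x S').Adj (x m) (x 0) := by
      rintro (hadj | ⟨⟨t, ht, he⟩, -⟩)
      · exact h.fresh m hm (by omega) (hH ⟨_, hadj⟩)
      · have htm := Finset.mem_Ico.1 (hS' ht)
        rw [cycleEdge, Nat.mod_eq_of_lt (by omega), Sym2.eq_iff] at he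
        exact he.elim (fun he => h.ne (by omega) (by omega) (by omega) he.1)
          (fun he => h.ne (by omega) (by omega) (by omega) he.1)
    rw [withCycleEdges_insert, Nat.mod_self,
      spans_sup_edge_iff hne hadj (h.mem_extendVerts (by omega)), splits_comm,
      (h.spans_and_splits_path hH (by omega) (by omega) hS').2, Finset.card_insert_of_notMem hmS]
    grind
  · have hcard := Finset.card_le_card hS
    rw [Nat.card_Ico] at hcard
    rw [(h.spans_and_splits_path hH (by omega) (by omega) hS).1]
    grind

end Attached

end Forests

/-! ### Every ladder has a labelling -/

section Presentation

variable {V : Type*} {k n : ℕ} {W : Set V} {E F : Set (Sym2 V)}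

theorem cycleEdges_eq_image (k : ℕ) (x : ℕ → V) : cycleEdges k x = cycleEdge k x '' Set.Iio k := by
  ext e
  simp [cycleEdges, cycleEdge, eq_comm]

theorem bijOn_add_mod (r : ℕ) (hk : 0 < k) :
    Set.BijOn (fun a => (a + r) % k) (Set.Iio k) (Set.Iio k) := by
  have hmaps : Set.MapsTo (fun a => (a + r) % k) (Set.Iio k) (Set.Iio k) :=
    fun a _ => Nat.mod_lt _ hk
  have hinj : Set.InjOn (fun a => (a + r) % k) (Set.Iio k) := fun a ha b hb hab => by
    have hmod : a ≡ b [MOD k] := Nat.ModEq.add_right_cancel' r hab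
    rwa [Nat.ModEq, Nat.mod_eq_of_lt ha, Nat.mod_eq_of_lt hb] at hmod
  exact ((Set.finite_Iio k).injOn_iff_bijOn_of_mapsTo hmaps).mp hinj

theorem cycleEdges_rotate (x : ℕ → V) (r : ℕ) (hk : 0 < k) :
    cycleEdges k (fun a => x ((a + r) % k)) = cycleEdges k x := by
  have hedge : cycleEdge k (fun a => x ((a + r) % k)) = fun a => cycleEdge k x ((a + r) % k) := by
    funext a
    simp only [cycleEdge, Nat.mod_add_mod]
    rw [add_right_comm]
  rw [cycleEdges_eq_image, cycleEdges_eq_image, hedge,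
    ← Set.image_image (cycleEdge k x) (fun a => (a + r) % k), (bijOn_add_mod r hk).image_eq]

theorem exists_rotation_cycleEdge_two_eq (hk : 3 ≤ k) {x : ℕ → V} (inj : Set.InjOn x (Set.Iio k))
    {e : Sym2 V} (he : e ∈ cycleEdges k x) :
    ∃ y : ℕ → V, Set.InjOn y (Set.Iio k) ∧ y '' Set.Iio k = x '' Set.Iio k ∧
      cycleEdges k y = cycleEdges k x ∧ cycleEdge k y 2 = e := by
  obtain ⟨t, ht, rfl⟩ := he
  have hbij := bijOn_add_mod (t + k - 2) (by omega : 0 < k)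
  refine ⟨fun a => x ((a + (t + k - 2)) % k), inj.comp hbij.injOn hbij.mapsTo, ?_,
    cycleEdges_rotate x _ (by omega), ?_⟩
  · rw [← Set.image_image x (fun a => (a + (t + k - 2)) % k), hbij.image_eq]
  · simp only [cycleEdge, Nat.mod_add_mod]
    rw [show 2 + (t + k - 2) = t + k by omega, show 2 + 1 + (t + k - 2) = t + 1 + k by omega,
      Nat.add_mod_right, Nat.add_mod_right, Nat.mod_eq_of_lt ht]

/-- The cycles `x i` and the positions `pos i` form a labelling of the ladder with vertex set `W`
and edge set `E`: a `Labelling` for a graph that need not contain all vertices of `V`, as it occurs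
in the course of the construction of a ladder. -/
structure Presents (k n : ℕ) (W : Set V) (E : Set (Sym2 V)) (x : ℕ → ℕ → V) (pos : ℕ → ℕ) :
    Prop where
  inj : ∀ i, i < n → Set.InjOn (x i) (Set.Iio k)
  pos_lt : ∀ i, i < n → pos i < k
  pos_free : 4 ≤ k → ∀ i, i < n → 2 ≤ pos i ∧ pos i + 2 ≤ k
  glue : ∀ i, i + 1 < n → s(x (i + 1) 0, x (i + 1) 1) = cycleEdge k (x i) (pos i)
  fresh : ∀ i, i + 1 < n → ∀ t, 2 ≤ t → t < k →
    ∀ j, j ≤ i → ∀ u, u < k → x (i + 1) t ≠ x j u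
  verts_eq : ∀ v, v ∈ W ↔ ∃ i, i < n ∧ ∃ t, t < k ∧ x i t = v
  edges_eq : ∀ e, e ∈ E ↔ ∃ i, i < n ∧ e ∈ cycleEdges k (x i)

theorem presents_cycle {x : ℕ → V} (inj : Set.InjOn x (Set.Iio k)) {p : ℕ} (hp : p < k)
    (hfree : 4 ≤ k → 2 ≤ p ∧ p + 2 ≤ k) :
    Presents k 1 (x '' Set.Iio k) (cycleEdges k x) (fun _ => x) (fun _ => p) where
  inj _ _ := inj
  pos_lt _ _ := hp
  pos_free hk _ _ := hfree hk
  glue i hi := by omega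
  fresh i hi := by omega
  verts_eq v := by simp
  edges_eq e := by simp

theorem Presents.fuse {x : ℕ → ℕ → V} {pos : ℕ → ℕ} (h : Presents k n W E x pos) {y : ℕ → V}
    (inj : Set.InjOn y (Set.Iio k))
    (glue : ∀ i, i + 1 = n → s(y 0, y 1) = cycleEdge k (x i) (pos i))
    (fresh : ∀ t, 2 ≤ t → t < k → y t ∉ W) {p : ℕ} (hp : p < k)
    (hfree : 4 ≤ k → 2 ≤ p ∧ p + 2 ≤ k) :
    Presents k (n + 1) (W ∪ y '' Set.Iio k) (E ∪ cycleEdges k y)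
      (fun i => if i < n then x i else y) (fun i => if i < n then pos i else p) where
  inj i _ := by
    split_ifs with hi
    exacts [h.inj i hi, inj]
  pos_lt i _ := by
    split_ifs with hi
    exacts [h.pos_lt i hi, hp]
  pos_free hk i _ := by
    split_ifs with hi
    exacts [h.pos_free hk i hi, hfree hk]
  glue i hi := by
    simp only [if_pos (show i < n by omega)]
    split_ifs with hi'
    exacts [h.glue i hi', glue i (by omega)]
  fresh i hi t ht htk j hj u hu := by
    have hjn : j < n := by omega
    simp only [if_pos hjn]
    split_ifs with hi'
    · exact h.fresh i hi' t ht htk j hj u hu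
    · exact fun he => fresh t ht htk ((h.verts_eq _).2 ⟨j, hjn, u, hu, he.symm⟩)
  verts_eq v := by
    rw [Set.mem_union, h.verts_eq]
    constructor
    · rintro (⟨i, hi, t, ht, rfl⟩ | ⟨t, ht, rfl⟩)
      · exact ⟨i, by omega, t, ht, by simp [hi]⟩
      · exact ⟨n, by omega, t, ht, by simp⟩
    · rintro ⟨i, _, t, ht, rfl⟩
      split_ifs with hi
      exacts [.inl ⟨i, hi, t, ht, rfl⟩, .inr ⟨t, ht, rfl⟩]
  edges_eq e := by
    rw [Set.mem_union, h.edges_eq]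
    constructor
    · rintro (⟨i, hi, he⟩ | he)
      · exact ⟨i, by omega, by simpa [hi] using he⟩
      · exact ⟨n, by omega, by simpa using he⟩
    · rintro ⟨i, _, he⟩
      split_ifs at he with hi
      exacts [.inl ⟨i, hi, he⟩, .inr he]

theorem LadderBuild.one_le (h : LadderBuild k n W E F) : 1 ≤ n := by
  cases h <;> omega

theorem LadderBuild.le_two (h : LadderBuild 3 n W E F) : n ≤ 2 := by
  cases h with
  | cycle => omega
  | fuse _ _ _ _ _ prev _ free _ =>
    cases prev with
    | cycle => omega
    | fuse =>
      obtain ⟨t, ht, ht', _⟩ := free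
      omega

theorem LadderBuild.exists_presents (hk : 3 ≤ k) (h : LadderBuild k n W E F) :
    (∃ x pos, Presents k n W E x pos) ∧ ∀ e ∈ F, ∃ x pos, Presents k n W E x pos ∧
      ∀ i, i + 1 = n → e = cycleEdge k (x i) (pos i) := by
  induction h with
  | cycle x inj =>
    refine ⟨⟨_, _, presents_cycle inj (p := 2) (by omega) (by omega)⟩, fun e he => ?_⟩
    obtain ⟨y, hy, hverts, hedges, rfl⟩ := exists_rotation_cycleEdge_two_eq hk inj he
    rw [← hverts, ← hedges]
    exact ⟨_, _, presents_cycle hy (p := 2) (by omega) (by omega), fun _ _ => rfl⟩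
  | fuse n W E F y prev inj free fresh ih =>
    obtain ⟨x, pos, hP, hglue⟩ := ih.2 _ free
    refine ⟨⟨_, _, hP.fuse inj hglue fresh (p := 2) (by omega) (by omega)⟩, ?_⟩
    rintro e ⟨t, ht, htk, rfl⟩
    refine ⟨_, _, hP.fuse inj hglue fresh (p := t) (by omega) (by omega), fun i hi => ?_⟩
    obtain rfl : i = n := by omega
    simp [cycleEdge, Nat.mod_eq_of_lt htk]

theorem IsLadder.nonempty_labelling {G : SimpleGraph V} (h : IsLadder k n G) :
    Nonempty (Labelling G k n) := by
  obtain ⟨hk, F, hF⟩ := h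
  obtain ⟨⟨x, pos, hP⟩, -⟩ := hF.exists_presents hk
  exact ⟨⟨x, pos, hP.inj, hP.pos_lt, hP.pos_free, hP.glue, hP.fresh,
    fun v => (hP.verts_eq v).1 (Set.mem_univ _), hP.edges_eq⟩⟩

end Presentation

/-! ### Running times -/

/-- The program `p` takes `O(k ^ i * n ^ j)` steps, uniformly in the initial state, on all inputs
with `k ≥ 1` and `n ≥ 1`. -/
def Runs (i j : ℕ) (p : Cmd) : Prop :=
  ∃ a, ∀ I : Input, 1 ≤ I.k → 1 ≤ I.n → ∀ s, (p.exec I s).2 ≤ a * (I.k ^ i * I.n ^ j)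

/-- The straight-line programs, which contain no loops. -/
def Cmd.loopFree : Cmd → Bool
  | .seq p p' => p.loopFree && p'.loopFree
  | .ite _ p p' => p.loopFree && p'.loopFree
  | .loop _ _ _ _ => false
  | _ => true

namespace Runs

variable {i j : ℕ} {p p' : Cmd}

theorem mono {i' j' : ℕ} (hi : i ≤ i') (hj : j ≤ j') (h : Runs i j p) : Runs i' j' p := by
  obtain ⟨a, ha⟩ := h
  refine ⟨a, fun I hk hn s => (ha I hk hn s).trans ?_⟩
  gcongr

theorem of_forall_le {a : ℕ} (h : ∀ I s, (p.exec I s).2 ≤ a) : Runs 0 0 p :=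
  ⟨a, fun I _ _ s => by simpa using h I s⟩

theorem seq (h : Runs i j p) (h' : Runs i j p') : Runs i j (.seq p p') := by
  obtain ⟨a, ha⟩ := h
  obtain ⟨b, hb⟩ := h'
  refine ⟨a + b, fun I hk hn s => ?_⟩
  rw [add_mul]
  exact add_le_add (ha I hk hn s) (hb I hk hn _)

theorem ite (b : BExp) (h : Runs i j p) (h' : Runs i j p') : Runs i j (.ite b p p') := by
  obtain ⟨a, ha⟩ := h
  obtain ⟨a', ha'⟩ := h'
  refine ⟨a + a' + (b.size + 1), fun I hk hn s => ?_⟩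
  have hp := ha I hk hn s
  have hp' := ha' I hk hn s
  have htest : b.size + 1 ≤ (b.size + 1) * (I.k ^ i * I.n ^ j) :=
    Nat.le_mul_of_pos_right _ (by positivity)
  rw [Cmd.exec, add_mul, add_mul]
  split_ifs <;> dsimp only <;> omega

theorem of_loopFree (h : p.loopFree) : Runs i j p := by
  refine mono (Nat.zero_le i) (Nat.zero_le j) ?_
  induction p with
  | skip => exact of_forall_le fun _ _ => le_rfl
  | nat => exact of_forall_le fun _ _ => le_rfl
  | real => exact of_forall_le fun _ _ => le_rfl
  | list => exact of_forall_le fun _ _ => le_rfl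
  | seq p p' ihp ihp' =>
    obtain ⟨hp, hp'⟩ := Bool.and_eq_true_iff.1 h
    exact (ihp hp).seq (ihp' hp')
  | ite b p p' ihp ihp' =>
    obtain ⟨hp, hp'⟩ := Bool.and_eq_true_iff.1 h
    exact (ihp hp).ite b (ihp' hp')
  | loop => exact absurd h Bool.false_ne_true

theorem nil : Runs i j (seqs []) := of_loopFree rfl

theorem cons {l : List Cmd} (h : Runs i j p) (hl : Runs i j (seqs l)) : Runs i j (seqs (p :: l)) :=
  h.seq hl

theorem foldl_steps_le {I : Input} {r : NReg} {b : ℕ} (h : ∀ s, (p.exec I s).2 ≤ b)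
    (l : List ℕ) (o : State × ℕ) :
    (l.foldl (fun o v => ((p.exec I (o.1.setNat r v)).1,
      o.2 + (p.exec I (o.1.setNat r v)).2 + 1)) o).2 ≤ o.2 + l.length * (b + 1) := by
  induction l generalizing o with
  | nil => simp
  | cons v l ih =>
    have hbody := h (o.1.setNat r v)
    refine (ih _).trans ?_
    rw [List.length_cons, add_mul]
    dsimp only
    omega

theorem loop {b i' j' : ℕ} (r : NReg) (lo : NExp) {hi : NExp}
    (hhi : ∀ I s, hi.eval I s ≤ b * (I.k ^ i' * I.n ^ j')) (h : Runs i j p) :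
    Runs (i + i') (j + j') (.loop r lo hi p) := by
  obtain ⟨a, ha⟩ := h
  refine ⟨lo.size + hi.size + 1 + b * (a + 1), fun I hk hn s => ?_⟩
  have hbody : 1 ≤ I.k ^ i * I.n ^ j := Nat.mul_pos (pow_pos hk i) (pow_pos hn j)
  have htest : 1 ≤ I.k ^ (i + i') * I.n ^ (j + j') := Nat.mul_pos (pow_pos hk _) (pow_pos hn _)
  have hrounds : hi.eval I s - lo.eval I s ≤ b * (I.k ^ i' * I.n ^ j') :=
    (Nat.sub_le _ _).trans (hhi I s)
  calc (Cmd.exec I (.loop r lo hi p) s).2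
      ≤ (lo.size + hi.size + 1) +
          (hi.eval I s - lo.eval I s) * (a * (I.k ^ i * I.n ^ j) + 1) := by
        simpa only [Cmd.exec, List.length_range'] using
          foldl_steps_le (r := r) (ha I hk hn) (List.range' _ _) (s, _)
    _ ≤ (lo.size + hi.size + 1) * (I.k ^ (i + i') * I.n ^ (j + j')) +
          b * (I.k ^ i' * I.n ^ j') * ((a + 1) * (I.k ^ i * I.n ^ j)) := by
        refine add_le_add (Nat.le_mul_of_pos_right _ htest) (Nat.mul_le_mul hrounds ?_)
        rw [add_mul, one_mul]
        exact Nat.add_le_add_left hbody _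
    _ = _ := by ring

theorem loop_k (r : NReg) (lo : NExp) (h : Runs 0 0 p) : Runs 1 0 (.loop r lo .k p) :=
  loop (b := 1) (i' := 1) (j' := 0) r lo (fun _ _ => by simp [NExp.eval]) h

end Runs

theorem runs_commit (j : Entry) : Runs 1 0 (commit j) :=
  .cons (.loop_k _ _ (.of_loopFree rfl)) (.of_loopFree rfl)

theorem runs_fromTrees (j : Entry) (a b : NExp) : Runs 1 0 (fromTrees j a b) :=
  .cons (.of_loopFree rfl) <| .cons (.of_loopFree rfl) <| .cons (.of_loopFree rfl) <|
    .cons (.of_loopFree rfl) <| .cons (.of_loopFree rfl) <| .cons (runs_commit j) .nil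

theorem runs_fromForests (j : Entry) (a : NExp) : Runs 1 0 (fromForests j a) :=
  .cons (.of_loopFree rfl) <| .cons (.of_loopFree rfl) <| .cons (.of_loopFree rfl) <|
    .cons (.of_loopFree rfl) <| .cons (.loop_k _ _ (.of_loopFree rfl)) <|
      .cons (runs_commit j) .nil

theorem runs_update : Runs 1 0 update :=
  have runs_pathCost : Runs 1 0 pathCost :=
    .cons (.of_loopFree rfl) <| .cons (.loop_k _ _ (.of_loopFree rfl)) .nil
  .cons (.of_loopFree rfl) <| .cons runs_pathCost <| .cons (runs_fromTrees _ _ _) <|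
    .cons (runs_fromTrees _ _ _) <| .cons (runs_fromTrees _ _ _) <|
      .cons (runs_fromForests _ _) <| .cons (runs_fromTrees _ _ _) <|
        .cons (runs_fromTrees _ _ _) <| .cons (runs_fromForests _ _) <| .of_loopFree rfl

theorem runs_init : Runs 1 0 init :=
  .cons (.of_loopFree rfl) <| .cons (.of_loopFree rfl) <| .cons (.of_loopFree rfl) <|
    .cons runs_update .nil

theorem runs_round : Runs 1 0 round := .cons (.of_loopFree rfl) <| .cons runs_update .nil

theorem runs_sweep : Runs 1 1 (sweep .n) :=
  (runs_init.mono le_rfl zero_le_one).seq <|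
    runs_round.loop (b := 1) (i' := 0) (j' := 1) _ _ fun _ _ => by simp [NExp.eval]

theorem runs_small : Runs 0 0 small :=
  .ite _ (.of_loopFree rfl) <| .cons (.of_loopFree rfl) <| .cons (.of_loopFree rfl) <|
    .cons (.of_loopFree rfl) <| .cons (.of_loopFree rfl) <| .cons (.of_loopFree rfl) <|
      .cons (.of_loopFree rfl) <|
        .cons (.loop (b := 3) (i := 0) (j := 0) (i' := 0) (j' := 0) _ _
          (fun _ _ => by simp [NExp.eval]) (.of_loopFree rfl)) .nil

theorem runs_ladderAlgorithm : Runs 1 1 ladderAlgorithm :=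
  .ite _ (runs_small.mono zero_le_one zero_le_one) <| runs_sweep.seq <| .of_loopFree rfl

/-! ### Semantics of programs -/

section Execution

variable {I : Input} {s s₀ s₁ s₂ : State}

theorem exec_loop {r : NReg} {lo hi : NExp} {p : Cmd} (P : ℕ → State → Prop) {a b : ℕ}
    (ha : lo.eval I s = a) (hb : hi.eval I s = b) (hab : a ≤ b) (start : P a s)
    (step : ∀ v s, a ≤ v → v < b → P v s → P (v + 1) (p.exec I (s.setNat r v)).1) :
    P b ((Cmd.loop r lo hi p).exec I s).1 := by
  have rounds : ∀ (m v : ℕ) (o : State × ℕ), a ≤ v → v + m = b → P v o.1 →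
      P b ((List.range' v m).foldl (fun o v => ((p.exec I (o.1.setNat r v)).1,
        o.2 + (p.exec I (o.1.setNat r v)).2 + 1)) o).1 := by
    intro m
    induction m with
    | zero => intro v o _ hv hP; simpa [← hv] using hP
    | succ m ih =>
      intro v o hav hv hP
      rw [List.range'_succ, List.foldl_cons]
      exact ih (v + 1) _ (by omega) (by omega) (step v o.1 hav (by omega) hP)
  rw [Cmd.exec, ha, hb]
  exact rounds _ _ _ le_rfl (by omega) start

theorem exec_loop_invariant {r : NReg} {lo hi : NExp} {p : Cmd} (P : State → Prop) (start : P s)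
    (step : ∀ v s, P s → P (p.exec I (s.setNat r v)).1) :
    P ((Cmd.loop r lo hi p).exec I s).1 := by
  rcases le_total (lo.eval I s) (hi.eval I s) with hle | hle
  · exact exec_loop (fun _ => P) rfl rfl hle start fun v s _ _ => step v s
  · rw [Cmd.exec, Nat.sub_eq_zero_of_le hle]
    exact start

@[simp] theorem exec_seqs_nil : ((seqs []).exec I s).1 = s := rfl

@[simp] theorem exec_seqs_cons (p : Cmd) (l : List Cmd) :
    ((seqs (p :: l)).exec I s).1 = ((seqs l).exec I (p.exec I s).1).1 := rfl

@[simp] theorem exec_nat (r : NReg) (e : NExp) :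
    ((Cmd.nat r e).exec I s).1 = s.setNat r (e.eval I s) := rfl

@[simp] theorem exec_real (r : RReg) (e : RExp) :
    ((Cmd.real r e).exec I s).1 = s.setReal r (e.eval I s) := rfl

@[simp] theorem exec_list (r : LReg) (e : LExp) :
    ((Cmd.list r e).exec I s).1 = s.setList r (e.eval I s) := rfl

theorem exec_cond (b : BExp) (p : Cmd) [Decidable (b.holds I s)] :
    ((cond b p).exec I s).1 = if b.holds I s then (p.exec I s).1 else s := by
  rw [cond, Cmd.exec]
  split_ifs <;> rfl

@[simp] theorem nat_setNat (r r' : NReg) (v : ℕ) :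
    (s.setNat r v).nat r' = if r' = r then v else s.nat r' := by
  simp only [State.setNat, Function.update_apply]

@[simp] theorem real_setNat (r : NReg) (v : ℕ) : (s.setNat r v).real = s.real := rfl

@[simp] theorem list_setNat (r : NReg) (v : ℕ) : (s.setNat r v).list = s.list := rfl

@[simp] theorem nat_setReal (r : RReg) (v : ℝ) : (s.setReal r v).nat = s.nat := rfl

@[simp] theorem real_setReal (r r' : RReg) (v : ℝ) :
    (s.setReal r v).real r' = if r' = r then v else s.real r' := by
  simp only [State.setReal, Function.update_apply]

@[simp] theorem list_setReal (r : RReg) (v : ℝ) : (s.setReal r v).list = s.list := rfl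

@[simp] theorem nat_setList (r : LReg) (v : List (ℕ × ℕ)) : (s.setList r v).nat = s.nat := rfl

@[simp] theorem real_setList (r : LReg) (v : List (ℕ × ℕ)) : (s.setList r v).real = s.real := rfl

@[simp] theorem list_setList (r r' : LReg) (v : List (ℕ × ℕ)) :
    (s.setList r v).list r' = if r' = r then v else s.list r' := by
  simp only [State.setList, Function.update_apply]

theorem setReal_self (r : RReg) : s.setReal r (s.real r) = s := by
  simp only [State.setReal, Function.update_eq_self]

@[simp] theorem setReal_setReal (r : RReg) (v w : ℝ) :
    (s.setReal r v).setReal r w = s.setReal r w := by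
  simp only [State.setReal, Function.update_idem]

@[simp] theorem exec_decr (r : RReg) (e : RExp) :
    ((decr r e).exec I s).1 = s.setReal r (s.real r - e.eval I s) := rfl

@[simp] theorem exec_incr (r : RReg) (e : RExp) :
    ((incr r e).exec I s).1 = s.setReal r (s.real r + e.eval I s) := rfl

theorem exec_cond_decr (b : BExp) (r : RReg) (e : RExp) [Decidable (b.holds I s)] :
    ((cond b (decr r e)).exec I s).1 =
      s.setReal r (s.real r - if b.holds I s then e.eval I s else 0) := by
  rw [exec_cond]
  split_ifs
  · rfl
  · rw [sub_zero, setReal_self]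

theorem exec_cond_incr (b : BExp) (r : RReg) (e : RExp) [Decidable (b.holds I s)] :
    ((cond b (incr r e)).exec I s).1 =
      s.setReal r (s.real r + if b.holds I s then e.eval I s else 0) := by
  rw [exec_cond]
  split_ifs
  · rfl
  · rw [add_zero, setReal_self]

theorem exec_cond_cond_decr (b b' : BExp) (r : RReg) (e : RExp)
    [Decidable (b.holds I s ∧ b'.holds I s)] :
    ((cond b (cond b' (decr r e))).exec I s).1 =
      s.setReal r (s.real r - if b.holds I s ∧ b'.holds I s then e.eval I s else 0) := by
  classical
  rw [exec_cond, exec_cond_decr]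
  by_cases hb : b.holds I s
  · simp only [hb, true_and, if_true]
  · simp only [hb, false_and, if_false, sub_zero, setReal_self]

/-- A set of registers, given by membership tests. -/
structure RegSet where
  nat : NReg → Bool
  real : RReg → Bool
  list : LReg → Bool

/-- Every assignment in the program, including those to loop variables, is to a register of `R`. -/
def Cmd.writesIn (R : RegSet) : Cmd → Bool
  | .skip => true
  | .nat r _ => R.nat r
  | .real r _ => R.real r
  | .list r _ => R.list r
  | .seq p p' => p.writesIn R && p'.writesIn R
  | .ite _ p p' => p.writesIn R && p'.writesIn R
  | .loop r _ _ p => R.nat r && p.writesIn R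

/-- The states `s₀` and `s` agree in all registers outside `R`. -/
structure AgreeOff (R : RegSet) (s₀ s : State) : Prop where
  nat : ∀ r, R.nat r = false → s.nat r = s₀.nat r
  real : ∀ r, R.real r = false → s.real r = s₀.real r
  list : ∀ r, R.list r = false → s.list r = s₀.list r

namespace AgreeOff

variable {R : RegSet}

theorem refl (s : State) : AgreeOff R s s := ⟨fun _ _ => rfl, fun _ _ => rfl, fun _ _ => rfl⟩

theorem trans (h : AgreeOff R s₀ s₁) (h' : AgreeOff R s₁ s₂) : AgreeOff R s₀ s₂ :=
  ⟨fun r hr => (h'.nat r hr).trans (h.nat r hr), fun r hr => (h'.real r hr).trans (h.real r hr),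
    fun r hr => (h'.list r hr).trans (h.list r hr)⟩

theorem setNat {r : NReg} (hr : R.nat r) (v : ℕ) : AgreeOff R s (s.setNat r v) :=
  ⟨fun r' hr' => by rw [nat_setNat, if_neg (by rintro rfl; simp [hr] at hr')],
    fun _ _ => rfl, fun _ _ => rfl⟩

theorem setReal {r : RReg} (hr : R.real r) (v : ℝ) : AgreeOff R s (s.setReal r v) :=
  ⟨fun _ _ => rfl, fun r' hr' => by rw [real_setReal, if_neg (by rintro rfl; simp [hr] at hr')],
    fun _ _ => rfl⟩

theorem setList {r : LReg} (hr : R.list r) (v : List (ℕ × ℕ)) : AgreeOff R s (s.setList r v) :=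
  ⟨fun _ _ => rfl, fun _ _ => rfl,
    fun r' hr' => by rw [list_setList, if_neg (by rintro rfl; simp [hr] at hr')]⟩

theorem exec {p : Cmd} (hp : p.writesIn R) (s : State) : AgreeOff R s (p.exec I s).1 := by
  induction p generalizing s with
  | skip => exact refl s
  | nat => exact setNat hp _
  | real => exact setReal hp _
  | list => exact setList hp _
  | seq p p' ih ih' =>
    obtain ⟨hp, hp'⟩ := Bool.and_eq_true_iff.1 hp
    exact (ih hp s).trans (ih' hp' _)
  | ite b p p' ih ih' =>
    obtain ⟨hp, hp'⟩ := Bool.and_eq_true_iff.1 hp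
    rw [Cmd.exec]
    split_ifs
    · exact ih hp s
    · exact ih' hp' s
  | loop r lo hi p ih =>
    obtain ⟨hr, hp⟩ := Bool.and_eq_true_iff.1 hp
    exact exec_loop_invariant (AgreeOff R s) (refl s) fun v s' h =>
      h.trans ((setNat hr v).trans (ih hp _))

end AgreeOff

/-- The registers that may change while the new objects are computed. All others, which describe
the current cycle and the old objects, stay fixed until the old objects are replaced. -/
def scratch : RegSet where
  nat | .cyc | .pos => false | _ => true
  real | .z _ | .x _ | .y _ | .path => false | _ => true
  list | .tree _ => false | _ => true

/-! ### The minimization over candidates -/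

/-- A candidate for a new object: the old object `old` together with the current cycle without the
edges at positions `0`, `del₁`, `del₂`. The position `0` stands for no further deletion. -/
structure Candidate where
  old : Entry
  del₁ : ℕ
  del₂ : ℕ

/-- The old objects, given by their costs `z`, their interaction costs `x` and `y` with the edges at
positions `1` and `k - 1` of the current cycle, and their lists of edge names. -/
structure OldData where
  z : Entry → ℝ
  x : Entry → ℝ
  y : Entry → ℝ
  list : Entry → List (ℕ × ℕ)

/-- The old objects held by the registers `z`, `x`, `y` and `tree`. -/
def State.oldData (s : State) : OldData where
  z j := s.real (.z j)
  x j := s.real (.x j)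
  y j := s.real (.y j)
  list j := s.list (.tree j)

/-- The interaction cost of the edges at positions `t` and `u` of cycle `i`. -/
def pairVal (I : Input) (i t u : ℕ) : ℝ := I.q (i, t) (i, u) + I.q (i, u) (i, t)

/-- The cost of the path formed by the edges at positions `1, …, k-1` of cycle `i`. -/
def pathVal (I : Input) (i : ℕ) : ℝ :=
  I.c (i, 1) + ∑ t ∈ Finset.Ico 2 I.k, (I.c (i, t) + pairVal I i (t - 1) t)

/-- The cost that remains of the cost `w` of the path of cycle `i` when the edges at positions `d₁`
and `d₂` are deleted, as computed by `setDel`. If `d₁` and `d₂` are consecutive, then the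
interaction of these two edges is subtracted only once. -/
def restVal (I : Input) (i : ℕ) (w : ℝ) (d₁ d₂ : ℕ) : ℝ :=
  let rest := if 0 < d₁ then
      w - I.c (i, d₁) - (if 1 < d₁ then pairVal I i (d₁ - 1) d₁ else 0) -
        (if d₁ + 1 < I.k then pairVal I i d₁ (d₁ + 1) else 0)
    else w
  if 0 < d₂ then
    rest - I.c (i, d₂) - (if 1 < d₂ ∧ ¬ d₂ - 1 = d₁ then pairVal I i (d₂ - 1) d₂ else 0) -
      (if d₂ + 1 < I.k ∧ ¬ d₂ + 1 = d₁ then pairVal I i d₂ (d₂ + 1) else 0)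
  else rest

/-- The value of a candidate built on old objects `D`, where `w` is the cost of the path of the
current cycle `i`. -/
def candVal (I : Input) (i : ℕ) (w : ℝ) (D : OldData) (c : Candidate) : ℝ :=
  restVal I i w c.del₁ c.del₂ + D.z c.old +
    (if ¬ (c.del₁ = 1 ∨ c.del₂ = 1) then D.x c.old else 0) +
    (if ¬ (c.del₁ = I.k - 1 ∨ c.del₂ = I.k - 1) then D.y c.old else 0)

/-- The value of a candidate in a given state. -/
def stateVal (I : Input) (s : State) : Candidate → ℝ :=
  candVal I (s.nat .cyc) (s.real .path) s.oldData

/-- The names of the edges of the path of cycle `i` except those at positions `d₁` and `d₂`, in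
front of the list `l`. -/
def pathList (k i d₁ d₂ : ℕ) (l : List (ℕ × ℕ)) : List (ℕ × ℕ) :=
  (((List.range' 1 (k - 1)).filter fun t => decide (¬ (t = d₁ ∨ t = d₂))).map
    fun t => (i, t)).reverse ++ l

/-- The state `s` holds a best candidate in `S` with respect to the old objects in `s₀`. -/
def Best (I : Input) (s₀ : State) (S : Set Candidate) (s : State) : Prop :=
  ∃ c ∈ S, IsMinOn (stateVal I s₀) S c ∧ s.real .best = stateVal I s₀ c ∧
    s.nat .bestDel₁ = c.del₁ ∧ s.nat .bestDel₂ = c.del₂ ∧ s.list .src = s₀.list (.tree c.old)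

/-- The new object `j` of `s` is a best candidate in `S` with respect to the old objects in `s₀`. -/
def Stored (I : Input) (s₀ : State) (S : Set Candidate) (j : Entry) (s : State) : Prop :=
  ∃ c ∈ S, IsMinOn (stateVal I s₀) S c ∧ s.real (.newZ j) = stateVal I s₀ c ∧
    s.list (.newTree j) = pathList I.k (s₀.nat .cyc) c.del₁ c.del₂ (s₀.list (.tree c.old))

/-- The candidates with deleted edges at positions `d₁` and `d₂` are about to be evaluated. -/
structure Ready (I : Input) (s₀ : State) (d₁ d₂ : ℕ) (s : State) : Prop where
  agree : AgreeOff scratch s₀ s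
  del₁ : s.nat .del₁ = d₁
  del₂ : s.nat .del₂ = d₂
  rest : s.real .rest = restVal I (s₀.nat .cyc) (s₀.real .path) d₁ d₂

theorem exec_setDel {a b : NExp} {d₁ d₂ : ℕ} (ha : a.eval I s = d₁)
    (hb : b.eval I (s.setNat .del₁ d₁) = d₂) :
    ((setDel a b).exec I s).1 = ((s.setNat .del₁ d₁).setNat .del₂ d₂).setReal .rest
      (restVal I (s.nat .cyc) (s.real .path) d₁ d₂) := by
  classical
  simp only [setDel, exec_seqs_cons, exec_seqs_nil, exec_nat, exec_real, ha, hb]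
  rw [exec_cond (.lt (.num 0) (.reg .del₁))]
  by_cases h₁ : 0 < d₁ <;> by_cases h₂ : 0 < d₂
  all_goals
    simp only [NExp.eval, BExp.holds, nat_setReal, nat_setNat, reduceCtorEq, if_false, if_true, h₁,
      exec_seqs_cons, exec_seqs_nil, exec_cond_decr, exec_decr]
    rw [exec_cond (.lt (.num 0) (.reg .del₂))]
    simp only [NExp.eval, EExp.eval, RExp.eval, BExp.holds, nat_setReal, nat_setNat, real_setReal,
      real_setNat, setReal_setReal, reduceCtorEq, if_false, if_true, h₁, h₂, exec_seqs_cons,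
      exec_seqs_nil, exec_cond_cond_decr, exec_decr, here, pairCost, restVal, pairVal]

theorem ready_setDel {a b : NExp} {d₁ d₂ : ℕ} (h : AgreeOff scratch s₀ s) (ha : a.eval I s = d₁)
    (hb : b.eval I (s.setNat .del₁ d₁) = d₂) : Ready I s₀ d₁ d₂ ((setDel a b).exec I s).1 := by
  refine ⟨h.trans (.exec rfl s), ?_, ?_, ?_⟩ <;>
    simp [exec_setDel ha hb, h.nat .cyc rfl, h.real .path rfl]

theorem Best.setDel {a b : NExp} {d₁ d₂ : ℕ} {S : Set Candidate} (h : Best I s₀ S s)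
    (ha : a.eval I s = d₁) (hb : b.eval I (s.setNat .del₁ d₁) = d₂) :
    Best I s₀ S ((AQMST.setDel a b).exec I s).1 := by
  rw [exec_setDel ha hb]
  simpa [Best] using h

namespace Ready

variable {d₁ d₂ : ℕ}

theorem exec_candidate (h : Ready I s₀ d₁ d₂ s) (j : Entry) :
    ((candidate j).exec I s).1 = s.setReal .cand (stateVal I s₀ ⟨j, d₁, d₂⟩) := by
  classical
  simp only [candidate, exec_seqs_cons, exec_seqs_nil, exec_real, exec_cond_incr, NExp.eval,
    BExp.holds, RExp.eval, nat_setReal, reduceCtorEq, if_false, if_true, setReal_setReal,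
    real_setReal, h.del₁, h.del₂, h.rest, h.agree.real (.z j) rfl, h.agree.real (.x j) rfl,
    h.agree.real (.y j) rfl, stateVal, candVal, State.oldData]

theorem setReal_cand (h : Ready I s₀ d₁ d₂ s) (v : ℝ) :
    Ready I s₀ d₁ d₂ (s.setReal .cand v) :=
  ⟨h.agree.trans (.setReal rfl v), h.del₁, h.del₂, by simp [h.rest]⟩

theorem take (h : Ready I s₀ d₁ d₂ s) (j : Entry) :
    Ready I s₀ d₁ d₂ ((AQMST.take j).exec I s).1 := by
  refine ⟨h.agree.trans (.exec rfl s), ?_, ?_, ?_⟩ <;>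
    simp [AQMST.take, h.del₁, h.del₂, h.rest]

theorem best_take {S : Set Candidate} {j : Entry} (h : Ready I s₀ d₁ d₂ s)
    (hcand : s.real .cand = stateVal I s₀ ⟨j, d₁, d₂⟩) (hmem : ⟨j, d₁, d₂⟩ ∈ S)
    (hmin : IsMinOn (stateVal I s₀) S ⟨j, d₁, d₂⟩) :
    Best I s₀ S ((AQMST.take j).exec I s).1 :=
  ⟨_, hmem, hmin, by
    simp [AQMST.take, RExp.eval, NExp.eval, LExp.eval, h.del₁, h.del₂, hcand,
      h.agree.list (.tree j) rfl]⟩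

theorem start (h : Ready I s₀ d₁ d₂ s) (j : Entry) :
    Ready I s₀ d₁ d₂ ((AQMST.start j).exec I s).1 ∧
      Best I s₀ {⟨j, d₁, d₂⟩} ((AQMST.start j).exec I s).1 := by
  rw [AQMST.start, exec_seqs_cons, exec_seqs_cons, exec_seqs_nil, h.exec_candidate]
  have hcand := h.setReal_cand (stateVal I s₀ ⟨j, d₁, d₂⟩)
  exact ⟨hcand.take j, hcand.best_take (by simp) rfl (by simp [IsMinOn, IsMinFilter])⟩

theorem consider {S : Set Candidate} (h : Ready I s₀ d₁ d₂ s) (hS : Best I s₀ S s) (j : Entry) :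
    Ready I s₀ d₁ d₂ ((AQMST.consider j).exec I s).1 ∧
      Best I s₀ (insert ⟨j, d₁, d₂⟩ S) ((AQMST.consider j).exec I s).1 := by
  classical
  rw [AQMST.consider, exec_seqs_cons, exec_seqs_cons, exec_seqs_nil, h.exec_candidate, exec_cond]
  have hcand := h.setReal_cand (stateVal I s₀ ⟨j, d₁, d₂⟩)
  obtain ⟨c, hc, hmin, hbest, hdel₁, hdel₂, hsrc⟩ := hS
  simp only [BExp.holds, RExp.eval, real_setReal, if_true, reduceCtorEq, if_false, hbest]
  split_ifs with hlt
  · refine ⟨hcand.take j, hcand.best_take (by simp) (Set.mem_insert _ _) ?_⟩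
    rintro c' (rfl | hc')
    · exact le_refl (stateVal I s₀ _)
    · exact hlt.le.trans (hmin hc')
  · refine ⟨hcand, c, Set.mem_insert_of_mem _ hc, ?_, by simp [hbest], hdel₁, hdel₂, hsrc⟩
    rintro c' (rfl | hc')
    · exact not_lt.1 hlt
    · exact hmin hc'

end Ready

theorem pathList_succ {v : ℕ} (hv : 1 ≤ v) (i d₁ d₂ : ℕ) (l : List (ℕ × ℕ)) :
    pathList (v + 1) i d₁ d₂ l =
      if ¬ (v = d₁ ∨ v = d₂) then (i, v) :: pathList v i d₁ d₂ l else pathList v i d₁ d₂ l := by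
  obtain ⟨w, rfl⟩ := Nat.exists_eq_add_of_le' hv
  simp only [pathList, Nat.add_sub_cancel, List.range'_concat, List.filter_append, List.map_append,
    List.reverse_append, List.append_assoc, one_mul, add_comm 1 w]
  by_cases hdel : w + 1 = d₁ ∨ w + 1 = d₂
  · rw [if_neg (not_not.2 hdel),
      List.filter_cons_of_neg (by simpa [or_iff_not_imp_left] using hdel)]
    rfl
  · rw [if_pos hdel, List.filter_cons_of_pos (by simpa using hdel)]
    rfl

theorem Best.commit {S : Set Candidate} (hB : Best I s₀ S s) (hk : 1 ≤ I.k)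
    (h : AgreeOff scratch s₀ s) (j : Entry) :
    Stored I s₀ S j ((AQMST.commit j).exec I s).1 := by
  classical
  obtain ⟨c, hc, hmin, hbest, hdel₁, hdel₂, hsrc⟩ := hB
  let inv : ℕ → State → Prop := fun v s' =>
    s'.real .best = stateVal I s₀ c ∧ s'.nat .cyc = s₀.nat .cyc ∧
      s'.nat .bestDel₁ = c.del₁ ∧ s'.nat .bestDel₂ = c.del₂ ∧
      s'.list .src = pathList v (s₀.nat .cyc) c.del₁ c.del₂ (s₀.list (.tree c.old))
  have hloop : inv I.k ((Cmd.loop .t (.num 1) .k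
      (cond (.not (.or (.eq (.reg .t) (.reg .bestDel₁)) (.eq (.reg .t) (.reg .bestDel₂))))
        (.list .src (.cons (here (.reg .t)) .src)))).exec I s).1 := by
    refine exec_loop inv rfl rfl hk ⟨hbest, h.nat .cyc rfl, hdel₁, hdel₂, hsrc⟩ ?_
    rintro v s' hv - ⟨hbest', hcyc, hdel₁, hdel₂, hsrc'⟩
    simp only [inv]
    rw [pathList_succ hv, ← hsrc', exec_cond, exec_list]
    simp only [BExp.holds, NExp.eval, LExp.eval, EExp.eval, here, nat_setNat, if_true, reduceCtorEq,
      if_false, hdel₁, hdel₂, hcyc, list_setNat]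
    split_ifs <;> simp [hbest', hcyc, hdel₁, hdel₂]
  obtain ⟨hbest', -, -, -, hsrc'⟩ := hloop
  exact ⟨c, hc, hmin, by simp [AQMST.commit, RExp.eval, hbest'],
    by simpa [AQMST.commit, LExp.eval] using hsrc'⟩

/-- The candidates built on an old object in `js` with deleted edges at positions `d₁` and `d₂`. -/
def candsOn (js : List Entry) (d₁ d₂ : ℕ) : Set Candidate :=
  {c | c.old ∈ js ∧ c.del₁ = d₁ ∧ c.del₂ = d₂}

/-- The candidates built on the old forests without an edge deleted besides that at position `d`,
and those built on the old trees with a further edge deleted at a position below `k` that is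
neither `p` nor adjacent to `p`. -/
def forestCands (k p d : ℕ) : Set Candidate :=
  candsOn forests d 0 ∪
    {c | ∃ t, 1 ≤ t ∧ t < k ∧ (t + 1 < p ∨ p + 1 < t) ∧ c ∈ candsOn trees d t}

theorem candsOn_trees (d₁ d₂ : ℕ) :
    candsOn trees d₁ d₂ = {⟨.T4, d₁, d₂⟩, ⟨.T3, d₁, d₂⟩, ⟨.T2, d₁, d₂⟩, ⟨.T1, d₁, d₂⟩} := by
  ext ⟨j, e₁, e₂⟩
  simp only [candsOn, trees, List.mem_cons, List.not_mem_nil, Set.mem_ofPred_eq, Set.mem_insert_iff,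
    Set.mem_singleton_iff, Candidate.mk.injEq]
  tauto

theorem candsOn_forests (d₁ d₂ : ℕ) :
    candsOn forests d₁ d₂ = {⟨.F3, d₁, d₂⟩, ⟨.F2, d₁, d₂⟩, ⟨.F1, d₁, d₂⟩} := by
  ext ⟨j, e₁, e₂⟩
  simp only [candsOn, forests, List.mem_cons, List.not_mem_nil, Set.mem_ofPred_eq,
    Set.mem_insert_iff, Set.mem_singleton_iff, Candidate.mk.injEq]
  grind

theorem forestCands_one (p d : ℕ) : forestCands 1 p d = candsOn forests d 0 := by
  refine Set.union_eq_left.2 ?_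
  rintro c ⟨t, ht, ht', -⟩
  omega

theorem forestCands_succ_of_far {v p d : ℕ} (hv : 1 ≤ v) (hfar : v + 1 < p ∨ p + 1 < v) :
    forestCands (v + 1) p d = candsOn trees d v ∪ forestCands v p d := by
  rw [forestCands, forestCands, Set.union_left_comm]
  congr 1
  ext c
  constructor
  · rintro ⟨t, ht, htv, htp, hc⟩
    rcases Nat.lt_succ_iff_lt_or_eq.1 htv with hlt | rfl
    · exact Or.inr ⟨t, ht, hlt, htp, hc⟩
    · exact Or.inl hc
  · rintro (hc | ⟨t, ht, htv, htp, hc⟩)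
    · exact ⟨v, hv, Nat.lt_succ_self v, hfar, hc⟩
    · exact ⟨t, ht, Nat.lt_succ_of_lt htv, htp, hc⟩

theorem forestCands_succ_of_near {v p d : ℕ} (hnear : ¬ (v + 1 < p ∨ p + 1 < v)) :
    forestCands (v + 1) p d = forestCands v p d := by
  rw [forestCands, forestCands]
  congr 1
  ext c
  refine exists_congr fun t => and_congr_right fun _ => ?_
  constructor
  · rintro ⟨htv, htp, hc⟩
    rcases Nat.lt_succ_iff_lt_or_eq.1 htv with hlt | rfl
    · exact ⟨hlt, htp, hc⟩
    · exact absurd htp hnear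
  · rintro ⟨htv, htp, hc⟩
    exact ⟨Nat.lt_succ_of_lt htv, htp, hc⟩

theorem stored_fromTrees {a b : NExp} {d₁ d₂ : ℕ} (hk : 1 ≤ I.k) (h : AgreeOff scratch s₀ s)
    (ha : ∀ s, AgreeOff scratch s₀ s → a.eval I s = d₁)
    (hb : ∀ s, AgreeOff scratch s₀ s → b.eval I s = d₂) (j : Entry) :
    Stored I s₀ (candsOn trees d₁ d₂) j ((fromTrees j a b).exec I s).1 := by
  obtain ⟨ready₁, best₁⟩ := (ready_setDel h (ha s h) (hb _ (h.trans (.setNat rfl _)))).start .T1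
  obtain ⟨ready₂, best₂⟩ := ready₁.consider best₁ .T2
  obtain ⟨ready₃, best₃⟩ := ready₂.consider best₂ .T3
  obtain ⟨ready₄, best₄⟩ := ready₃.consider best₃ .T4
  rw [candsOn_trees]
  exact best₄.commit hk ready₄.agree j

theorem stored_fromForests {a : NExp} {d : ℕ} (hk : 1 ≤ I.k) (h : AgreeOff scratch s₀ s)
    (ha : ∀ s, AgreeOff scratch s₀ s → a.eval I s = d) (j : Entry) :
    Stored I s₀ (forestCands I.k (s₀.nat .pos) d) j ((fromForests j a).exec I s).1 := by
  classical
  obtain ⟨ready₁, best₁⟩ := (ready_setDel (b := .num 0) (d₂ := 0) h (ha s h) rfl).start .F1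
  obtain ⟨ready₂, best₂⟩ := ready₁.consider best₁ .F2
  obtain ⟨ready₃, best₃⟩ := ready₂.consider best₂ .F3
  suffices hloop : _ ∧ _ from Best.commit hloop.2 hk hloop.1 j
  refine exec_loop (fun v s' => AgreeOff scratch s₀ s' ∧
    Best I s₀ (forestCands v (s₀.nat .pos) d) s') (a := 1) rfl rfl hk ⟨ready₃.agree, ?_⟩ ?_
  · rwa [forestCands_one, candsOn_forests]
  rintro v s' hv - ⟨hs', best⟩
  have hsv : AgreeOff scratch s₀ (s'.setNat .t v) := hs'.trans (.setNat rfl v)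
  have bestv : Best I s₀ (forestCands v (s₀.nat .pos) d) (s'.setNat .t v) := by
    simpa [Best] using best
  rw [exec_cond]
  simp only [BExp.holds, NExp.eval, nat_setNat, if_true, reduceCtorEq, if_false, hs'.nat .pos rfl]
  split_ifs with hfar
  · have ht : (NExp.reg .t).eval I ((s'.setNat .t v).setNat .del₁ d) = v := by simp [NExp.eval]
    obtain ⟨ready₁, best₁⟩ :=
      (ready_setDel hsv (ha _ hsv) ht).consider (bestv.setDel (ha _ hsv) ht) .T1
    obtain ⟨ready₂, best₂⟩ := ready₁.consider best₁ .T2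
    obtain ⟨ready₃, best₃⟩ := ready₂.consider best₂ .T3
    obtain ⟨ready₄, best₄⟩ := ready₃.consider best₃ .T4
    refine ⟨ready₄.agree, ?_⟩
    rw [forestCands_succ_of_far hv hfar, candsOn_trees]
    simp only [Set.insert_union, Set.singleton_union]
    exact best₄
  · exact ⟨hsv, by rwa [forestCands_succ_of_near hfar]⟩

/-! ### The sweep over the cycles -/

/-- The candidates for the new object `j`, for a cycle of length `k` whose shared edge is at
position `p`. -/
def cands (k p : ℕ) : Entry → Set Candidate
  | .T1 => candsOn trees (p + 1) 0
  | .T2 => candsOn trees (p - 1) 0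
  | .T3 => candsOn trees p 0
  | .T4 => forestCands k p 0
  | .F1 => candsOn trees p (p + 1)
  | .F2 => candsOn trees p (p - 1)
  | .F3 => forestCands k p p

/-- The objects in `s` are the best candidates for the cycle `i` that are built on `D`. -/
def Updated (I : Input) (i : ℕ) (D : OldData) (s : State) : Prop :=
  ∀ j, ∃ c ∈ cands I.k (I.pos i) j,
    IsMinOn (candVal I i (pathVal I i) D) (cands I.k (I.pos i) j) c ∧
      s.real (.z j) = candVal I i (pathVal I i) D c ∧
      s.list (.tree j) = pathList I.k i c.del₁ c.del₂ (D.list c.old)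

theorem real_path_exec_pathCost (hk : 2 ≤ I.k) (s : State) :
    (pathCost.exec I s).1.real .path = pathVal I (s.nat .cyc) := by
  rw [pathCost, exec_seqs_cons, exec_seqs_cons, exec_seqs_nil, exec_real]
  let inv : ℕ → State → Prop := fun v s' => s'.nat .cyc = s.nat .cyc ∧
    s'.real .path = I.c (s.nat .cyc, 1) +
      ∑ t ∈ Finset.Ico 2 v, (I.c (s.nat .cyc, t) + pairVal I (s.nat .cyc) (t - 1) t)
  suffices hloop : inv I.k _ from hloop.2
  refine exec_loop inv rfl rfl hk ⟨rfl, ?_⟩ ?_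
  · simp [RExp.eval, EExp.eval, here, NExp.eval]
  · rintro v s' hv - ⟨hcyc, hpath⟩
    refine ⟨hcyc, ?_⟩
    rw [Finset.sum_Ico_succ_top (show 2 ≤ v from hv), ← add_assoc, ← hpath]
    simp [RExp.eval, EExp.eval, here, NExp.eval, pairCost, pairVal, hcyc]

/-- All registers except those that hold the new object `j`. -/
def allBut (j : Entry) : RegSet where
  nat _ := true
  real r := r ≠ .newZ j
  list r := r ≠ .newTree j

theorem Stored.exec {S : Set Candidate} {j : Entry} (h : Stored I s₀ S j s) {p : Cmd}
    (hp : p.writesIn (allBut j)) : Stored I s₀ S j (p.exec I s).1 := by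
  have agree := AgreeOff.exec (I := I) hp s
  simpa only [Stored, agree.real (.newZ j) (by simp [allBut]),
    agree.list (.newTree j) (by simp [allBut])] using h

/-- The part of `update` that finds the new object `j`. -/
def newObject : Entry → Cmd
  | .T1 => fromTrees .T1 (.add (.reg .pos) (.num 1)) (.num 0)
  | .T2 => fromTrees .T2 (.sub (.reg .pos) (.num 1)) (.num 0)
  | .T3 => fromTrees .T3 (.reg .pos) (.num 0)
  | .T4 => fromForests .T4 (.num 0)
  | .F1 => fromTrees .F1 (.reg .pos) (.add (.reg .pos) (.num 1))
  | .F2 => fromTrees .F2 (.reg .pos) (.sub (.reg .pos) (.num 1))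
  | .F3 => fromForests .F3 (.reg .pos)

theorem newObject_writesIn_scratch (j : Entry) : (newObject j).writesIn scratch := by
  cases j <;> rfl

theorem newObject_writesIn_allBut {j j' : Entry} (h : j' ≠ j) :
    (newObject j').writesIn (allBut j) := by
  cases j' <;> cases j <;> first | rfl | exact absurd rfl h

theorem stored_newObject (hk : 1 ≤ I.k) (h : AgreeOff scratch s₀ s) (j : Entry) :
    Stored I s₀ (cands I.k (s₀.nat .pos) j) j ((newObject j).exec I s).1 := by
  have eval_pos : ∀ s, AgreeOff scratch s₀ s → (NExp.reg .pos).eval I s = s₀.nat .pos :=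
    fun s h => h.nat .pos rfl
  have eval_succ : ∀ s, AgreeOff scratch s₀ s →
      (NExp.add (.reg .pos) (.num 1)).eval I s = s₀.nat .pos + 1 :=
    fun s h => congrArg (· + 1) (eval_pos s h)
  have eval_pred : ∀ s, AgreeOff scratch s₀ s →
      (NExp.sub (.reg .pos) (.num 1)).eval I s = s₀.nat .pos - 1 :=
    fun s h => congrArg (· - 1) (eval_pos s h)
  have eval_zero : ∀ s, AgreeOff scratch s₀ s → (NExp.num 0).eval I s = 0 := fun _ _ => rfl
  cases j
  · exact stored_fromTrees hk h eval_succ eval_zero .T1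
  · exact stored_fromTrees hk h eval_pred eval_zero .T2
  · exact stored_fromTrees hk h eval_pos eval_zero .T3
  · exact stored_fromForests hk h eval_zero .T4
  · exact stored_fromTrees hk h eval_pos eval_succ .F1
  · exact stored_fromTrees hk h eval_pos eval_pred .F2
  · exact stored_fromForests hk h eval_pos .F3

theorem stored_newObjects (hk : 1 ≤ I.k) {j : Entry} {l : List Entry} (h : AgreeOff scratch s₀ s)
    (hj : j ∈ l ∨ Stored I s₀ (cands I.k (s₀.nat .pos) j) j s) :
    Stored I s₀ (cands I.k (s₀.nat .pos) j) j ((seqs (l.map newObject)).exec I s).1 := by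
  induction l generalizing s with
  | nil => exact hj.resolve_left List.not_mem_nil
  | cons i l ih =>
    rw [List.map_cons, exec_seqs_cons]
    refine ih (h.trans (.exec (newObject_writesIn_scratch i) s)) ?_
    rcases eq_or_ne i j with rfl | hij
    · exact Or.inr (stored_newObject hk h i)
    · exact hj.imp (fun hj => (List.mem_cons.1 hj).resolve_left hij.symm)
        fun hS => hS.exec (newObject_writesIn_allBut hij)

/-- The part of `update` that replaces the old objects by the new ones. -/
def replaceOld : Cmd :=
  seqs ((trees ++ forests).map fun j =>
    seqs [.real (.z j) (.reg (.newZ j)), .list (.tree j) (.reg (.newTree j))])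

theorem exec_replaceOld (s : State) (j : Entry) :
    (replaceOld.exec I s).1.real (.z j) = s.real (.newZ j) ∧
      (replaceOld.exec I s).1.list (.tree j) = s.list (.newTree j) := by
  cases j <;> simp [replaceOld, trees, forests, RExp.eval, LExp.eval]

theorem updated_update (hk : 2 ≤ I.k) (s : State) :
    Updated I (s.nat .cyc) s.oldData (update.exec I s).1 := by
  have exec_update : (update.exec I s).1 =
      (replaceOld.exec I ((seqs ((trees ++ forests).map newObject)).exec I
        (pathCost.exec I (s.setNat .pos (I.pos (s.nat .cyc)))).1).1).1 := rfl
  rw [exec_update]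
  set s₁ := (pathCost.exec I (s.setNat .pos (I.pos (s.nat .cyc)))).1
  have agree : AgreeOff ⟨(· = .t), (· = .path), fun _ => false⟩
      (s.setNat .pos (I.pos (s.nat .cyc))) s₁ := .exec rfl _
  have hcyc : s₁.nat .cyc = s.nat .cyc := agree.nat .cyc rfl
  have hpos : s₁.nat .pos = I.pos (s.nat .cyc) := (agree.nat .pos rfl).trans (by simp)
  have hpath : s₁.real .path = pathVal I (s.nat .cyc) := real_path_exec_pathCost hk _
  have hlist : ∀ j, s₁.list (.tree j) = s.oldData.list j := fun j => agree.list _ rfl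
  have hold : s₁.oldData = s.oldData := by
    simp only [State.oldData, hlist, agree.real (.z _) rfl, agree.real (.x _) rfl,
      agree.real (.y _) rfl, real_setNat]
  intro j
  have hj : j ∈ trees ++ forests := by cases j <;> decide
  have stored := stored_newObjects (I := I) (by omega) (.refl s₁) (Or.inl hj)
  simp only [Stored, stateVal, hcyc, hpos, hpath, hold, hlist] at stored
  simpa only [(exec_replaceOld _ j).1, (exec_replaceOld _ j).2] using stored

/-- The old objects for the first cycle: the trees consist of the edge at position `0`, and the
forests are empty. -/
def baseData (I : Input) : OldData where
  z j := if j ∈ trees then I.c (0, 0) else 0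
  x j := if j ∈ trees then pairVal I 0 1 0 else 0
  y j := if j ∈ trees then pairVal I 0 (I.k - 1) 0 else 0
  list j := if j ∈ trees then [(0, 0)] else []

/-- The part of `init` before `update`. -/
def initSetup : Cmd :=
  seqs [.nat .cyc (.num 0),
    seqs (trees.map fun j =>
      seqs [.real (.z j) (.c (here (.num 0))), .list .src .nil,
        .list (.tree j) (.cons (here (.num 0)) .src),
        .real (.x j) (pairCost (here (.num 1)) (here (.num 0))),
        .real (.y j) (pairCost (here (.sub .k (.num 1))) (here (.num 0)))]),
    seqs (forests.map fun j =>
      seqs [.real (.z j) .zero, .list (.tree j) .nil, .real (.x j) .zero, .real (.y j) .zero])]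

theorem oldData_initSetup (s : State) : (initSetup.exec I s).1.oldData = baseData I := by
  simp only [initSetup, trees, forests, List.map_cons, List.map_nil, exec_seqs_cons, exec_seqs_nil,
    exec_nat, exec_real, exec_list, pairCost, here, RExp.eval, EExp.eval, NExp.eval, LExp.eval,
    nat_setReal, nat_setList, nat_setNat, if_true, list_setList]
  simp only [State.oldData, baseData, OldData.mk.injEq]
  refine ⟨?_, ?_, ?_, ?_⟩ <;> funext j <;> cases j <;> simp [trees, pairVal]

theorem updated_init (hk : 2 ≤ I.k) (s : State) :
    Updated I 0 (baseData I) (init.exec I s).1 := by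
  have exec_init : (init.exec I s).1 = (update.exec I (initSetup.exec I s).1).1 := rfl
  have hcyc : (initSetup.exec I s).1.nat .cyc = 0 := by
    simp [initSetup, trees, forests, NExp.eval]
  rw [exec_init, ← oldData_initSetup s, ← hcyc]
  exact updated_update hk _

/-- The edges near position `p` of cycle `i` that belong to the object `j`. -/
def nearEdges (i p : ℕ) : Entry → List (ℕ × ℕ)
  | .T1 => [(i, p), (i, p - 1)]
  | .T2 => [(i, p), (i, p + 1)]
  | .T3 => [(i, p - 1), (i, p + 1)]
  | .T4 => [(i, p), (i, p - 1), (i, p + 1)]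
  | .F1 => [(i, p - 1)]
  | .F2 => [(i, p + 1)]
  | .F3 => [(i, p - 1), (i, p + 1)]

/-- The interaction cost of the old object `j` and the edge at position `t` of cycle `i + 1`. -/
def nearPair (I : Input) (i t : ℕ) (j : Entry) : ℝ :=
  ((nearEdges i (I.pos i) j).map fun e => I.q (i + 1, t) e + I.q e (i + 1, t)).sum

/-- The objects of the first `i + 1` cycles, held by `s`, as old objects for the cycle `i + 1`. -/
def nextData (I : Input) (i : ℕ) (s : State) : OldData where
  z j := s.real (.z j)
  x := nearPair I i 1
  y := nearPair I i (I.k - 1)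
  list j := s.list (.tree j)

/-- The part of `round` before `update`. -/
def roundSetup : Cmd :=
  seqs ((trees ++ forests).map fun j =>
    seqs [.real (.x j) (sumExp ((contents j).map (pairCost (here (.num 1))))),
      .real (.y j) (sumExp ((contents j).map (pairCost (here (.sub .k (.num 1))))))])

theorem eval_sumExp_contents {i : ℕ} (hi : s.nat .cyc = i + 1) (p : NExp) (j : Entry) :
    (sumExp ((contents j).map (pairCost (here p)))).eval I s = nearPair I i (p.eval I s) j := by
  cases j <;> simp [nearPair, nearEdges, RExp.eval, EExp.eval, NExp.eval, here, pairCost, sumExp,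
    contents, prevA, prevB, prevB', prevCyc, hi]

theorem oldData_roundSetup {i : ℕ} (hi : s.nat .cyc = i + 1) :
    (roundSetup.exec I s).1.oldData = nextData I i s := by
  simp only [roundSetup, trees, forests, List.cons_append, List.nil_append, List.map_cons,
    List.map_nil, exec_seqs_cons, exec_seqs_nil, exec_real]
  simp only [eval_sumExp_contents (i := i), nat_setReal, hi, NExp.eval]
  simp only [State.oldData, nextData, OldData.mk.injEq]
  refine ⟨?_, ?_, ?_, ?_⟩ <;> funext j <;> cases j <;> simp

theorem updated_round (hk : 2 ≤ I.k) {i : ℕ} (hi : s.nat .cyc = i + 1) :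
    Updated I (i + 1) (nextData I i s) (round.exec I s).1 := by
  have exec_round : (round.exec I s).1 = (update.exec I (roundSetup.exec I s).1).1 := rfl
  have hcyc : (roundSetup.exec I s).1.nat .cyc = i + 1 := by simp [roundSetup, trees, forests, hi]
  rw [exec_round, ← oldData_roundSetup hi, ← hcyc]
  exact updated_update hk _

theorem exec_sweep (hk : 2 ≤ I.k) {e : NExp} {m : ℕ} (hm : 1 ≤ m) (he : ∀ s, e.eval I s = m)
    (P : ℕ → State → Prop) (first : ∀ s, Updated I 0 (baseData I) s → P 1 s)
    (next : ∀ i s s', i + 1 < m → P (i + 1) s → Updated I (i + 1) (nextData I i s) s' →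
      P (i + 2) s') (s : State) :
    P m ((sweep e).exec I s).1 := by
  refine exec_loop P (a := 1) (b := m) rfl (he _) hm (first _ (updated_init hk s)) ?_
  intro v s' hv hvm hP
  obtain ⟨i, rfl⟩ := Nat.exists_eq_add_of_le' hv
  exact next i s' _ hvm hP (updated_round hk (s := s'.setNat .cyc (i + 1)) (by simp))

/-- The output registers of `s` hold a cheapest object of `s₀` with a name in `S`. -/
def Selected (s₀ : State) (S : Set Entry) (s : State) : Prop :=
  ∃ j ∈ S, IsMinOn (fun j => s₀.real (.z j)) S j ∧ s.real .best = s₀.real (.z j) ∧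
    s.list .out = s₀.list (.tree j)

/-- The registers for the output. -/
def outRegs : RegSet where
  nat _ := false
  real r := r = .best
  list r := r = .out

theorem Selected.insert {S : Set Entry} (hS : Selected s₀ S s) (h : AgreeOff outRegs s₀ s)
    (j : Entry) : Selected s₀ (insert j S) ((cond (.rlt (.reg (.z j)) (.reg .best))
      (seqs [.real .best (.reg (.z j)), .list .out (.reg (.tree j))])).exec I s).1 := by
  classical
  obtain ⟨j₀, hj₀, hmin, hbest, hout⟩ := hS
  rw [exec_cond]
  simp only [BExp.holds, RExp.eval, hbest, h.real (.z j) rfl]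
  split_ifs with hlt
  · refine ⟨j, Set.mem_insert _ _, ?_, ?_, ?_⟩
    · rintro j' (rfl | hj')
      · exact le_refl (s₀.real _)
      · exact hlt.le.trans (hmin hj')
    · simp [RExp.eval, h.real (.z j) rfl]
    · simp [LExp.eval, h.list (.tree j) rfl]
  · refine ⟨j₀, Set.mem_insert_of_mem _ hj₀, ?_, hbest, hout⟩
    rintro j' (rfl | hj')
    · exact not_lt.1 hlt
    · exact hmin hj'

theorem selected_finish (s : State) : Selected s {j | j ∈ trees} (finish.exec I s).1 := by
  have start : Selected s {.T1} ((s.setReal .best (s.real (.z .T1))).setList .out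
      (s.list (.tree .T1))) := ⟨.T1, rfl, by simp [IsMinOn, IsMinFilter], by simp⟩
  have agree₁ : AgreeOff outRegs s ((s.setReal .best (s.real (.z .T1))).setList .out
      (s.list (.tree .T1))) := (AgreeOff.setReal rfl _).trans (.setList rfl _)
  have agree₂ := agree₁.trans (.exec (I := I) (p := cond (.rlt (.reg (.z .T2)) (.reg .best))
      (seqs [.real .best (.reg (.z .T2)), .list .out (.reg (.tree .T2))])) rfl _)
  have agree₃ := agree₂.trans (.exec (I := I) (p := cond (.rlt (.reg (.z .T3)) (.reg .best))
      (seqs [.real .best (.reg (.z .T3)), .list .out (.reg (.tree .T3))])) rfl _)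
  have hset : {j | j ∈ trees} = ({.T4, .T3, .T2, .T1} : Set Entry) := by ext j; simp [trees]; tauto
  rw [hset]
  exact ((start.insert agree₁ .T2).insert agree₂ .T3).insert agree₃ .T4

end Execution

/-! ### The structure of ladders -/

section Positions

variable {k d d₁ d₂ t : ℕ} {S : Finset ℕ}

/-- The positions `1, …, k - 1` of a cycle, without the positions `d₁` and `d₂`. The position `0`
stands for no deletion. -/
def kept (k d₁ d₂ : ℕ) : Finset ℕ := ((Finset.Ico 1 k).erase d₁).erase d₂

theorem mem_kept : t ∈ kept k d₁ d₂ ↔ (1 ≤ t ∧ t < k) ∧ t ≠ d₁ ∧ t ≠ d₂ := by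
  grind [kept]

theorem kept_subset : kept k d₁ d₂ ⊆ Finset.Ico 1 k :=
  (Finset.erase_subset _ _).trans (Finset.erase_subset _ _)

theorem kept_comm : kept k d₁ d₂ = kept k d₂ d₁ := Finset.erase_right_comm

theorem kept_zero_zero : kept k 0 0 = Finset.Ico 1 k := by simp [kept]

theorem insert_eq_kept_iff (h₁ : 1 ≤ d₁) (h₂ : d₁ < k) :
    d₁ ∉ S ∧ insert d₁ S = kept k 0 d₂ ↔ d₁ ≠ d₂ ∧ S = kept k d₁ d₂ := by
  constructor
  · rintro ⟨hS, h⟩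
    have hmem : d₁ ∈ kept k 0 d₂ := h ▸ Finset.mem_insert_self _ _
    refine ⟨(mem_kept.1 hmem).2.2, ?_⟩
    rw [← Finset.erase_insert hS, h, kept, kept, Finset.erase_right_comm,
      Finset.erase_eq_of_notMem (s := Finset.Ico 1 k) (by simp)]
  · rintro ⟨hne, rfl⟩
    refine ⟨fun h => (mem_kept.1 h).2.1 rfl, ?_⟩
    ext t
    rw [Finset.mem_insert, mem_kept, mem_kept]
    omega

theorem card_add_one_eq_iff (hk : 1 ≤ k) (hS : S ⊆ Finset.Ico 1 k) :
    S.card + 1 = k ↔ S = kept k 0 0 := by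
  rw [kept_zero_zero]
  refine ⟨fun h => Finset.eq_of_subset_of_card_le hS ?_, fun h => ?_⟩ <;> grind [Nat.card_Ico]

theorem card_add_two_eq_iff (hk : 1 ≤ k) (hS : S ⊆ Finset.Ico 1 k) :
    S.card + 2 = k ↔ ∃ d, (1 ≤ d ∧ d < k) ∧ S = kept k 0 d := by
  have hcard : S.card + 2 = k ↔ S ⊆ Finset.Ico 1 k ∧ S.card + 1 = (Finset.Ico 1 k).card := by
    grind [Nat.card_Ico]
  rw [hcard, ← Finset.exists_eq_insert_iff]
  constructor
  · rintro ⟨d, hd, h⟩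
    have hmem := Finset.mem_Ico.1 (h ▸ Finset.mem_insert_self d S)
    exact ⟨d, hmem, kept_comm ▸ ((insert_eq_kept_iff hmem.1 hmem.2).1
      ⟨hd, h.trans kept_zero_zero.symm⟩).2⟩
  · rintro ⟨d, hd, rfl⟩
    rw [kept_comm, ← kept_zero_zero]
    exact ⟨d, (insert_eq_kept_iff hd.1 hd.2).2 ⟨by omega, rfl⟩⟩

end Positions

namespace Labelling

section Structure

variable {V : Type*} {G : SimpleGraph V} {k n m t : ℕ} (L : Labelling G k n)

/-- The edges of the graph that cycle `m` is fused to: those of the first `m` cycles and the edge at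
position `0` (which is one of them if `m ≥ 1`). -/
def oldEdges (m : ℕ) : Set (Sym2 V) := L.edges m ∪ {L.edge m 0}

/-- The vertices of the graph that cycle `m` is fused to. -/
def oldVerts (m : ℕ) : Set V := L.verts m ∪ {L.x m 0, L.x m 1}

/-- `A` is a spanning tree of the graph that cycle `m` is fused to. -/
def OldTree (m : ℕ) (A : Finset (Sym2 V)) : Prop :=
  (A : Set (Sym2 V)) ⊆ L.oldEdges m ∧ Spans (SimpleGraph.fromEdgeSet A) (L.oldVerts m)

/-- `A` is a spanning forest of the graph that cycle `m` is fused to, and consists of two trees that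
separate the end points of the edge at position `0`. -/
def OldForest (m : ℕ) (A : Finset (Sym2 V)) : Prop :=
  (A : Set (Sym2 V)) ⊆ L.oldEdges m ∧
    Splits (SimpleGraph.fromEdgeSet A) (L.oldVerts m) (L.x m 0) (L.x m 1)

theorem edge_eq (ht : t + 1 < k) : L.edge m t = s(L.x m t, L.x m (t + 1)) := by
  rw [edge, Nat.mod_eq_of_lt ht]

theorem edge_last (ht : t + 1 = k) : L.edge m t = s(L.x m t, L.x m 0) := by
  rw [edge, ht, Nat.mod_self]

theorem attached (hk : 3 ≤ k) (hm : m < n) : Attached k (L.x m) (L.oldVerts m) where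
  three_le := hk
  inj := L.inj m hm
  mem_zero := .inr (.inl rfl)
  mem_one := .inr (.inr rfl)
  fresh t h2 ht := by
    rintro (⟨i, hi, u, hu, h⟩ | h | h)
    · obtain ⟨m, rfl⟩ : ∃ m', m = m' + 1 := ⟨m - 1, by omega⟩
      exact L.fresh m hm t h2 ht i (by omega) u hu h.symm
    · exact absurd (L.inj m hm ht (show 0 < k by omega) h) (by omega)
    · exact absurd (L.inj m hm ht (show 1 < k by omega) h) (by omega)

theorem mem_oldVerts_of_mem_oldEdges (hk : 2 ≤ k) {e : Sym2 V} (he : e ∈ L.oldEdges m) {v : V}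
    (hv : v ∈ e) : v ∈ L.oldVerts m := by
  rcases he with ⟨i, hi, t, ht, rfl⟩ | rfl
  · rcases Sym2.mem_iff.1 hv with rfl | rfl
    exacts [.inl ⟨i, hi, t, ht, rfl⟩, .inl ⟨i, hi, _, Nat.mod_lt _ (by omega), rfl⟩]
  · rw [L.edge_eq (by omega), Sym2.mem_iff] at hv
    exact .inr hv

theorem support_subset_oldVerts (hk : 2 ≤ k) {A : Set (Sym2 V)} (hA : A ⊆ L.oldEdges m) :
    (SimpleGraph.fromEdgeSet A).support ⊆ L.oldVerts m := by
  rintro v ⟨w, hvw⟩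
  exact L.mem_oldVerts_of_mem_oldEdges hk (hA ((SimpleGraph.fromEdgeSet_adj A).1 hvw).1)
    (Sym2.mem_mk_left v w)

theorem edges_succ (hk : 1 ≤ k) : L.edges (m + 1) = L.oldEdges m ∪ L.edge m '' Set.Ico 1 k := by
  ext e
  constructor
  · rintro ⟨i, hi, t, ht, rfl⟩
    rcases Nat.lt_succ_iff_lt_or_eq.1 hi with hi | rfl
    · exact .inl (.inl ⟨i, hi, t, ht, rfl⟩)
    · rcases t.eq_zero_or_pos with rfl | hpos
      exacts [.inl (.inr rfl), .inr ⟨t, ⟨hpos, ht⟩, rfl⟩]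
  · rintro ((⟨i, hi, t, ht, rfl⟩ | rfl) | ⟨t, ht, rfl⟩)
    exacts [⟨i, by omega, t, ht, rfl⟩, ⟨m, by omega, 0, by omega, rfl⟩, ⟨m, by omega, t, ht.2, rfl⟩]

theorem verts_succ (hk : 2 ≤ k) : L.verts (m + 1) = extendVerts (L.oldVerts m) (L.x m) (k - 1) := by
  ext v
  constructor
  · rintro ⟨i, hi, t, ht, rfl⟩
    rcases Nat.lt_succ_iff_lt_or_eq.1 hi with hi | rfl
    · exact .inl (.inl ⟨i, hi, t, ht, rfl⟩)
    · rcases Nat.lt_or_ge t 2 with h2 | h2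
      · interval_cases t
        exacts [.inl (.inr (.inl rfl)), .inl (.inr (.inr rfl))]
      · exact .inr ⟨t, ⟨h2, by omega⟩, rfl⟩
  · rintro ((⟨i, hi, t, ht, rfl⟩ | rfl | rfl) | ⟨t, ht, rfl⟩)
    exacts [⟨i, by omega, t, ht, rfl⟩, ⟨m, by omega, 0, by omega, rfl⟩,
      ⟨m, by omega, 1, by omega, rfl⟩, ⟨m, by omega, t, by have := ht.2; omega, rfl⟩]

theorem edge_injOn (hk : 3 ≤ k) (hm : m < n) : Set.InjOn (L.edge m) (Set.Iio k) := by
  intro s hs t ht h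
  have hmod : ∀ {a}, a < k → (a + 1) % k = if a + 1 = k then 0 else a + 1 := by
    intro a ha
    split_ifs with h
    exacts [h ▸ Nat.mod_self k, Nat.mod_eq_of_lt (by omega)]
  have hlt : ∀ a, (a + 1) % k < k := fun a => Nat.mod_lt _ (by omega)
  rcases Sym2.eq_iff.1 h with ⟨h, -⟩ | ⟨hs', ht'⟩
  · exact L.inj m hm hs ht h
  · have hs' := L.inj m hm hs (hlt t) hs'
    have ht' := L.inj m hm (hlt s) ht ht'
    rw [hmod ht] at hs'
    rw [hmod hs] at ht'
    split_ifs at hs' ht' <;> omega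

theorem edge_ne (hk : 3 ≤ k) (hm : m < n) {s t : ℕ} (hs : s < k) (ht : t < k) (hst : s ≠ t) :
    L.edge m s ≠ L.edge m t :=
  fun h => hst (L.edge_injOn hk hm hs ht h)

theorem edge_notMem_oldEdges (hk : 3 ≤ k) (hm : m < n) (h1 : 1 ≤ t) (ht : t < k) :
    L.edge m t ∉ L.oldEdges m := fun h => by
  have hold : ∀ v ∈ L.edge m t, v ∈ L.oldVerts m := fun v =>
    L.mem_oldVerts_of_mem_oldEdges (by omega) h
  rcases h1.eq_or_lt with rfl | h2
  · rw [L.edge_eq (by omega)] at hold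
    exact (L.attached hk hm).fresh 2 le_rfl (by omega) (hold _ (Sym2.mem_mk_right _ _))
  · exact (L.attached hk hm).fresh t h2 ht (hold _ (Sym2.mem_mk_left _ _))

theorem oldEdges_succ (hk : 3 ≤ k) (hm : m + 1 < n) : L.oldEdges (m + 1) = L.edges (m + 1) := by
  refine Set.union_eq_self_of_subset_right (Set.singleton_subset_iff.2 ?_)
  rw [L.edge_eq (by omega)]
  exact ⟨m, by omega, _, L.pos_lt m (by omega), (L.glue m hm).symm⟩

theorem oldVerts_succ (hk : 1 ≤ k) (hm : m + 1 < n) : L.oldVerts (m + 1) = L.verts (m + 1) := by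
  refine Set.union_eq_self_of_subset_right fun v hv => ?_
  have hshared : v ∈ s(L.x (m + 1) 0, L.x (m + 1) 1) := Sym2.mem_iff.2 hv
  rw [L.glue m hm, Sym2.mem_iff] at hshared
  rcases hshared with rfl | rfl
  exacts [⟨m, by omega, _, L.pos_lt m (by omega), rfl⟩,
    ⟨m, by omega, _, Nat.mod_lt _ (by omega), rfl⟩]

variable {L} {A T : Finset (Sym2 V)} {S : Finset ℕ}

theorem spanningTree_iff : L.SpanningTree m T ↔
    (T : Set (Sym2 V)) ⊆ L.edges m ∧ Spans (SimpleGraph.fromEdgeSet T) (L.verts m) := Iff.rfl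

variable [DecidableEq V]

theorem oldForest_iff (hk : 3 ≤ k) (hm : m < n) :
    L.OldForest m A ↔ L.edge m 0 ∉ A ∧ L.OldTree m (insert (L.edge m 0) A) := by
  have hne : L.x m 0 ≠ L.x m 1 := (L.attached hk hm).ne (by omega) (by omega) (by omega)
  have hmem : L.edge m 0 ∈ L.oldEdges m := .inr rfl
  rw [OldForest, OldTree, splits_fromEdgeSet_iff hne (.inr (.inl rfl)), Finset.coe_insert,
    Set.insert_subset_iff, and_iff_right hmem, L.edge_eq (by omega), Finset.mem_coe, and_left_comm]

theorem splitForest_iff (hm : m < n) (hpos : L.pos m + 1 < k) :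
    L.SplitForest (m + 1) T ↔ L.edge m (L.pos m) ∉ T ∧
      L.SpanningTree (m + 1) (insert (L.edge m (L.pos m)) T) := by
  have hne : L.x m (L.pos m) ≠ L.x m (L.pos m + 1) := fun h =>
    absurd (L.inj m hm (show L.pos m < k by omega) hpos h) (by omega)
  have hmem : L.edge m (L.pos m) ∈ L.edges (m + 1) := ⟨m, by omega, _, by omega, rfl⟩
  have hvert : L.x m (L.pos m) ∈ L.verts (m + 1) := ⟨m, by omega, _, by omega, rfl⟩
  have hdef : L.SplitForest (m + 1) T ↔ (T : Set (Sym2 V)) ⊆ L.edges (m + 1) ∧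
      Splits (SimpleGraph.fromEdgeSet T) (L.verts (m + 1)) (L.x m (L.pos m))
        (L.x m (L.pos m + 1)) := Iff.rfl
  rw [hdef, spanningTree_iff, splits_fromEdgeSet_iff hne hvert, Finset.coe_insert,
    Set.insert_subset_iff, and_iff_right hmem, L.edge_eq hpos, Finset.mem_coe, and_left_comm]

/-- The edge set `A` together with the edges of cycle `m` at the positions in `S`. -/
def combine (L : Labelling G k n) (m : ℕ) (A : Finset (Sym2 V)) (S : Finset ℕ) : Finset (Sym2 V) :=
  A ∪ S.image (L.edge m)

theorem coe_combine : (L.combine m A S : Set (Sym2 V)) = ↑A ∪ L.edge m '' S := by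
  rw [combine, Finset.coe_union, Finset.coe_image]

theorem combine_insert : L.combine m A (insert t S) = insert (L.edge m t) (L.combine m A S) := by
  rw [combine, combine, Finset.image_insert, Finset.union_insert]

theorem exists_combine (hk : 1 ≤ k) (hT : (T : Set (Sym2 V)) ⊆ L.edges (m + 1)) :
    ∃ (A : Finset (Sym2 V)) (S : Finset ℕ), (A : Set (Sym2 V)) ⊆ L.oldEdges m ∧
      S ⊆ Finset.Ico 1 k ∧ T = L.combine m A S := by
  classical
  have hnew : ((T.filter (· ∉ L.oldEdges m) : Finset _) : Set (Sym2 V)) ⊆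
      L.edge m '' (Finset.Ico 1 k : Finset ℕ) := by
    intro e he
    rw [Finset.mem_coe, Finset.mem_filter] at he
    rw [L.edges_succ hk] at hT
    rw [Finset.coe_Ico]
    exact (hT he.1).resolve_left he.2
  obtain ⟨S, hS, hST⟩ := Finset.subset_set_image_iff.1 hnew
  refine ⟨T.filter (· ∈ L.oldEdges m), S, fun e he => (Finset.mem_filter.1 he).2,
    Finset.coe_subset.1 hS, ?_⟩
  rw [combine, hST, Finset.filter_union_filter_not_eq]

section Combine

variable (hA : (A : Set (Sym2 V)) ⊆ L.oldEdges m) (hS : S ⊆ Finset.Ico 1 k)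

include hA hS

theorem edge_mem_combine (hk : 3 ≤ k) (hm : m < n) (h1 : 1 ≤ t) (ht : t < k) :
    L.edge m t ∈ L.combine m A S ↔ t ∈ S := by
  have hold : L.edge m t ∉ A := fun h => L.edge_notMem_oldEdges hk hm h1 ht (hA h)
  rw [combine, Finset.mem_union, or_iff_right hold]
  refine ⟨fun h => ?_, Finset.mem_image_of_mem _⟩
  obtain ⟨u, hu, he⟩ := Finset.mem_image.1 h
  rwa [← L.edge_injOn hk hm (Finset.mem_Ico.1 (hS hu)).2 ht he]

theorem spanningTree_combine_iff (hk : 3 ≤ k) (hm : m < n) :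
    L.SpanningTree (m + 1) (L.combine m A S) ↔ (L.OldForest m A ∧ S = kept k 0 0) ∨
      ∃ t, (1 ≤ t ∧ t < k) ∧ L.OldTree m A ∧ S = kept k 0 t := by
  have hgraph : SimpleGraph.fromEdgeSet (L.combine m A S : Set (Sym2 V)) =
      withCycleEdges (SimpleGraph.fromEdgeSet A) k (L.x m) S := by
    rw [coe_combine, SimpleGraph.fromEdgeSet_union]
    rfl
  have hsub : (L.combine m A S : Set (Sym2 V)) ⊆ L.edges (m + 1) := by
    rw [coe_combine, L.edges_succ (by omega), ← Finset.coe_Ico]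
    exact Set.union_subset_union hA (Set.image_mono (Finset.coe_subset.2 hS))
  rw [spanningTree_iff, and_iff_right hsub, hgraph, L.verts_succ (by omega),
    (L.attached hk hm).spans_cycle_iff (L.support_subset_oldVerts (by omega) hA) hS,
    card_add_one_eq_iff (by omega) hS, card_add_two_eq_iff (by omega) hS, OldForest, OldTree,
    and_iff_right hA, and_iff_right hA]
  grind

theorem splitForest_combine_iff (hk : 3 ≤ k) (hm : m < n) (h1 : 1 ≤ L.pos m)
    (hpos : L.pos m + 1 < k) :
    L.SplitForest (m + 1) (L.combine m A S) ↔ (L.OldForest m A ∧ S = kept k (L.pos m) 0) ∨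
      ∃ t, (1 ≤ t ∧ t < k ∧ t ≠ L.pos m) ∧ L.OldTree m A ∧ S = kept k (L.pos m) t := by
  have hinsert : ∀ d, L.pos m ∉ S ∧ insert (L.pos m) S = kept k 0 d ↔
      L.pos m ≠ d ∧ S = kept k (L.pos m) d := fun d => insert_eq_kept_iff h1 (by omega)
  rw [splitForest_iff hm hpos, edge_mem_combine hA hS hk hm h1 (by omega), ← combine_insert,
    spanningTree_combine_iff hA
      (Finset.insert_subset (Finset.mem_Ico.2 ⟨h1, by omega⟩) hS) hk hm]
  grind

end Combine

end Structure

end Labelling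

/-! ### The admissible edge sets and the candidates -/

theorem mem_forests_iff (j : Entry) : j ∈ forests ↔ j ∉ trees := by
  cases j <;> simp [forests, trees]

section Candidates

variable {P : Entry → Prop} {Q : ℕ → ℕ → Prop} {k p d d₁ d₂ : ℕ}

theorem exists_mem_candsOn_iff {js : List Entry} :
    (∃ c ∈ candsOn js d₁ d₂, P c.old ∧ Q c.del₁ c.del₂) ↔ (∃ j ∈ js, P j) ∧ Q d₁ d₂ := by
  constructor
  · rintro ⟨⟨j, _, _⟩, ⟨hj, rfl, rfl⟩, hP, hQ⟩
    exact ⟨⟨j, hj, hP⟩, hQ⟩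
  · rintro ⟨⟨j, hj, hP⟩, hQ⟩
    exact ⟨⟨j, d₁, d₂⟩, ⟨hj, rfl, rfl⟩, hP, hQ⟩

theorem exists_mem_forestCands_iff :
    (∃ c ∈ forestCands k p d, P c.old ∧ Q c.del₁ c.del₂) ↔ (∃ j ∈ forests, P j) ∧ Q d 0 ∨
      ∃ t, (1 ≤ t ∧ t < k ∧ (t + 1 < p ∨ p + 1 < t)) ∧ (∃ j ∈ trees, P j) ∧ Q d t := by
  simp_rw [forestCands, Set.mem_union, or_and_right, exists_or, ← exists_mem_candsOn_iff,
    Set.mem_ofPred_eq]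
  grind

end Candidates

namespace Labelling

section Admissible

variable {V : Type*} {G : SimpleGraph V} {k n m : ℕ} {L : Labelling G k n} {j : Entry}
  {A T : Finset (Sym2 V)} {S : Finset ℕ}

theorem Admissible.subset_edges (h : L.Admissible (m + 1) j T) :
    (T : Set (Sym2 V)) ⊆ L.edges (m + 1) := by
  cases j <;> exact h.1.1

theorem oldTree_succ_iff (hk : 3 ≤ k) (hm : m + 1 < n) :
    L.OldTree (m + 1) A ↔ L.SpanningTree (m + 1) A := by
  rw [OldTree, spanningTree_iff, L.oldEdges_succ hk hm, L.oldVerts_succ (by omega) hm]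

theorem oldTree_zero_iff (hk : 3 ≤ k) (hn : 0 < n) : L.OldTree 0 A ↔ A = {L.edge 0 0} := by
  have hE : L.oldEdges 0 = {L.edge 0 0} := by
    simp [oldEdges, edges]
  have hW : L.oldVerts 0 = {L.x 0 0, L.x 0 1} := by
    simp [oldVerts, verts]
  have hne : L.x 0 0 ≠ L.x 0 1 := (L.attached hk hn).ne (by omega) (by omega) (by omega)
  rw [OldTree, hE, hW, ← Finset.coe_singleton, Finset.coe_subset, Finset.subset_singleton_iff]
  constructor
  · rintro ⟨rfl | hA, hspans⟩
    · rw [Finset.coe_empty, SimpleGraph.fromEdgeSet_empty] at hspans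
      exact absurd hspans (not_spans_of_isIsolated (w := L.x 0 0) (u := L.x 0 1) (fun _ => id)
        (.inl rfl) (.inr rfl) hne.symm)
    · exact hA
  · rintro rfl
    refine ⟨.inr rfl, ?_⟩
    rw [Finset.coe_singleton, ← insert_empty_eq, L.edge_eq (by omega)]
    refine ((splits_fromEdgeSet_iff hne (.inl rfl)).1 ?_).2
    rw [SimpleGraph.fromEdgeSet_empty]
    refine ⟨SimpleGraph.isAcyclic_bot, by simpa using hne, ?_⟩
    rintro w (rfl | rfl)
    exacts [.inl .rfl, .inr .rfl]

theorem oldForest_succ_iff (hk : 3 ≤ k) (hm : m + 1 < n) (hpos : L.pos m + 1 < k) :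
    L.OldForest (m + 1) A ↔ L.SplitForest (m + 1) A := by
  classical
  rw [oldForest_iff hk hm, splitForest_iff (by omega) hpos, oldTree_succ_iff hk hm,
    L.edge_eq (by omega), L.glue m hm, edge]

theorem oldForest_zero_iff (hk : 3 ≤ k) (hn : 0 < n) : L.OldForest 0 A ↔ A = ∅ := by
  classical
  rw [oldForest_iff hk hn, oldTree_zero_iff hk hn]
  constructor
  · rintro ⟨hedge, hins⟩
    rw [← Finset.erase_insert hedge, hins, Finset.erase_singleton]
  · rintro rfl
    exact ⟨Finset.notMem_empty _, insert_empty_eq _⟩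

theorem exists_trees_admissible_iff (hk : 4 ≤ k) (hm : m < n) :
    (∃ j ∈ trees, L.Admissible (m + 1) j T) ↔ L.SpanningTree (m + 1) T := by
  classical
  constructor
  · rintro ⟨j, hj, h⟩
    cases j <;> first | exact h.1 | simp [trees] at hj
  · intro h
    obtain ⟨hp, hpk⟩ := L.pos_free hk m hm
    obtain ⟨A, S, hA, hS, rfl⟩ := exists_combine (by omega) h.1
    have hmem : ∀ t, 1 ≤ t → t < k → (L.edge m t ∈ L.combine m A S ↔ t ∈ S) := fun t =>
      edge_mem_combine hA hS (by omega) hm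
    suffices hnear : (L.pos m ∈ S ∨ L.pos m - 1 ∈ S) ∧ (L.pos m ∈ S ∨ L.pos m + 1 ∈ S) ∧
        (L.pos m - 1 ∈ S ∨ L.pos m + 1 ∈ S) by
      simp only [trees, Admissible, List.mem_cons, List.not_mem_nil, or_false, exists_eq_or_imp,
        exists_eq_left, Nat.add_sub_cancel, h, true_and]
      grind
    rcases (spanningTree_combine_iff hA hS (by omega) hm).1 h with ⟨-, rfl⟩ | ⟨t, -, -, rfl⟩ <;>
      grind [mem_kept]

theorem exists_forests_admissible_iff (hk : 4 ≤ k) (hm : m < n) :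
    (∃ j ∈ forests, L.Admissible (m + 1) j T) ↔ L.SplitForest (m + 1) T := by
  classical
  constructor
  · rintro ⟨j, hj, h⟩
    cases j <;> first | exact h.1 | simp [forests] at hj
  · intro h
    obtain ⟨hp, hpk⟩ := L.pos_free hk m hm
    obtain ⟨A, S, hA, hS, rfl⟩ := exists_combine (by omega) h.1
    have hmem : ∀ t, 1 ≤ t → t < k → (L.edge m t ∈ L.combine m A S ↔ t ∈ S) := fun t =>
      edge_mem_combine hA hS (by omega) hm
    suffices hnear : L.pos m ∉ S ∧ (L.pos m - 1 ∈ S ∨ L.pos m + 1 ∈ S) by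
      simp only [forests, Admissible, List.mem_cons, List.not_mem_nil, or_false, exists_eq_or_imp,
        exists_eq_left, Nat.add_sub_cancel, h, true_and]
      grind
    rcases (splitForest_combine_iff hA hS (by omega) hm (by omega) (by omega)).1 h with
      ⟨-, rfl⟩ | ⟨t, -, -, rfl⟩ <;> grind [mem_kept]

/-- The constraint on the old object `j` before cycle `m` is fused: for `m = 0` the only old tree is
the edge at position `0`, and the only old forest is empty. -/
def OldAdmissible (L : Labelling G k n) : ℕ → Entry → Finset (Sym2 V) → Prop
  | 0, j, A => A = if j ∈ trees then {L.edge 0 0} else ∅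
  | m + 1, j, A => L.Admissible (m + 1) j A

theorem exists_trees_oldAdmissible_iff (hk : 4 ≤ k) (hm : m < n) :
    (∃ j ∈ trees, L.OldAdmissible m j A) ↔ L.OldTree m A := by
  cases m with
  | zero => simp [OldAdmissible, oldTree_zero_iff (show 3 ≤ k by omega) hm, trees]
  | succ m =>
    rw [oldTree_succ_iff (by omega) hm]
    exact exists_trees_admissible_iff hk (by omega)

theorem exists_forests_oldAdmissible_iff (hk : 4 ≤ k) (hm : m < n) :
    (∃ j ∈ forests, L.OldAdmissible m j A) ↔ L.OldForest m A := by
  cases m with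
  | zero => simp [OldAdmissible, oldForest_zero_iff (show 3 ≤ k by omega) hm, trees, forests]
  | succ m =>
    have hpos := L.pos_free hk m (by omega)
    rw [oldForest_succ_iff (by omega) hm (by omega)]
    exact exists_forests_admissible_iff hk (by omega)

theorem OldAdmissible.subset_oldEdges (hk : 4 ≤ k) (hm : m < n) (h : L.OldAdmissible m j A) :
    (A : Set (Sym2 V)) ⊆ L.oldEdges m := by
  by_cases hj : j ∈ trees
  · exact ((exists_trees_oldAdmissible_iff hk hm).1 ⟨j, hj, h⟩).1
  · exact ((exists_forests_oldAdmissible_iff hk hm).1 ⟨j, (mem_forests_iff j).2 hj, h⟩).1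

variable [DecidableEq V]

theorem admissible_combine_iff (hk : 4 ≤ k) (hm : m < n) (hA : (A : Set (Sym2 V)) ⊆ L.oldEdges m)
    (hS : S ⊆ Finset.Ico 1 k) :
    L.Admissible (m + 1) j (L.combine m A S) ↔
      ∃ c ∈ cands k (L.pos m) j, L.OldAdmissible m c.old A ∧ S = kept k c.del₁ c.del₂ := by
  obtain ⟨hp, hpk⟩ := L.pos_free hk m hm
  have hmem : ∀ t, 1 ≤ t → t < k → (L.edge m t ∈ L.combine m A S ↔ t ∈ S) := fun t =>
    edge_mem_combine hA hS (by omega) hm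
  have hT := spanningTree_combine_iff hA hS (show 3 ≤ k by omega) hm
  have hF := splitForest_combine_iff hA hS (show 3 ≤ k by omega) hm (by omega) (by omega)
  have hcands := fun js d₁ d₂ => exists_mem_candsOn_iff (P := (L.OldAdmissible m · A))
    (Q := fun d₁ d₂ => S = kept k d₁ d₂) (js := js) (d₁ := d₁) (d₂ := d₂)
  have hforests := fun d => exists_mem_forestCands_iff (P := (L.OldAdmissible m · A))
    (Q := fun d₁ d₂ => S = kept k d₁ d₂) (k := k) (p := L.pos m) (d := d)
  cases j <;>
    simp only [Admissible, Nat.add_sub_cancel, hmem (L.pos m) (by omega) (by omega),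
      hmem (L.pos m - 1) (by omega) (by omega), hmem (L.pos m + 1) (by omega) (by omega), hT, hF,
      cands, hcands, hforests,
      exists_trees_oldAdmissible_iff hk hm, exists_forests_oldAdmissible_iff hk hm]
  case T4 | F3 =>
    constructor
    · rintro ⟨h | ⟨t, ht, hold, rfl⟩, hnear⟩
      · exact Or.inl h
      · exact Or.inr ⟨t, by simp only [mem_kept] at hnear; omega, hold, rfl⟩
    · rintro (⟨hold, rfl⟩ | ⟨t, ht, hold, rfl⟩)
      · exact ⟨Or.inl ⟨hold, rfl⟩, by simp only [mem_kept]; omega⟩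
      · exact ⟨Or.inr ⟨t, by omega, hold, rfl⟩, by simp only [mem_kept]; omega⟩
  all_goals
    constructor
    · rintro ⟨⟨-, rfl⟩ | ⟨t, _, hold, rfl⟩, hnear⟩ <;> simp only [mem_kept] at hnear
      · omega
      · refine ⟨hold, ?_⟩
        ext u
        simp only [mem_kept]
        omega
    · rintro ⟨hold, rfl⟩
      refine ⟨Or.inr ?_, by simp only [mem_kept]; omega⟩
      first
        | exact ⟨_, by omega, hold, kept_comm ..⟩
        | exact ⟨_, by omega, hold, rfl⟩

theorem admissible_iff (hk : 4 ≤ k) (hm : m < n) :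
    L.Admissible (m + 1) j T ↔ ∃ c ∈ cands k (L.pos m) j, ∃ A, L.OldAdmissible m c.old A ∧
      T = L.combine m A (kept k c.del₁ c.del₂) := by
  constructor
  · intro h
    obtain ⟨A, S, hA, hS, rfl⟩ := exists_combine (by omega) h.subset_edges
    obtain ⟨c, hc, hold, rfl⟩ := (admissible_combine_iff hk hm hA hS).1 h
    exact ⟨c, hc, A, hold, rfl⟩
  · rintro ⟨c, hc, A, hold, rfl⟩
    exact (admissible_combine_iff hk hm (hold.subset_oldEdges hk hm) kept_subset).2
      ⟨c, hc, hold, rfl⟩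

end Admissible

end Labelling

/-! ### The cost of a fusion -/

theorem sum_eq_sum_ite_mem {α : Type*} [DecidableEq α] {S B : Finset α} {f : α → ℝ}
    (h : ∀ a ∈ S, a ∉ B → f a = 0) : ∑ a ∈ S, f a = ∑ b ∈ B, if b ∈ S then f b else 0 := by
  rw [Finset.sum_ite_mem]
  exact (Finset.sum_subset Finset.inter_subset_right fun a haS ha =>
    h a haS fun haB => ha (Finset.mem_inter.2 ⟨haB, haS⟩)).symm

section Cost

variable {V : Type*} {c : Sym2 V → ℝ} {q : Sym2 V → Sym2 V → ℝ}

/-- The interaction cost of the edge `e` with the edges in `A`. -/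
def interaction (q : Sym2 V → Sym2 V → ℝ) (e : Sym2 V) (A : Finset (Sym2 V)) : ℝ :=
  ∑ f ∈ A, (q e f + q f e)

variable [DecidableEq V]

theorem cost_empty : cost c q ∅ = 0 := by simp [cost]

theorem cost_insert {A : Finset (Sym2 V)} {e : Sym2 V} (he : e ∉ A) :
    cost c q (insert e A) = cost c q A + c e + interaction q e A := by
  have hpairs : ∀ f ∈ A, ∑ g ∈ (insert e A).erase f, q f g = q f e + ∑ g ∈ A.erase f, q f g := by
    intro f hf
    have hne : e ≠ f := fun h => he (h ▸ hf)
    rw [Finset.erase_insert_of_ne hne, Finset.sum_insert fun h => he (Finset.mem_of_mem_erase h)]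
  rw [cost, cost, interaction, Finset.sum_insert he, Finset.sum_insert he, Finset.erase_insert he,
    Finset.sum_congr rfl hpairs, Finset.sum_add_distrib, Finset.sum_add_distrib]
  ring

theorem cost_union {A B : Finset (Sym2 V)} (h : Disjoint A B) :
    cost c q (A ∪ B) = cost c q A + cost c q B + ∑ f ∈ B, interaction q f A := by
  induction B using Finset.induction_on with
  | empty => simp [cost_empty]
  | insert f B hf ih =>
    rw [Finset.disjoint_insert_right] at h
    rw [Finset.union_insert, cost_insert (by simp [h.1, hf]), cost_insert hf, Finset.sum_insert hf,
      ih h.2, interaction, Finset.sum_union h.2, interaction, interaction]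
    ring

end Cost

namespace Labelling

section Incidence

variable {V : Type*} {G : SimpleGraph V} {k n m s t u : ℕ} {L : Labelling G k n} {e : Sym2 V}
  {q : Sym2 V → Sym2 V → ℝ}

theorem x_mem_edge_iff (hm : m < n) (hs : s < k) (ht : t < k) :
    L.x m s ∈ L.edge m t ↔ s = t ∨ s = t + 1 ∨ (s = 0 ∧ t + 1 = k) := by
  have x_eq_iff : ∀ {u}, u < k → (L.x m s = L.x m u ↔ s = u) := fun hu =>
    (L.inj m hm).eq_iff hs hu
  rcases (show t + 1 ≤ k from ht).lt_or_eq with h | h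
  · rw [L.edge_eq h, Sym2.mem_iff, x_eq_iff ht, x_eq_iff h]
    omega
  · rw [L.edge_last h, Sym2.mem_iff, x_eq_iff ht, x_eq_iff (by omega)]
    omega

theorem exists_eq_x_of_mem_edge (ht : t < k) {v : V} (hv : v ∈ L.edge m t) :
    ∃ s < k, v = L.x m s := by
  rcases Sym2.mem_iff.1 hv with rfl | rfl
  exacts [⟨t, ht, rfl⟩, ⟨_, Nat.mod_lt _ (by omega), rfl⟩]

theorem lt_two_of_x_mem_oldVerts (hk : 3 ≤ k) (hm : m < n) (hs : s < k)
    (h : L.x m s ∈ L.oldVerts m) : s < 2 := by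
  by_contra hs2
  exact (L.attached hk hm).fresh s (by omega) hs h

theorem eq_edge_of_x_mem (hk : 3 ≤ k) (hm : m < n) (h2 : 2 ≤ s) (hs : s < k)
    (he : e ∈ L.edges (m + 1)) (hse : L.x m s ∈ e) : e = L.edge m s ∨ e = L.edge m (s - 1) := by
  rw [L.edges_succ (by omega)] at he
  rcases he with he | ⟨t, ⟨-, ht⟩, rfl⟩
  · exact absurd (lt_two_of_x_mem_oldVerts hk hm hs
      (L.mem_oldVerts_of_mem_oldEdges (by omega) he hse)) (by omega)
  · rcases (x_mem_edge_iff hm hs ht).1 hse with rfl | rfl | h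
    exacts [.inl rfl, .inr rfl, absurd h (by omega)]

theorem mem_edgeSet_of_mem_oldEdges (hk : 1 ≤ k) (hm : m < n) (he : e ∈ L.oldEdges m) :
    e ∈ G.edgeSet := by
  rcases he with ⟨i, hi, t, ht, rfl⟩ | rfl
  exacts [(L.edges_eq _).2 ⟨i, by omega, t, ht, rfl⟩, (L.edges_eq _).2 ⟨m, hm, 0, by omega, rfl⟩]

theorem edge_mem_edgeSet (hm : m < n) (ht : t < k) : L.edge m t ∈ G.edgeSet :=
  (L.edges_eq _).2 ⟨m, hm, t, ht, rfl⟩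

theorem pair_eq_zero {f : Sym2 V} (hq : AdjacentOnly G q) (he : e ∈ G.edgeSet)
    (hf : f ∈ G.edgeSet) (hef : e ≠ f) (h : ∀ v, v ∈ e → v ∉ f) : q e f + q f e = 0 := by
  rw [hq e he f hf hef fun ⟨v, hve, hvf⟩ => h v hve hvf,
    hq f hf e he hef.symm fun ⟨v, hvf, hve⟩ => h v hve hvf, add_zero]

theorem pair_path_eq_zero (hk : 3 ≤ k) (hm : m < n) (hq : AdjacentOnly G q) (ht : 1 ≤ t)
    (htu : t + 1 < u) (hu : u < k) :
    q (L.edge m t) (L.edge m u) + q (L.edge m u) (L.edge m t) = 0 := by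
  refine pair_eq_zero hq (edge_mem_edgeSet hm (by omega)) (edge_mem_edgeSet hm hu)
    (L.edge_ne hk hm (by omega) hu (by omega)) fun v hvt hvu => ?_
  obtain ⟨s, hs, rfl⟩ := exists_eq_x_of_mem_edge hu hvu
  rw [x_mem_edge_iff hm hs (by omega)] at hvt hvu
  omega

theorem pair_old_eq_zero (hk : 3 ≤ k) (hm : m < n) (hq : AdjacentOnly G q) (ht : 1 ≤ t)
    (htk : t < k) (he : e ∈ L.oldEdges m)
    (h : ∀ s < 2, L.x m s ∈ L.edge m t → L.x m s ∉ e) :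
    q (L.edge m t) e + q e (L.edge m t) = 0 := by
  refine pair_eq_zero hq (edge_mem_edgeSet hm htk) (mem_edgeSet_of_mem_oldEdges (by omega) hm he)
    (fun hte => L.edge_notMem_oldEdges hk hm ht htk (hte ▸ he)) fun v hvt hve => ?_
  obtain ⟨s, hs, rfl⟩ := exists_eq_x_of_mem_edge htk hvt
  have hold := L.mem_oldVerts_of_mem_oldEdges (by omega) he hve
  exact h s (lt_two_of_x_mem_oldVerts hk hm hs hold) hvt hve

theorem interaction_old_eq_zero (hk : 3 ≤ k) (hm : m < n) (hq : AdjacentOnly G q) (ht : 2 ≤ t)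
    (htk : t + 1 < k) {A : Finset (Sym2 V)} (hA : (A : Set (Sym2 V)) ⊆ L.oldEdges m) :
    interaction q (L.edge m t) A = 0 := by
  refine Finset.sum_eq_zero fun e he =>
    pair_old_eq_zero hk hm hq (by omega) (by omega) (hA he) fun s hs hst => ?_
  rw [x_mem_edge_iff hm (by omega) (by omega)] at hst
  omega

theorem interaction_base {c : Sym2 V → ℝ} {A : Finset (Sym2 V)} {j : Entry}
    (hA : L.OldAdmissible 0 j A) :
    interaction q (L.edge 0 t) A = if j ∈ trees then pairVal (L.input c q) 0 t 0 else 0 := by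
  rw [hA, interaction]
  split_ifs
  exacts [Finset.sum_singleton _ _, Finset.sum_empty]

theorem pair_far_eq_zero (hk : 3 ≤ k) (hm : m + 1 < n) (hq : AdjacentOnly G q)
    (hpos : 2 ≤ L.pos m) (hposk : L.pos m + 1 < k) (ht : 1 ≤ t) (htk : t < k)
    (he : e ∈ L.edges (m + 1)) (hnear : e ≠ L.edge m (L.pos m))
    (hprev : e ≠ L.edge m (L.pos m - 1)) (hnext : e ≠ L.edge m (L.pos m + 1)) :
    q (L.edge (m + 1) t) e + q e (L.edge (m + 1) t) = 0 := by
  refine pair_old_eq_zero hk hm hq ht htk (Or.inl he) fun s hs _ hse => ?_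
  have hshared : L.x (m + 1) s ∈ s(L.x (m + 1) 0, L.x (m + 1) 1) := by
    interval_cases s <;> simp
  rw [L.glue m hm, Nat.mod_eq_of_lt hposk, Sym2.mem_iff] at hshared
  rcases hshared with h | h <;> rw [h] at hse
  · exact (eq_edge_of_x_mem hk (by omega) hpos (by omega) he hse).elim hnear hprev
  · exact (eq_edge_of_x_mem hk (by omega) (by omega) hposk he hse).elim hnext hnear

theorem interaction_eq_nearPair {c : Sym2 V → ℝ} (hk : 4 ≤ k) (hm : m + 1 < n)
    (hq : AdjacentOnly G q) (ht : 1 ≤ t) (htk : t < k) {A : Finset (Sym2 V)} {j : Entry}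
    (hA : L.Admissible (m + 1) j A) :
    interaction q (L.edge (m + 1) t) A = nearPair (L.input c q) m t j := by
  classical
  obtain ⟨hpos, hposk⟩ := L.pos_free hk m (by omega)
  have edge_ne : ∀ {s u}, s < k → u < k → s ≠ u → L.edge m s ≠ L.edge m u :=
    L.edge_ne (by omega) (by omega)
  have sum_near := sum_eq_sum_ite_mem (S := A)
    (B := {L.edge m (L.pos m), L.edge m (L.pos m - 1), L.edge m (L.pos m + 1)})
    (f := fun e => q (L.edge (m + 1) t) e + q e (L.edge (m + 1) t)) fun e he hne => by
      simp only [Finset.mem_insert, Finset.mem_singleton, not_or] at hne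
      exact pair_far_eq_zero (by omega) hm hq hpos (by omega) ht htk (hA.subset_edges he) hne.1
        hne.2.1 hne.2.2
  rw [interaction, sum_near, Finset.sum_insert, Finset.sum_pair]
  · cases j <;> obtain ⟨-, hp, hprev, hnext⟩ := hA <;>
      simp only [Nat.add_sub_cancel] at hp hprev hnext <;>
      simp [hp, hprev, hnext, nearPair, nearEdges, Labelling.input]
  · exact edge_ne (by omega) (by omega) (by omega)
  · simp only [Finset.mem_insert, Finset.mem_singleton, not_or]
    exact ⟨edge_ne (by omega) (by omega) (by omega), edge_ne (by omega) (by omega) (by omega)⟩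

end Incidence

section FusionCost

variable {V : Type*} [DecidableEq V] {G : SimpleGraph V} {k n m d d₁ d₂ : ℕ} {L : Labelling G k n}
  {c : Sym2 V → ℝ} {q : Sym2 V → Sym2 V → ℝ} {A : Finset (Sym2 V)} {S : Finset ℕ}

theorem sum_image_edge (hk : 3 ≤ k) (hm : m < n) (hS : S ⊆ Finset.Ico 1 k) (g : Sym2 V → ℝ) :
    ∑ e ∈ S.image (L.edge m), g e = ∑ t ∈ S, g (L.edge m t) :=
  Finset.sum_image ((L.edge_injOn hk hm).mono fun _ ht => (Finset.mem_Ico.1 (hS ht)).2)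

theorem cost_combine (hk : 3 ≤ k) (hm : m < n) (hq : AdjacentOnly G q)
    (hA : (A : Set (Sym2 V)) ⊆ L.oldEdges m) (hS : S ⊆ Finset.Ico 1 k) :
    cost c q (L.combine m A S) = cost c q A + cost c q (S.image (L.edge m)) +
      ((if 1 ∈ S then interaction q (L.edge m 1) A else 0) +
        (if k - 1 ∈ S then interaction q (L.edge m (k - 1)) A else 0)) := by
  have disjoint : Disjoint A (S.image (L.edge m)) := by
    simp only [Finset.disjoint_right, Finset.mem_image]
    rintro _ ⟨t, ht, rfl⟩ htA
    have hIco := Finset.mem_Ico.1 (hS ht)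
    exact L.edge_notMem_oldEdges hk hm hIco.1 hIco.2 (hA htA)
  rw [combine, cost_union disjoint, sum_image_edge hk hm hS, sum_eq_sum_ite_mem (B := {1, k - 1}),
    Finset.sum_pair (by omega)]
  intro t ht hne
  have hIco := Finset.mem_Ico.1 (hS ht)
  simp only [Finset.mem_insert, Finset.mem_singleton] at hne
  exact interaction_old_eq_zero hk hm hq (by omega) (by omega) hA

theorem cost_image_insert (hk : 3 ≤ k) (hm : m < n) (hq : AdjacentOnly G q)
    (hS : S ⊆ Finset.Ico 1 k) (h1 : 1 ≤ d) (hd : d < k) (hdS : d ∉ S) :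
    cost c q ((insert d S).image (L.edge m)) = cost c q (S.image (L.edge m)) + c (L.edge m d) +
      (if d - 1 ∈ S then pairVal (L.input c q) m (d - 1) d else 0) +
      (if d + 1 ∈ S then pairVal (L.input c q) m d (d + 1) else 0) := by
  have hnotMem : L.edge m d ∉ S.image (L.edge m) := fun h => by
    obtain ⟨t, ht, he⟩ := Finset.mem_image.1 h
    exact hdS (L.edge_injOn hk hm (Finset.mem_Ico.1 (hS ht)).2 hd he ▸ ht)
  rw [Finset.image_insert, cost_insert hnotMem, interaction, sum_image_edge hk hm hS,
    sum_eq_sum_ite_mem (B := {d - 1, d + 1}), Finset.sum_pair (by omega), ← add_assoc,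
    add_comm (q (L.edge m d) (L.edge m (d - 1)))]
  · rfl
  · intro t ht hne
    have hIco := Finset.mem_Ico.1 (hS ht)
    simp only [Finset.mem_insert, Finset.mem_singleton] at hne
    have htd : t ≠ d := fun h => hdS (h ▸ ht)
    rcases Nat.lt_or_ge t d with hlt | hge
    · rw [add_comm]
      exact pair_path_eq_zero hk hm hq hIco.1 (by omega) hd
    · exact pair_path_eq_zero hk hm hq h1 (by omega) hIco.2

theorem cost_image_Ico (hk : 3 ≤ k) (hm : m < n) (hq : AdjacentOnly G q) {u : ℕ} (hu : 2 ≤ u)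
    (huk : u ≤ k) : cost c q ((Finset.Ico 1 u).image (L.edge m)) = c (L.edge m 1) +
      ∑ t ∈ Finset.Ico 2 u, (c (L.edge m t) + pairVal (L.input c q) m (t - 1) t) := by
  induction u, hu using Nat.le_induction with
  | base => simp [cost]
  | succ u hu ih =>
    rw [← Finset.insert_Ico_right_eq_Ico_add_one (by omega),
      cost_image_insert hk hm hq (Finset.Ico_subset_Ico_right (by omega)) (by omega) (by omega)
        (by simp), Finset.sum_Ico_succ_top hu, ih (by omega),
      if_pos (by rw [Finset.mem_Ico]; omega), if_neg (by simp)]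
    ring

theorem pathVal_eq (hk : 3 ≤ k) (hm : m < n) (hq : AdjacentOnly G q) :
    pathVal (L.input c q) m = cost c q ((kept k 0 0).image (L.edge m)) := by
  rw [kept_zero_zero, cost_image_Ico hk hm hq (by omega) le_rfl]
  rfl

theorem cost_image_kept (hk : 3 ≤ k) (hm : m < n) (hq : AdjacentOnly G q) (h₁ : 0 < d₁)
    (h₁k : d₁ < k) (hne : d₁ ≠ d₂) :
    cost c q ((kept k d₁ d₂).image (L.edge m)) =
      cost c q ((kept k 0 d₂).image (L.edge m)) - c (L.edge m d₁) -
        (if 1 < d₁ ∧ ¬ d₁ - 1 = d₂ then pairVal (L.input c q) m (d₁ - 1) d₁ else 0) -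
        (if d₁ + 1 < k ∧ ¬ d₁ + 1 = d₂ then pairVal (L.input c q) m d₁ (d₁ + 1) else 0) := by
  obtain ⟨hnotMem, hinsert⟩ := (insert_eq_kept_iff h₁ h₁k).2 ⟨hne, rfl⟩
  have hprev : d₁ - 1 ∈ kept k d₁ d₂ ↔ 1 < d₁ ∧ ¬ d₁ - 1 = d₂ := by rw [mem_kept]; omega
  have hnext : d₁ + 1 ∈ kept k d₁ d₂ ↔ d₁ + 1 < k ∧ ¬ d₁ + 1 = d₂ := by rw [mem_kept]; omega
  have hcost := cost_image_insert (L := L) (c := c) hk hm hq kept_subset h₁ h₁k hnotMem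
  rw [hinsert, if_congr hprev rfl rfl, if_congr hnext rfl rfl] at hcost
  linarith

theorem restVal_eq (hk : 3 ≤ k) (hm : m < n) (hq : AdjacentOnly G q) (h₁ : d₁ < k) (h₂ : d₂ < k)
    (hne : d₂ = 0 ∨ d₁ ≠ d₂) :
    restVal (L.input c q) m (pathVal (L.input c q) m) d₁ d₂ =
      cost c q ((kept k d₁ d₂).image (L.edge m)) := by
  have delete : ∀ {d d'}, d < k → d = 0 ∨ d ≠ d' →
      (if 0 < d then cost c q ((kept k 0 d').image (L.edge m)) - c (L.edge m d) -
        (if 1 < d ∧ ¬ d - 1 = d' then pairVal (L.input c q) m (d - 1) d else 0) -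
        (if d + 1 < k ∧ ¬ d + 1 = d' then pairVal (L.input c q) m d (d + 1) else 0)
      else cost c q ((kept k 0 d').image (L.edge m))) =
        cost c q ((kept k d d').image (L.edge m)) := by
    intro d d' hd hdd'
    rcases Nat.eq_zero_or_pos d with rfl | hpos
    · rw [if_neg (lt_irrefl 0)]
    · rw [if_pos hpos]
      exact (cost_image_kept hk hm hq hpos hd (hdd'.resolve_left hpos.ne')).symm
  have first := delete (d' := 0) h₁ (by omega)
  rw [if_congr (show 1 < d₁ ∧ ¬ d₁ - 1 = 0 ↔ 1 < d₁ by omega) rfl rfl,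
    if_congr (show d₁ + 1 < k ∧ ¬ d₁ + 1 = 0 ↔ d₁ + 1 < k by omega) rfl rfl,
    ← pathVal_eq hk hm hq, kept_comm (d₂ := 0)] at first
  rw [kept_comm, ← delete (d := d₂) (d' := d₁) h₂ (by omega), ← first]
  rfl

end FusionCost

end Labelling

/-! ### Correctness of the sweep -/

theorem del_lt_of_mem_cands {k p : ℕ} {j : Entry} {a : Candidate} (hp : 2 ≤ p) (hpk : p + 2 ≤ k)
    (h : a ∈ cands k p j) :
    a.del₁ < k ∧ a.del₂ < k ∧ (a.del₂ = 0 ∨ a.del₁ ≠ a.del₂) := by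
  cases j
  case T4 | F3 =>
    rcases h with ⟨-, h₁, h₂⟩ | ⟨t, ht, htk, htp, -, h₁, h₂⟩ <;> rw [h₁, h₂] <;> omega
  all_goals
    obtain ⟨-, h₁, h₂⟩ := h
    rw [h₁, h₂]
    omega

namespace Labelling

section Sweep

variable {V : Type*} {G : SimpleGraph V} {k n m d₁ d₂ : ℕ} {L : Labelling G k n}
  {c : Sym2 V → ℝ} {q : Sym2 V → Sym2 V → ℝ} {D : OldData}

/-- The fields `x` and `y` of `D` are the interaction costs of the old objects with the edges at
positions `1` and `k - 1` of cycle `m`. -/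
def InteractionCosts (L : Labelling G k n) (q : Sym2 V → Sym2 V → ℝ) (m : ℕ) (D : OldData) :
    Prop :=
  ∀ j A, L.OldAdmissible m j A → interaction q (L.edge m 1) A = D.x j ∧
    interaction q (L.edge m (k - 1)) A = D.y j

theorem interactionCosts_base (L : Labelling G k n) (c : Sym2 V → ℝ) (q : Sym2 V → Sym2 V → ℝ) :
    L.InteractionCosts q 0 (baseData (L.input c q)) :=
  fun _ _ hA => ⟨interaction_base hA, interaction_base hA⟩

theorem interactionCosts_next (hk : 4 ≤ k) (hm : m + 1 < n) (hq : AdjacentOnly G q) (s : State) :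
    L.InteractionCosts q (m + 1) (nextData (L.input c q) m s) := fun _ _ hA =>
  ⟨interaction_eq_nearPair hk hm hq le_rfl (by omega) hA,
    interaction_eq_nearPair hk hm hq (by omega) (by omega) hA⟩

variable [DecidableEq V]

/-- The lists of `D` name, without repetition, old objects of minimum cost before cycle `m` is
fused, and the field `z` of `D` consists of their costs. -/
def Solved (L : Labelling G k n) (c : Sym2 V → ℝ) (q : Sym2 V → Sym2 V → ℝ) (m : ℕ)
    (D : OldData) : Prop :=
  ∀ j, IsOptimal (cost c q) (L.OldAdmissible m j) (L.edgeFinset (D.list j)) ∧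
    D.z j = cost c q (L.edgeFinset (D.list j)) ∧
    ((D.list j).map fun a => L.edge a.1 a.2).Nodup

theorem cost_combine_kept (hk : 4 ≤ k) (hm : m < n) (hq : AdjacentOnly G q)
    (hD : L.InteractionCosts q m D) {j : Entry} {a : Candidate} (ha : a ∈ cands k (L.pos m) j)
    {A : Finset (Sym2 V)} (hA : L.OldAdmissible m a.old A) :
    cost c q (L.combine m A (kept k a.del₁ a.del₂)) = cost c q A - D.z a.old +
      candVal (L.input c q) m (pathVal (L.input c q) m) D a := by
  obtain ⟨hp, hpk⟩ := L.pos_free hk m hm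
  obtain ⟨h₁, h₂, hne⟩ := del_lt_of_mem_cands hp hpk ha
  have first : 1 ∈ kept k a.del₁ a.del₂ ↔ ¬ (a.del₁ = 1 ∨ a.del₂ = 1) := by rw [mem_kept]; omega
  have last : k - 1 ∈ kept k a.del₁ a.del₂ ↔ ¬ (a.del₁ = k - 1 ∨ a.del₂ = k - 1) := by
    rw [mem_kept]; omega
  rw [cost_combine (by omega) hm hq (hA.subset_oldEdges hk hm) kept_subset, (hD _ A hA).1,
    (hD _ A hA).2, candVal, restVal_eq (by omega) hm hq h₁ h₂ hne, if_congr first rfl rfl,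
    if_congr last rfl rfl, show (L.input c q).k = k from rfl]
  ring

theorem edgeFinset_pathList (i : ℕ) (l : List (ℕ × ℕ)) :
    L.edgeFinset (pathList k i d₁ d₂ l) = L.combine i (L.edgeFinset l) (kept k d₁ d₂) := by
  ext e
  simp only [edgeFinset, pathList, combine, List.mem_toFinset, Finset.mem_union, Finset.mem_image,
    List.map_append, List.mem_append, List.mem_map, List.mem_reverse, List.mem_filter,
    List.mem_range'_1, mem_kept, decide_eq_true_eq]
  rw [or_comm]
  refine or_congr_right ⟨?_, ?_⟩
  · rintro ⟨_, ⟨t, ht, rfl⟩, rfl⟩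
    exact ⟨t, by omega, rfl⟩
  · rintro ⟨t, ht, rfl⟩
    exact ⟨_, ⟨t, by omega, rfl⟩, rfl⟩

theorem nodup_pathList (hk : 3 ≤ k) (hm : m < n) {l : List (ℕ × ℕ)}
    (hl : (l.map fun a => L.edge a.1 a.2).Nodup)
    (hA : (L.edgeFinset l : Set (Sym2 V)) ⊆ L.oldEdges m) :
    ((pathList k m d₁ d₂ l).map fun a => L.edge a.1 a.2).Nodup := by
  rw [pathList, List.map_append, List.nodup_append']
  refine ⟨?_, hl, ?_⟩
  · rw [List.map_reverse, List.nodup_reverse, List.map_map]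
    refine List.Nodup.map_on (fun s hs t ht h => ?_) (List.Nodup.filter _ List.nodup_range')
    rw [List.mem_filter, List.mem_range'_1] at hs ht
    exact L.edge_injOn hk hm (show s < k by omega) (show t < k by omega) h
  · rw [List.disjoint_left]
    intro e he hel
    simp only [List.mem_map, List.mem_reverse, List.mem_filter, List.mem_range'_1] at he
    obtain ⟨_, ⟨t, ⟨ht, -⟩, rfl⟩, rfl⟩ := he
    exact L.edge_notMem_oldEdges hk hm (t := t) (by omega) (by omega)
      (hA (List.mem_toFinset.2 hel))

theorem Solved.next (hk : 4 ≤ k) (hm : m < n) (hq : AdjacentOnly G q) (h : L.Solved c q m D)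
    (hD : L.InteractionCosts q m D) {s : State} (hs : Updated (L.input c q) m D s) :
    L.Solved c q (m + 1) s.oldData := by
  intro j
  obtain ⟨a, ha, hmin, hz, hl⟩ := hs j
  obtain ⟨hopt, hcost, hnodup⟩ := h a.old
  have hlist : s.oldData.list j = pathList k m a.del₁ a.del₂ (D.list a.old) := hl
  have hz' : s.oldData.z j = cost c q (L.edgeFinset (s.oldData.list j)) := by
    rw [hlist, edgeFinset_pathList, cost_combine_kept hk hm hq hD ha hopt.1, hcost, sub_self,
      zero_add]
    exact hz
  refine ⟨⟨?_, fun T hT => ?_⟩, hz', ?_⟩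
  · rw [hlist, edgeFinset_pathList]
    exact (admissible_iff hk hm).2 ⟨a, ha, _, hopt.1, rfl⟩
  · obtain ⟨b, hb, A, hA, rfl⟩ := (admissible_iff hk hm).1 hT
    have hab : s.oldData.z j ≤ candVal (L.input c q) m (pathVal (L.input c q) m) D b :=
      hz.trans_le (hmin hb)
    have hbA : D.z b.old ≤ cost c q A := (h b.old).2.1.trans_le ((h b.old).1.2 A hA)
    rw [← hz', cost_combine_kept hk hm hq hD hb hA]
    linarith
  · rw [hlist]
    exact nodup_pathList (by omega) hm hnodup (hopt.1.subset_oldEdges hk hm)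

theorem solved_base (L : Labelling G k n) (c : Sym2 V → ℝ) (q : Sym2 V → Sym2 V → ℝ) :
    L.Solved c q 0 (baseData (L.input c q)) := by
  intro j
  by_cases hj : j ∈ trees <;>
    simp [baseData, IsOptimal, OldAdmissible, edgeFinset, cost, hj, Labelling.input]

theorem solved_sweep (hk : 4 ≤ k) (hq : AdjacentOnly G q) (hm : 1 ≤ m) (hmn : m ≤ n) {e : NExp}
    (he : ∀ s, e.eval (L.input c q) s = m) (s : State) :
    L.Solved c q m ((sweep e).exec (L.input c q) s).1.oldData :=
  exec_sweep (show 2 ≤ k by omega) hm he (fun v s => L.Solved c q v s.oldData)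
    (fun _ hs => (L.solved_base c q).next hk (by omega) hq (L.interactionCosts_base c q) hs)
    (fun _ s _ _ h hs => Solved.next hk (by omega) hq (D := nextData _ _ s) h
      (interactionCosts_next hk (by omega) hq s) hs) s

end Sweep

end Labelling

/-! ### The search through an explicit list of trees -/

section ExplicitLists

variable {I : Input} {s s' : State}

theorem NExp.eval_congr (h : s'.nat = s.nat) (a : NExp) : a.eval I s' = a.eval I s := by
  induction a with
  | reg r => simp only [NExp.eval, h]
  | num | k | n => rfl
  | pos a iha => simp only [NExp.eval, iha]
  | add a b iha ihb | sub a b iha ihb => simp only [NExp.eval, iha, ihb]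

theorem EExp.eval_congr (h : s'.nat = s.nat) : EExp.eval I s' = EExp.eval I s := by
  funext e
  simp only [EExp.eval, NExp.eval_congr h]

/-- The cost of the set of edges named by a list. -/
def listVal (I : Input) : List (ℕ × ℕ) → ℝ
  | [] => 0
  | a :: l => I.c a + (l.map fun b => I.q a b + I.q b a).sum + listVal I l

theorem eval_listCost (es : List EExp) :
    (listCost es).eval I s = listVal I (es.map (EExp.eval I s)) := by
  have eval_sumExp : ∀ (e : EExp) (es : List EExp), (sumExp (es.map (pairCost e))).eval I s =
      ((es.map (EExp.eval I s)).map fun b => I.q (e.eval I s) b + I.q b (e.eval I s)).sum := by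
    intro e es
    induction es with
    | nil => rfl
    | cons f es ih => simp [sumExp, RExp.eval, pairCost, ih]
  induction es with
  | nil => rfl
  | cons e es ih => simp only [listCost, RExp.eval, ih, eval_sumExp, List.map_cons, listVal]

/-- The output registers of `s` hold a list in `S` of minimum cost, and its cost. The list is
reversed, since its edges are inserted one by one at the head. -/
def BestList (I : Input) (S : Set (List (ℕ × ℕ))) (s : State) : Prop :=
  ∃ l ∈ S, IsMinOn (listVal I) S l ∧ s.real .best = listVal I l ∧ s.list .out = l.reverse

theorem exec_insertions (es : List EExp) (s : State) :
    ((seqs (es.map fun e => Cmd.list .out (.cons e .out))).exec I s).1 =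
      s.setList .out ((es.map (EExp.eval I s)).reverse ++ s.list .out) := by
  induction es generalizing s with
  | nil => simp [State.setList, Function.update_eq_self]
  | cons e es ih =>
    rw [List.map_cons, exec_seqs_cons, exec_list, ih,
      EExp.eval_congr (s := s) (s' := s.setList _ _) rfl]
    simp [State.setList, LExp.eval]

theorem exec_takeList (es : List EExp) (s : State) :
    ((takeList es).exec I s).1.real .best = s.real .cand ∧
      ((takeList es).exec I s).1.list .out = (es.map (EExp.eval I s)).reverse := by
  rw [takeList, exec_seqs_cons, exec_seqs_cons, exec_seqs_cons, exec_seqs_nil, exec_insertions,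
    exec_list, exec_real, EExp.eval_congr (s := s) (s' := (s.setReal _ _).setList _ _) rfl]
  simp [RExp.eval, LExp.eval]

theorem exec_takeList_setReal_cand (es : List EExp) (s : State) :
    let s' := ((takeList es).exec I (s.setReal .cand ((listCost es).eval I s))).1
    s'.real .best = listVal I (es.map (EExp.eval I s)) ∧
      s'.list .out = (es.map (EExp.eval I s)).reverse := by
  intro s'
  obtain ⟨hbest, hout⟩ : s'.real .best = _ ∧ s'.list .out = _ :=
    exec_takeList es (s.setReal .cand ((listCost es).eval I s))
  rw [EExp.eval_congr (s := s) (s' := s.setReal _ _) rfl] at hout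
  rw [hbest, ← eval_listCost]
  exact ⟨by simp, hout⟩

theorem bestList_startList (es : List EExp) (s : State) :
    BestList I {es.map (EExp.eval I s)} ((startList es).exec I s).1 := by
  refine ⟨_, rfl, ?_, exec_takeList_setReal_cand es s⟩
  rintro _ rfl
  exact le_refl (listVal I _)

theorem BestList.considerList {S : Set (List (ℕ × ℕ))} (h : BestList I S s) (es : List EExp) :
    BestList I (insert (es.map (EExp.eval I s)) S) ((considerList es).exec I s).1 := by
  classical
  obtain ⟨l, hl, hmin, hbest, hout⟩ := h
  have hholds : (BExp.rlt (.reg .cand) (.reg .best)).holds I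
      (s.setReal .cand ((listCost es).eval I s)) ↔
      listVal I (es.map (EExp.eval I s)) < listVal I l := by
    simp [BExp.holds, RExp.eval, eval_listCost, hbest]
  rw [AQMST.considerList, exec_seqs_cons, exec_seqs_cons, exec_seqs_nil, exec_real, exec_cond,
    if_congr hholds rfl rfl]
  split_ifs with hlt
  · refine ⟨_, Set.mem_insert _ _, ?_, exec_takeList_setReal_cand es s⟩
    rintro l' (rfl | hl')
    exacts [le_refl (listVal I _), hlt.le.trans (hmin hl')]
  · refine ⟨l, Set.mem_insert_of_mem _ hl, ?_, by simpa using hbest, by simpa using hout⟩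
    rintro l' (rfl | hl')
    exacts [not_lt.1 hlt, hmin hl']

/-- The spanning trees of a triangle. -/
def triangleTrees : Set (List (ℕ × ℕ)) :=
  {l | ∃ t u, t < u ∧ u < 3 ∧ l = [(0, t), (0, u)]}

/-- The spanning trees of two triangles that share the edge at position `p` of the first one, up to
those that contain both other edges of the second one and an edge of the first one at a
position at least `v`. -/
def twoTriangleTrees (p v : ℕ) : Set (List (ℕ × ℕ)) :=
  {l | (∃ l₀ ∈ triangleTrees, ∃ u, (u = 1 ∨ u = 2) ∧ l = l₀ ++ [(1, u)]) ∨
    ∃ t < v, t ≠ p ∧ l = [(0, t), (1, 1), (1, 2)]}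

theorem triangleTrees_eq :
    triangleTrees = {[(0, 1), (0, 2)], [(0, 0), (0, 2)], [(0, 0), (0, 1)]} := by
  ext l
  constructor
  · rintro ⟨t, u, htu, hu, rfl⟩
    interval_cases u <;> interval_cases t <;> simp
  · rintro (rfl | rfl | rfl)
    exacts [⟨1, 2, by simp⟩, ⟨0, 2, by simp⟩, ⟨0, 1, by simp⟩]

theorem twoTriangleTrees_zero (p : ℕ) : twoTriangleTrees p 0 =
    {[(0, 1), (0, 2), (1, 2)], [(0, 1), (0, 2), (1, 1)], [(0, 0), (0, 2), (1, 2)],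
      [(0, 0), (0, 2), (1, 1)], [(0, 0), (0, 1), (1, 2)], [(0, 0), (0, 1), (1, 1)]} := by
  ext l
  simp only [twoTriangleTrees, triangleTrees_eq, Set.mem_insert_iff, Set.mem_singleton_iff,
    Set.mem_ofPred_eq, exists_eq_left, or_and_right, exists_or, List.cons_append, List.nil_append,
    not_lt_zero, false_and, exists_false, or_false]
  tauto

theorem twoTriangleTrees_succ_self (p : ℕ) :
    twoTriangleTrees p (p + 1) = twoTriangleTrees p p := by
  ext l
  exact or_congr_right (exists_congr fun t => by grind)

theorem twoTriangleTrees_succ {p v : ℕ} (h : v ≠ p) :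
    twoTriangleTrees p (v + 1) = insert [(0, v), (1, 1), (1, 2)] (twoTriangleTrees p v) := by
  ext l
  simp only [twoTriangleTrees, Set.mem_insert_iff, Set.mem_ofPred_eq]
  grind

theorem bestList_small_of_eq_one (hn : I.n = 1) (s : State) :
    BestList I triangleTrees (small.exec I s).1 := by
  have hholds : (BExp.eq .n (.num 1)).holds I s := hn
  rw [small, Cmd.exec, if_pos hholds, triangleTrees_eq]
  exact ((bestList_startList [fixed 0 0, fixed 0 1] s).considerList
    [fixed 0 0, fixed 0 2]).considerList [fixed 0 1, fixed 0 2]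

theorem bestList_small_of_ne_one (hn : I.n ≠ 1) (s : State) :
    BestList I (twoTriangleTrees (I.pos 0) 3) (small.exec I s).1 := by
  classical
  have hholds : ¬ (BExp.eq .n (.num 1)).holds I s := hn
  rw [small, Cmd.exec, if_neg hholds]
  refine exec_loop (a := 0) (b := 3) (fun v s => BestList I (twoTriangleTrees (I.pos 0) v) s)
    rfl rfl (by omega) ?_ ?_
  · rw [twoTriangleTrees_zero]
    exact (((((bestList_startList [fixed 0 0, fixed 0 1, fixed 1 1] s).considerList
      [fixed 0 0, fixed 0 1, fixed 1 2]).considerList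
      [fixed 0 0, fixed 0 2, fixed 1 1]).considerList
      [fixed 0 0, fixed 0 2, fixed 1 2]).considerList
      [fixed 0 1, fixed 0 2, fixed 1 1]).considerList [fixed 0 1, fixed 0 2, fixed 1 2]
  · rintro v s' - - h
    replace h : BestList I (twoTriangleTrees (I.pos 0) v) (s'.setNat .t v) := h
    have hne : (BExp.not (.eq (.reg .t) (.pos (.num 0)))).holds I (s'.setNat .t v) ↔
        v ≠ I.pos 0 := by
      simp [BExp.holds, NExp.eval]
    rw [exec_cond, if_congr hne rfl rfl]
    split_ifs with hv
    · rw [twoTriangleTrees_succ hv]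
      simpa [EExp.eval, NExp.eval, fixed] using
        h.considerList [⟨.num 0, .reg .t⟩, fixed 1 1, fixed 1 2]
    · obtain rfl := not_ne_iff.1 hv
      rw [twoTriangleTrees_succ_self]
      exact h

end ExplicitLists

namespace Labelling

/-! ### Ladders of triangles -/

section Triangles

variable {V : Type*} {G : SimpleGraph V} {n m : ℕ} {L : Labelling G 3 n}

theorem nodup_triangleTrees (hn : 0 < n) {l : List (ℕ × ℕ)} (hl : l ∈ triangleTrees) :
    (l.map fun a => L.edge a.1 a.2).Nodup := by
  obtain ⟨t, u, htu, hu, rfl⟩ := hl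
  simpa using L.edge_ne le_rfl hn (htu.trans hu) hu htu.ne

theorem nodup_twoTriangleTrees (hn : 1 < n) {p : ℕ} {l : List (ℕ × ℕ)}
    (hl : l ∈ twoTriangleTrees p 3) : (l.map fun a => L.edge a.1 a.2).Nodup := by
  have hne : ∀ {t u : ℕ}, t < 3 → 1 ≤ u → u < 3 → L.edge 0 t ≠ L.edge 1 u := fun ht h1 hu h =>
    L.edge_notMem_oldEdges le_rfl hn h1 hu (h ▸ .inl ⟨0, one_pos, _, ht, rfl⟩)
  rcases hl with ⟨l, hl, u, hu, rfl⟩ | ⟨t, ht, -, rfl⟩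
  · rw [List.map_append, List.nodup_append']
    refine ⟨nodup_triangleTrees (one_pos.trans hn) hl, by simp, ?_⟩
    obtain ⟨t, t', htt', ht', rfl⟩ := hl
    simp [(hne (htt'.trans ht') (by omega : 1 ≤ u) (by omega)).symm,
      (hne ht' (by omega : 1 ≤ u) (by omega)).symm]
  · simp [hne ht le_rfl (by omega), hne ht one_le_two (by omega),
      L.edge_ne le_rfl hn (by omega : 1 < 3) (by omega : 2 < 3) (by omega)]

variable {A T : Finset (Sym2 V)}

theorem spanningTree_succ_iff_of_three [DecidableEq V] (hm : m < n) :
    L.SpanningTree (m + 1) T ↔ (∃ A, L.OldForest m A ∧ T = L.combine m A {1, 2}) ∨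
      ∃ A, L.OldTree m A ∧ ∃ t, (t = 1 ∨ t = 2) ∧ T = L.combine m A {t} := by
  constructor
  · intro hT
    obtain ⟨A, S, hA, hS, rfl⟩ := exists_combine (by omega) hT.1
    rcases (spanningTree_combine_iff hA hS le_rfl hm).1 hT with
      ⟨hforest, rfl⟩ | ⟨t, ⟨ht1, ht3⟩, htree, rfl⟩
    · exact .inl ⟨A, hforest, rfl⟩
    · refine .inr ⟨A, htree, 3 - t, by omega, ?_⟩
      interval_cases t <;> rfl
  · rintro (⟨A, hforest, rfl⟩ | ⟨A, htree, t, ht, rfl⟩)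
    · exact (spanningTree_combine_iff hforest.1 (by decide) le_rfl hm).2 (.inl ⟨hforest, rfl⟩)
    · refine (spanningTree_combine_iff htree.1 ?_ le_rfl hm).2
        (.inr ⟨3 - t, by omega, htree, ?_⟩) <;> rcases ht with rfl | rfl <;> decide

theorem spanningTree_one_iff [DecidableEq V] (hn : 0 < n) : L.SpanningTree 1 T ↔
    ∃ t u, t < u ∧ u < 3 ∧ T = {L.edge 0 t, L.edge 0 u} := by
  simp only [spanningTree_succ_iff_of_three hn, oldForest_zero_iff le_rfl hn,
    oldTree_zero_iff le_rfl hn, exists_eq_left]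
  constructor
  · rintro (rfl | ⟨t, ht, rfl⟩)
    · exact ⟨1, 2, by simp [combine]⟩
    · exact ⟨0, t, by omega, by omega, by simp [combine]⟩
  · rintro ⟨t, u, htu, hu, rfl⟩
    rcases Nat.eq_zero_or_pos t with rfl | ht
    · exact .inr ⟨u, by omega, by simp [combine]⟩
    · obtain ⟨rfl, rfl⟩ : t = 1 ∧ u = 2 := by omega
      simp [combine]

theorem oldForest_one_iff (hn : 1 < n) :
    L.OldForest 1 A ↔ ∃ t < 3, t ≠ L.pos 0 ∧ A = {L.edge 0 t} := by
  classical
  have hp := L.pos_lt 0 (by omega)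
  have hglue : L.edge 1 0 = L.edge 0 (L.pos 0) := (L.edge_eq (by omega)).trans (L.glue 0 hn)
  rw [oldForest_iff le_rfl hn, oldTree_succ_iff le_rfl hn, spanningTree_one_iff (by omega), hglue]
  generalize L.pos 0 = p at hp
  constructor
  · rintro ⟨hpA, t, u, htu, hu, hA⟩
    have hne := L.edge_ne le_rfl (one_pos.trans hn) (htu.trans hu) hu htu.ne
    have hp_mem : L.edge 0 p ∈ ({L.edge 0 t, L.edge 0 u} : Finset _) :=
      hA ▸ Finset.mem_insert_self _ _
    rw [← Finset.erase_insert hpA, hA]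
    rw [Finset.mem_insert, Finset.mem_singleton] at hp_mem
    rcases hp_mem with hpt | hpu
    · exact ⟨u, hu, by rintro rfl; exact hne hpt.symm,
        by rw [hpt, Finset.erase_insert (by simpa using hne)]⟩
    · exact ⟨t, htu.trans hu, by rintro rfl; exact hne hpu,
        by rw [hpu, Finset.pair_comm, Finset.erase_insert (by simpa using hne.symm)]⟩
  · rintro ⟨t, ht, htp, rfl⟩
    refine ⟨by simpa using L.edge_ne le_rfl (one_pos.trans hn) hp ht htp.symm, ?_⟩
    rcases htp.lt_or_gt with h | h
    exacts [⟨t, p, h, hp, Finset.pair_comm _ _⟩, ⟨p, t, h, ht, rfl⟩]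

variable [DecidableEq V]

theorem spanningTree_one_iff_triangleTrees (hn : 0 < n) :
    L.SpanningTree 1 T ↔ ∃ l ∈ triangleTrees, T = L.edgeFinset l := by
  rw [spanningTree_one_iff hn]
  constructor
  · rintro ⟨t, u, htu, hu, rfl⟩
    exact ⟨_, ⟨t, u, htu, hu, rfl⟩, by simp [edgeFinset]⟩
  · rintro ⟨_, ⟨t, u, htu, hu, rfl⟩, rfl⟩
    exact ⟨t, u, htu, hu, by simp [edgeFinset]⟩

theorem spanningTree_two_iff (hn : 1 < n) :
    L.SpanningTree 2 T ↔ ∃ l ∈ twoTriangleTrees (L.pos 0) 3, T = L.edgeFinset l := by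
  have happend : ∀ l u, L.edgeFinset (l ++ [(1, u)]) = L.combine 1 (L.edgeFinset l) {u} := by
    simp [edgeFinset, combine]
  have hpair : ∀ t, L.edgeFinset [(0, t), (1, 1), (1, 2)] = L.combine 1 {L.edge 0 t} {1, 2} := by
    simp [edgeFinset, combine, Finset.insert_comm]
  simp only [spanningTree_succ_iff_of_three hn, oldForest_one_iff hn, oldTree_succ_iff le_rfl hn,
    spanningTree_one_iff_triangleTrees (one_pos.trans hn)]
  constructor
  · rintro (⟨_, ⟨t, ht, htp, rfl⟩, rfl⟩ | ⟨_, ⟨l, hl, rfl⟩, u, hu, rfl⟩)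
    exacts [⟨_, .inr ⟨t, ht, htp, rfl⟩, (hpair t).symm⟩,
      ⟨_, .inl ⟨l, hl, u, hu, rfl⟩, (happend l u).symm⟩]
  · rintro ⟨_, ⟨l, hl, u, hu, rfl⟩ | ⟨t, ht, htp, rfl⟩, rfl⟩
    exacts [.inr ⟨_, ⟨l, hl, rfl⟩, u, hu, happend l u⟩,
      .inl ⟨_, ⟨t, ht, htp, rfl⟩, hpair t⟩]

end Triangles

/-! ### The output -/

section Output

variable {V : Type*} {G : SimpleGraph V} {k n : ℕ} {L : Labelling G k n}

theorem isSpanningTree_iff {T : Finset (Sym2 V)} : IsSpanningTree G T ↔ L.SpanningTree n T := by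
  have hE : G.edgeSet = L.edges n := by
    ext e
    rw [L.edges_eq]
    constructor <;> rintro ⟨i, hi, t, ht, rfl⟩ <;> exact ⟨i, hi, t, ht, rfl⟩
  have hV : ∀ v, v ∈ L.verts n := L.verts_eq
  have : Nonempty V := ⟨L.x 0 0⟩
  rw [IsSpanningTree, SpanningTree, hE, SimpleGraph.isTree_iff, SimpleGraph.connected_iff,
    SimpleGraph.Preconnected]
  constructor
  · rintro ⟨hsubset, ⟨hreach, -⟩, hacyclic⟩
    exact ⟨hsubset, hacyclic, fun u _ w _ => hreach u w⟩
  · rintro ⟨hsubset, hacyclic, hreach⟩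
    exact ⟨hsubset, ⟨fun u w => hreach u (hV u) w (hV w), this⟩, hacyclic⟩

variable [DecidableEq V] {c : Sym2 V → ℝ} {q : Sym2 V → Sym2 V → ℝ}

theorem listVal_eq {l : List (ℕ × ℕ)} (hl : (l.map fun a => L.edge a.1 a.2).Nodup) :
    listVal (L.input c q) l = cost c q (L.edgeFinset l) := by
  induction l with
  | nil => simp [listVal, edgeFinset, cost_empty]
  | cons a l ih =>
    rw [List.map_cons, List.nodup_cons] at hl
    have hinsert : L.edgeFinset (a :: l) = insert (L.edge a.1 a.2) (L.edgeFinset l) := by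
      simp [edgeFinset]
    have hnew : L.edge a.1 a.2 ∉ L.edgeFinset l := by
      simpa only [edgeFinset, List.mem_toFinset] using hl.1
    have hinteraction : interaction q (L.edge a.1 a.2) (L.edgeFinset l) =
        (l.map fun b => (L.input c q).q a b + (L.input c q).q b a).sum := by
      rw [interaction, edgeFinset, List.sum_toFinset _ hl.2, List.map_map]
      rfl
    rw [hinsert, cost_insert hnew, hinteraction, listVal, ih hl.2]
    change c (L.edge a.1 a.2) + _ + _ = _
    ring

/-- The output registers of `s` hold an optimal spanning tree, as a list that names each of its
edges once, and its cost. -/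
def Correct (L : Labelling G k n) (c : Sym2 V → ℝ) (q : Sym2 V → Sym2 V → ℝ) (s : State) : Prop :=
  ((s.list .out).map fun a => L.edge a.1 a.2).Nodup ∧
    IsOptimal (cost c q) (IsSpanningTree G) (L.edgeFinset (s.list .out)) ∧
    s.real .best = cost c q (L.edgeFinset (s.list .out))

theorem correct_of_bestList {S : Set (List (ℕ × ℕ))} {s : State} (h : BestList (L.input c q) S s)
    (hnodup : ∀ l ∈ S, (l.map fun a => L.edge a.1 a.2).Nodup)
    (hS : ∀ T, IsSpanningTree G T ↔ ∃ l ∈ S, T = L.edgeFinset l) : L.Correct c q s := by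
  obtain ⟨l, hl, hmin, hbest, hout⟩ := h
  have hrev : L.edgeFinset l.reverse = L.edgeFinset l := by
    rw [edgeFinset, edgeFinset, List.map_reverse, List.toFinset_reverse]
  rw [Correct, hout, hrev, List.map_reverse, List.nodup_reverse, hbest, listVal_eq (hnodup l hl)]
  refine ⟨hnodup l hl, ⟨(hS _).2 ⟨l, hl, rfl⟩, fun T hT => ?_⟩, rfl⟩
  obtain ⟨l', hl', rfl⟩ := (hS T).1 hT
  rw [← listVal_eq (hnodup l hl), ← listVal_eq (hnodup l' hl')]
  exact hmin hl'

theorem correct_small {L : Labelling G 3 n} (hn : n = 1 ∨ n = 2) (s : State) :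
    L.Correct c q (small.exec (L.input c q) s).1 := by
  rcases hn with rfl | rfl
  · exact correct_of_bestList (bestList_small_of_eq_one rfl s)
      (fun _ => nodup_triangleTrees one_pos)
      fun _ => isSpanningTree_iff.trans (spanningTree_one_iff_triangleTrees one_pos)
  · exact correct_of_bestList (bestList_small_of_ne_one (show 2 ≠ 1 by omega) s)
      (fun _ => nodup_twoTriangleTrees one_lt_two)
      fun _ => isSpanningTree_iff.trans (spanningTree_two_iff one_lt_two)

theorem correct_sweep (hk : 4 ≤ k) (hn : 1 ≤ n) (hq : AdjacentOnly G q) (s : State) :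
    L.Correct c q ((Cmd.seq (sweep .n) finish).exec (L.input c q) s).1 := by
  have hsolved := solved_sweep (L := L) (c := c) hk hq hn le_rfl (e := .n) (fun _ => rfl) s
  obtain ⟨j, hj, hmin, hbest, hout⟩ :=
    selected_finish (I := L.input c q) ((sweep .n).exec (L.input c q) s).1
  obtain ⟨hopt, hcost, hnodup⟩ := hsolved j
  obtain ⟨m, rfl⟩ : ∃ m, n = m + 1 := ⟨n - 1, by omega⟩
  change L.Correct c q (finish.exec (L.input c q) ((sweep .n).exec (L.input c q) s).1).1
  rw [Correct, hout]
  refine ⟨hnodup, ⟨isSpanningTree_iff.2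
    ((exists_trees_admissible_iff hk m.lt_succ_self).1 ⟨j, hj, hopt.1⟩), fun T hT => ?_⟩,
    hbest.trans hcost⟩
  obtain ⟨j', hj', hT'⟩ :=
    (exists_trees_admissible_iff hk m.lt_succ_self).2 ((isSpanningTree_iff (L := L)).1 hT)
  obtain ⟨hopt', hcost', -⟩ := hsolved j'
  calc cost c q _ = _ := hcost.symm
    _ ≤ _ := hmin hj'
    _ = cost c q _ := hcost'
    _ ≤ cost c q T := hopt'.2 T hT'

theorem correct_ladderAlgorithm (hG : IsLadder k n G) (hq : AdjacentOnly G q) (s : State) :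
    L.Correct c q (ladderAlgorithm.exec (L.input c q) s).1 := by
  obtain ⟨hk, F, hF⟩ := hG
  rw [ladderAlgorithm, Cmd.exec]
  split_ifs with h
  · change k < 4 at h
    obtain rfl : k = 3 := by omega
    have hn := hF.one_le
    have hn' := hF.le_two
    exact correct_small (by omega) s
  · change ¬ k < 4 at h
    exact correct_sweep (by omega) hF.one_le hq s

end Output

end Labelling

end AQMST

theorem mainTheorem6 : ∃ C : ℕ, ∀ {V : Type*} [DecidableEq V] (k n : ℕ) (G : SimpleGraph V),
    AQMST.IsLadder k n G →
      -- every ladder can be presented to the algorithm, and for every presentation and all costs: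
      Nonempty (AQMST.Labelling G k n) ∧
      ∀ (L : AQMST.Labelling G k n) (c : Sym2 V → ℝ) (q : Sym2 V → Sym2 V → ℝ)
        (s₀ : AQMST.State), AQMST.AdjacentOnly G q →
        let I := L.input c q
        let final := (AQMST.ladderAlgorithm.exec I s₀).1
        let steps := (AQMST.ladderAlgorithm.exec I s₀).2
        let T := L.edgeFinset (final.list .out)
        -- the running time
        steps ≤ C * (k * n) ∧
        -- the output is an optimal tree, each edge listed once, together with its cost
        ((final.list .out).map fun a => L.edge a.1 a.2).Nodup ∧
        AQMST.IsOptimal (AQMST.cost c q) (AQMST.IsSpanningTree G) T ∧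
        final.real .best = AQMST.cost c q T ∧
        -- after the first `m` cycles the seven objects and their costs are known
        (4 ≤ k → ∀ m, 1 ≤ m → m ≤ n → ∀ j : AQMST.Entry,
          let s := ((AQMST.sweep (.num m)).exec I s₀).1
          AQMST.IsOptimal (AQMST.cost c q) (L.Admissible m j) (L.edgeFinset (s.list (.tree j))) ∧
          s.real (.z j) = AQMST.cost c q (L.edgeFinset (s.list (.tree j)))) := by
  obtain ⟨C, hC⟩ := AQMST.runs_ladderAlgorithm
  refine ⟨C, fun k n G hG => ⟨hG.nonempty_labelling, fun L c q s₀ hq => ?_⟩⟩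
  obtain ⟨hnodup, hopt, hbest⟩ := AQMST.Labelling.correct_ladderAlgorithm (c := c) hG hq s₀
  obtain ⟨hk, F, hF⟩ := hG
  have hsteps := hC (L.input c q) (show 1 ≤ k by omega) hF.one_le s₀
  rw [pow_one, pow_one] at hsteps
  refine ⟨hsteps, hnodup, hopt, hbest, fun hk4 m hm hmn j => ?_⟩
  have hsolved := AQMST.Labelling.solved_sweep (L := L) (c := c) hk4 hq hm hmn (e := .num m)
    (fun _ => rfl) s₀ j
  obtain ⟨m, rfl⟩ := Nat.exists_eq_add_of_le' hm
  exact ⟨hsolved.1, hsolved.2.1⟩
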